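/- Let $0<R_0<R_1$. In $\mathbb{R}^2$ let $B_i$ be the open disk of radius $R_i$ centred at $(0,R_i)$, $i=0,1$, so that the two disks touch at the origin $O$. Put $\Omega_1=B_1\setminus\overline{B_0}$ (the cuspidal annulus), $\Gamma_0=\partial B_0$, $\Gamma_1=\partial B_1$. Let $H^1_0(\Omega_1,\Gamma_0)$ be the space of functions of $H^1(\Omega_1)$ with zero trace on $\Gamma_0$, that is, the closure in $H^1(\Omega_1)$ of the smooth functions vanishing near $\Gamma_0$. Let $\lambda\ge 0$, $c_0\in\mathbb{R}$, and let $u\in H^1(\Omega_1)$ be a weak solution of $$-\Delta u=\lambda u\ \text{ in }\Omega_1,\qquad \partial_\nu u=0\ \text{ on }\Gamma_1\setminus O,\qquad u=c_0\ \text{ on }\Gamma_0\setminus O,$$ i.e. $u-c_0\in H^1_0(\Omega_1,\Gamma_0)$ and $(\nabla u,\nabla v)_{\Omega_1}=\lambda(u,v)_{\Omega_1}$ for all $v\in H^1_0(\Omega_1,\Gamma_0)$. Put $H_i(x_1)=R_i-\sqrt{R_i^2-x_1^2}$ (the lower half of $\partial B_i$ is the graph $x_2=H_i(x_1)$), $H=H_0-H_1$,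 $H_i^p(x_1)=x_1^2/(2R_i)$, $H^p=H_0^p-H_1^p$, $\eta=(x_2-H_1(x_1))/H(x_1)$, and $$\mathcal U_1(x)=-\tfrac{\lambda c_0}{2}\bigl[x_2^2-2H_1^p(x_1)\,(x_2-H_0^p(x_1))-H_0^p(x_1)^2\bigr],\qquad \widehat{\mathcal U}_1(x)=\tfrac{\lambda c_0}{2}\,H^p(x_1)^2\,(1-\eta^2).$$ (The second is the solution of $-H^p(x_1)^{-2}\partial_\eta^2\widehat{\mathcal U}_1=\lambda c_0$, $\partial_\eta\widehat{\mathcal U}_1|_{\eta=0}=0$, $\widehat{\mathcal U}_1|_{\eta=1}=0$; the first is the same expression with $H_0,H_1$ in $\eta$ replaced by their principal parts $H_0^p,H_1^p$.) Let $\chi:\mathbb{R}\to[0,1]$ be smooth with $\chi(t)=0$ for $|t|\ge R_0$ and $\chi(t)=1$ for $|t|\le R_0/2$, and let $\widehat\chi(x)=\chi(x_1)$ if $x_2<R_0$, $\widehat\chi(x)=0$ otherwise. Let $\rho$ be a function that is smooth and positive on $\overline{\Omega_1}\setminus O$ and equal to $|x|$ in $\Omega_1$ near $O$. Define the remainders $\tilde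 u$ and $\hat u$ by $$u=c_0+\chi(x_1)\,\mathcal U_1+\tilde u,\qquad u=c_0+\widehat\chi\,\widehat{\mathcal U}_1+\hat u .$$ Then there is an exponent $N>0$ such that $$\rho^{-N}\tilde u\in H^1(\Omega_1),\qquad \rho^{-N}\hat u\in H^1_0(\Omega_1,\Gamma_0),$$ and, if $\lambda\neq0$ and $c_0\ne 0$, none of the functions $\rho^{-N}(u-c_0)$, $\rho^{-N}\mathcal U_1$, $\rho^{-N}\widehat{\mathcal U}_1$ belongs to $H^1(\Omega_1\cap\{|x|<r\})$ for any $r>0$. -/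

import Mathlib

open MeasureTheory Filter Topology
open scoped ContDiff

noncomputable section

/-- The Euclidean plane; the Cartesian coordinates `x₁, x₂` of `x` are `x 0, x 1`. -/
abbrev Plane : Type := EuclideanSpace ℝ (Fin 2)

/-! ### Sobolev spaces -/

/-- `G` is the weak gradient of `f` in the open set `Ω`. -/
def HasWeakGradient (Ω : Set Plane) (f : Plane → ℝ) (G : Plane → Plane) : Prop :=
  ∀ φ : Plane → ℝ, ContDiff ℝ ∞ φ → HasCompactSupport φ → tsupport φ ⊆ Ω →
    ∫ x in Ω, f x • gradient φ x = -∫ x in Ω, φ x • G x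

/-- `f ∈ H¹(Ω)`, with weak gradient `G`. -/
structure IsH1With (Ω : Set Plane) (f : Plane → ℝ) (G : Plane → Plane) : Prop where
  memLp : MemLp f 2 (volume.restrict Ω)
  memLp_grad : MemLp G 2 (volume.restrict Ω)
  weakGradient : HasWeakGradient Ω f G

/-- `f ∈ H¹(Ω)`. -/
def MemH1 (Ω : Set Plane) (f : Plane → ℝ) : Prop :=
  ∃ G : Plane → Plane, IsH1With Ω f G

/-- `f ∈ H¹₀(Ω, Γ)`, with weak gradient `G`: the closure in `H¹(Ω)` of the smooth functions that
vanish in a neighbourhood of the closed set `Γ`, that is, the functions of `H¹(Ω)` with zero trace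
on `Γ`. -/
def IsH10With (Ω Γ : Set Plane) (f : Plane → ℝ) (G : Plane → Plane) : Prop :=
  IsH1With Ω f G ∧
    ∃ φ : ℕ → Plane → ℝ,
      (∀ n, ContDiff ℝ ∞ (φ n) ∧ HasCompactSupport (φ n) ∧ Disjoint (tsupport (φ n)) Γ) ∧
      Tendsto (fun n => eLpNorm (fun x => f x - φ n x) 2 (volume.restrict Ω)) atTop (𝓝 0) ∧
      Tendsto (fun n => eLpNorm (fun x => G x - gradient (φ n) x) 2 (volume.restrict Ω))
        atTop (𝓝 0)

/-- `f ∈ H¹₀(Ω, Γ)`. -/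
def MemH10 (Ω Γ : Set Plane) (f : Plane → ℝ) : Prop :=
  ∃ G : Plane → Plane, IsH10With Ω Γ f G

/-! ### The kissing disks -/

/-- The centre `(0, R)` of the disk of radius `R` that touches the axis `x₂ = 0` from above at the
origin. -/
def diskCenter (R : ℝ) : Plane := !₂[0, R]

/-- The region between the disks of radii `R₀ < R₁`, tangent to each other at the origin. -/
def cuspidalAnnulus (R₀ R₁ : ℝ) : Set Plane :=
  Metric.ball (diskCenter R₁) R₁ \ Metric.closedBall (diskCenter R₀) R₀

/-- The boundary of the core. -/
def innerBoundary (R₀ : ℝ) : Set Plane := Metric.sphere (diskCenter R₀) R₀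

/-- The lower half of the circle of radius `R` about `(0, R)` is the graph of this function. -/
def circleHeight (R t : ℝ) : ℝ := R - √(R ^ 2 - t ^ 2)

/-- The principal part of `circleHeight R` at `t = 0`. -/
def principalHeight (R t : ℝ) : ℝ := t ^ 2 / (2 * R)

/-! ### The boundary value problem -/

/-- Variational form of `-Δu = lam u` in the cuspidal annulus with the Neumann condition on the
outer circle and `u = c₀` on the inner one. -/
def IsKissingSolution (R₀ R₁ lam c₀ : ℝ) (u : Plane → ℝ) : Prop :=
  MemH10 (cuspidalAnnulus R₀ R₁) (innerBoundary R₀) (fun x => u x - c₀) ∧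
  ∃ G : Plane → Plane, IsH1With (cuspidalAnnulus R₀ R₁) u G ∧
    ∀ (v : Plane → ℝ) (V : Plane → Plane),
      IsH10With (cuspidalAnnulus R₀ R₁) (innerBoundary R₀) v V →
        ∫ x in cuspidalAnnulus R₀ R₁, inner ℝ (G x) (V x) =
          lam * ∫ x in cuspidalAnnulus R₀ R₁, u x * v x

/-! ### The corrector -/

/-- The explicit corrector `𝒰₁`, a polynomial in `x`. -/
def corrector (R₀ R₁ lam c₀ : ℝ) (x : Plane) : ℝ :=
  -(lam * c₀ / 2) *
    (x 1 ^ 2 - 2 * principalHeight R₁ (x 0) * (x 1 - principalHeight R₀ (x 0))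
      - principalHeight R₀ (x 0) ^ 2)

/-- The stretched coordinate `η`, which is `0` on the outer and `1` on the inner circle. -/
def stretchedCoord (R₀ R₁ : ℝ) (x : Plane) : ℝ :=
  (x 1 - circleHeight R₁ (x 0)) / (circleHeight R₀ (x 0) - circleHeight R₁ (x 0))

/-- The corrector in the variables `(x₁, η)`: with `Hᵖ` the principal part of the thickness, the
solution of `-(Hᵖ)⁻² ∂²U/∂η² = lam c₀`, `∂U/∂η = 0` at `η = 0`, `U = 0` at `η = 1`. It agrees with
`corrector` up to terms of higher order at the cusp, and vanishes on the inner circle. -/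
def stretchedCorrector (R₀ R₁ lam c₀ : ℝ) (x : Plane) : ℝ :=
  lam * c₀ / 2 * (principalHeight R₀ (x 0) - principalHeight R₁ (x 0)) ^ 2
    * (1 - stretchedCoord R₀ R₁ x ^ 2)

/-- `χ` is a smooth cut-off function: `0` for `|t| ≥ R₀` and `1` for `|t| ≤ R₀ / 2`. -/
structure IsCutoff (R₀ : ℝ) (χ : ℝ → ℝ) : Prop where
  smooth : ContDiff ℝ ∞ χ
  nonneg : ∀ t, 0 ≤ χ t
  le_one : ∀ t, χ t ≤ 1
  eq_zero : ∀ t, R₀ ≤ |t| → χ t = 0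
  eq_one : ∀ t, |t| ≤ R₀ / 2 → χ t = 1

/-- The cut-off `χ(x₁)` in the part of the annulus next to the cusp, and `0` in the part of the
strip `|x₁| < R₀` that lies above the core. -/
def cuspCutoff (R₀ : ℝ) (χ : ℝ → ℝ) (x : Plane) : ℝ :=
  if x 1 < R₀ then χ (x 0) else 0

/-- `ρ` is smooth and positive on the closure of `Ω` except at the origin, and it is the distance to
the origin in the part of `Ω` near the origin. -/
structure IsCuspDistance (Ω : Set Plane) (ρ : Plane → ℝ) : Prop where
  smooth : ∀ x ∈ closure Ω, x ≠ 0 → ContDiffAt ℝ ∞ ρ x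
  pos : ∀ x ∈ closure Ω, x ≠ 0 → 0 < ρ x
  eq_norm : ∀ᶠ x in 𝓝[Ω] (0 : Plane), ρ x = ‖x‖

end

noncomputable section

/-! ### Gradients -/

section Gradient

/-! The exponent is `N = 4`. Near the cusp the domain is a gap of width comparable to `t²`, where `t
= x 0`, and to leading order the equation is an ordinary differential equation across the gap. Its
solution with source `λc₀`, the stretched corrector, has size `t⁴` and vertical derivative of size
`t²`. Divided by `|x|⁴`, that derivative has size `t⁻²`, and `∫ t⁻⁴ · t² dt` diverges. What the
corrector leaves over is a flux of size `|t|³`; divided by `|x|⁴` it has size `|t|⁻¹`, and `∫ t⁻² ·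
t² dt` converges. These counts separate the two orders exactly when `7/2 ≤ N < 9/2`.

Let `f = modelCorrector`, so that `k f` with `k = λc₀/2` is the cut-off stretched corrector in the
annulus, and put `w = u - c₀ - k f`. On vertical slices `∫ χ v = -∫ χ (x₂ - H₁) ∂₂v` for `v ∈ H¹₀`:
the factor `x₂ - H₁` vanishes on the outer circle and `v` on the inner one
(`IsH10With.setIntegral_cuspRegion`). This turns the source `λc₀ χ` into a vertical flux which
cancels `k ∂₂f` up to fourth order (`exists_norm_flux_le`). Hence `w` solves the equation with a
source `g = O(|x|⁴)` and a flux `F = O(|x|³)` (`IsKissingSolution.isH10With_remainder`).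

The decay of `w` follows from a weighted energy estimate. With `σ = |x|² + δ`, the test function
`σ⁻⁴ w` controls `∇(σ⁻² w)`, apart from terms bounded by `|σ⁻² w|² / |x|²`. The Poincaré inequality
across the gap (`IsH10With.poincare`) bounds `σ⁻² w / x₁²` by `∇(σ⁻² w)`, so these terms carry an
additional factor `|x|²` and are absorbed near the cusp; away from it they are bounded by the norm
of `w`. The bound is uniform in `δ` (`IsH10With.energy_bound`), and `δ → 0` gives `|x|⁻⁴ w ∈ H¹₀`
(`IsH10With.inv_pow_four_mul`).

The weight `|x|⁻⁴` may be replaced by `ρ⁻⁴`, as the quotient is `1` near the cusp. This settles `û`.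
The difference between `χ 𝒰₁` and `k f` has size `|x|⁴` and gradient of size `|x|³`
(`exists_bound_corrector_sub`), which settles `ũ`. For the negative statements, `∂₂(|x|⁻⁴ 𝒰₁)` is at
least a multiple of `t⁻²` on a parabolic wedge inside the cusp (`exists_wedge`), so it is not square
integrable; the other two functions differ from `𝒰₁` near the cusp by the remainders already
controlled. -/

theorem gradient_apply_eq_fderiv (f : Plane → ℝ) (x : Plane) (i : Fin 2) :
    gradient f x i = fderiv ℝ f x (EuclideanSpace.single i 1) := by
  rw [← inner_gradient_left, EuclideanSpace.inner_single_right]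
  simp

theorem HasGradientAt.mul' {f g : Plane → ℝ} {f' g' x : Plane} (hf : HasGradientAt f f' x)
    (hg : HasGradientAt g g' x) :
    HasGradientAt (fun y => f y * g y) (f x • g' + g x • f') x := by
  rw [hasGradientAt_iff_hasFDerivAt] at *
  exact (hf.mul hg).congr_fderiv (by simp)

theorem HasGradientAt.sub' {f g : Plane → ℝ} {f' g' x : Plane} (hf : HasGradientAt f f' x)
    (hg : HasGradientAt g g' x) :
    HasGradientAt (fun y => f y - g y) (f' - g') x := by
  rw [hasGradientAt_iff_hasFDerivAt] at *
  exact (hf.sub hg).congr_fderiv (by simp)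

theorem HasGradientAt.scomp {f : Plane → ℝ} {f' x : Plane} {θ : ℝ → ℝ} {θ' : ℝ}
    (hθ : HasDerivAt θ θ' (f x)) (hf : HasGradientAt f f' x) :
    HasGradientAt (fun y => θ (f y)) (θ' • f') x := by
  rw [hasGradientAt_iff_hasFDerivAt] at *
  exact (hθ.comp_hasFDerivAt x hf).congr_fderiv (by simp)

theorem HasGradientAt.const_mul' {f : Plane → ℝ} {f' x : Plane} (c : ℝ)
    (hf : HasGradientAt f f' x) : HasGradientAt (fun y => c * f y) (c • f') x := by
  rw [hasGradientAt_iff_hasFDerivAt] at *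
  exact (hf.const_mul c).congr_fderiv (by simp)

theorem hasGradientAt_coord (i : Fin 2) (x : Plane) :
    HasGradientAt (fun y : Plane => y i) (EuclideanSpace.single i (1 : ℝ)) x := by
  rw [hasGradientAt_iff_hasFDerivAt]
  have h := (EuclideanSpace.proj i : Plane →L[ℝ] ℝ).hasFDerivAt (x := x)
  refine h.congr_fderiv ?_
  ext y
  simp [EuclideanSpace.inner_single_left]

theorem continuousOn_gradient {f : Plane → ℝ} {U : Set Plane} (hU : IsOpen U)
    (hf : ContDiffOn ℝ 1 f U) : ContinuousOn (gradient f) U := by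
  have h := hf.continuousOn_fderiv_of_isOpen hU le_rfl
  exact (InnerProductSpace.toDual ℝ Plane).symm.continuous.comp_continuousOn h

theorem continuous_gradient {f : Plane → ℝ} (hf : ContDiff ℝ 1 f) : Continuous (gradient f) := by
  rw [← continuousOn_univ]
  exact continuousOn_gradient isOpen_univ hf.contDiffOn

theorem gradient_eq_zero_of_notMem_tsupport {f : Plane → ℝ} {x : Plane} (hx : x ∉ tsupport f) :
    gradient f x = 0 := by
  have : fderiv ℝ f x = 0 := by
    by_contra h
    exact hx (tsupport_fderiv_subset ℝ (subset_tsupport _ h))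
  simp [gradient, this]

theorem contDiff_of_contDiffAt_tsupport {f : Plane → ℝ} {n : WithTop ℕ∞}
    (h : ∀ x ∈ tsupport f, ContDiffAt ℝ n f x) : ContDiff ℝ n f := by
  rw [contDiff_iff_contDiffAt]
  intro x
  by_cases hx : x ∈ tsupport f
  · exact h x hx
  · exact contDiffAt_const.congr_of_eventuallyEq (notMem_tsupport_iff_eventuallyEq.1 hx)

theorem norm_sq_eq (x : Plane) : ‖x‖ ^ 2 = x 0 ^ 2 + x 1 ^ 2 := by
  rw [EuclideanSpace.norm_sq_eq]; simp [Fin.sum_univ_two]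

theorem abs_coord_le_norm (x : Plane) (i : Fin 2) : |x i| ≤ ‖x‖ := by
  simpa using PiLp.norm_apply_le x i

theorem norm_le_abs_add_abs (x : Plane) : ‖x‖ ≤ |x 0| + |x 1| := by
  apply le_of_sq_le_sq _ (by positivity)
  rw [norm_sq_eq]
  nlinarith [abs_nonneg (x 0), abs_nonneg (x 1), sq_abs (x 0), sq_abs (x 1),
    mul_nonneg (abs_nonneg (x 0)) (abs_nonneg (x 1))]

end Gradient

/-! ### Weak gradients -/

section WeakGradient

variable {Ω : Set Plane}

theorem integrableOn_of_support_compact {F : Type*} [NormedAddCommGroup F] {g : Plane → F}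
    {K : Set Plane} (hΩ : MeasurableSet Ω) (hg : IntegrableOn g K volume)
    (h0 : ∀ x, x ∉ K → g x = 0) : IntegrableOn g Ω volume :=
  hg.of_forall_sdiff_eq_zero hΩ fun x hx => h0 x hx.2

theorem setIntegral_eq_integral_of_tsupport_subset {F : Type*} [NormedAddCommGroup F]
    [NormedSpace ℝ F] {φ : Plane → ℝ} (hφ : tsupport φ ⊆ Ω) (G : Plane → F) :
    ∫ x in Ω, φ x • G x = ∫ x, φ x • G x := by
  refine setIntegral_eq_integral_of_forall_compl_eq_zero fun x hx => ?_
  rw [image_eq_zero_of_notMem_tsupport fun h => hx (hφ h), zero_smul]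

/-- The difference of the two gradients is annihilated by every test function, so the fundamental
lemma of the calculus of variations applies. -/
theorem HasWeakGradient.ae_eq {f : Plane → ℝ} {G G' : Plane → Plane} (hΩ : IsOpen Ω)
    (hG : LocallyIntegrableOn G Ω) (hG' : LocallyIntegrableOn G' Ω)
    (h : HasWeakGradient Ω f G) (h' : HasWeakGradient Ω f G') :
    G =ᵐ[volume.restrict Ω] G' := by
  have key := hΩ.ae_eq_zero_of_integral_contDiff_smul_eq_zero (hG.sub hG') (μ := volume) ?_
  · rw [EventuallyEq, ae_restrict_iff' hΩ.measurableSet]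
    filter_upwards [key] with x hx hxΩ
    simpa [sub_eq_zero] using hx hxΩ
  intro φ hφ hc hs
  have i1 : ∀ H : Plane → Plane, LocallyIntegrableOn H Ω →
      IntegrableOn (fun x => φ x • H x) Ω := fun H hH =>
    integrableOn_of_support_compact hΩ.measurableSet
      ((hH.integrableOn_compact_subset hs hc).continuousOn_smul hφ.continuous.continuousOn hc)
      fun x hx => by rw [image_eq_zero_of_notMem_tsupport hx, zero_smul]
  rw [← setIntegral_eq_integral_of_tsupport_subset hs]
  simp only [Pi.sub_apply, smul_sub]
  rw [integral_sub (i1 G hG) (i1 G' hG'), ← neg_neg (∫ x in Ω, φ x • G x), ← h φ hφ hc hs,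
    h' φ hφ hc hs, neg_neg, sub_self]

/-- Although `m` is smooth only inside `Ω`, the product `φ m` is again a test function because `φ`
has compact support in `Ω`. Testing the weak identity of `f` with it gives the product rule; `m` may
therefore be singular at the boundary. -/
theorem HasWeakGradient.mul_smooth {f m : Plane → ℝ} {G : Plane → Plane} (hΩ : IsOpen Ω)
    (hf : LocallyIntegrableOn f Ω) (hG : LocallyIntegrableOn G Ω)
    (h : HasWeakGradient Ω f G) (hm : ContDiffOn ℝ ∞ m Ω) :
    HasWeakGradient Ω (fun x => m x * f x) (fun x => m x • G x + f x • gradient m x) := by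
  intro φ hφ hc hs
  have hψ : ContDiff ℝ ∞ (fun x => φ x * m x) := by
    refine contDiff_of_contDiffAt_tsupport fun x hx => ?_
    have hx' : x ∈ Ω := hs (tsupport_mul_subset_left hx)
    exact hφ.contDiffAt.mul (hm.contDiffAt (hΩ.mem_nhds hx'))
  have hψc : HasCompactSupport (fun x => φ x * m x) := hc.mul_right
  have hψs : tsupport (fun x => φ x * m x) ⊆ Ω := fun x hx => hs (tsupport_mul_subset_left hx)
  have e := h _ hψ hψc hψs
  have hm1 : ContDiffOn ℝ 1 m Ω := hm.of_le (by simp)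
  have cgm : ContinuousOn (gradient m) (tsupport φ) := (continuousOn_gradient hΩ hm1).mono hs
  have cm : ContinuousOn m (tsupport φ) := hm.continuousOn.mono hs
  have cφ : ContinuousOn φ (tsupport φ) := hφ.continuous.continuousOn
  have cgφ : ContinuousOn (gradient φ) (tsupport φ) :=
    (continuous_gradient (hφ.of_le (by simp))).continuousOn
  have fK := hf.integrableOn_compact_subset hs hc
  have GK := hG.integrableOn_compact_subset hs hc
  have z : ∀ x, x ∉ tsupport φ → φ x = 0 := fun x hx => image_eq_zero_of_notMem_tsupport hx
  have i1 : IntegrableOn (fun x => f x • (φ x • gradient m x)) Ω :=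
    integrableOn_of_support_compact hΩ.measurableSet (fK.smul_continuousOn (cφ.smul cgm) hc)
      fun x hx => by simp [z x hx]
  have i2 : IntegrableOn (fun x => f x • (m x • gradient φ x)) Ω :=
    integrableOn_of_support_compact hΩ.measurableSet (fK.smul_continuousOn (cm.smul cgφ) hc)
      fun x hx => by simp [gradient_eq_zero_of_notMem_tsupport hx]
  have i3 : IntegrableOn (fun x => (φ x * m x) • G x) Ω :=
    integrableOn_of_support_compact hΩ.measurableSet (GK.continuousOn_smul (cφ.mul cm) hc)
      fun x hx => by simp [z x hx]
  have e1 : ∫ x in Ω, f x • gradient (fun x => φ x * m x) x =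
      (∫ x in Ω, f x • (φ x • gradient m x)) + ∫ x in Ω, f x • (m x • gradient φ x) := by
    rw [← integral_add i1 i2]
    refine setIntegral_congr_fun hΩ.measurableSet fun x hx => ?_
    have d1 := (hφ.differentiable (by simp) x).hasGradientAt
    have d2 := ((hm1.contDiffAt (hΩ.mem_nhds hx)).differentiableAt (by simp)).hasGradientAt
    simp only [(d1.mul' d2).gradient, smul_add]
  have e2 : ∫ x in Ω, φ x • (m x • G x + f x • gradient m x) =
      (∫ x in Ω, (φ x * m x) • G x) + ∫ x in Ω, f x • (φ x • gradient m x) := by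
    rw [← integral_add i3 i1]
    refine setIntegral_congr_fun hΩ.measurableSet fun x _ => ?_
    simp only [smul_add, smul_smul, mul_comm (f x)]
  have e3 : ∫ x in Ω, (m x * f x) • gradient φ x = ∫ x in Ω, f x • (m x • gradient φ x) := by
    refine setIntegral_congr_fun hΩ.measurableSet fun x _ => ?_
    simp only [smul_smul, mul_comm (f x)]
  rw [e1] at e
  rw [e3, e2, neg_add, ← e]
  abel

theorem hasWeakGradient_const (c : ℝ) : HasWeakGradient Ω (fun _ => c) (fun _ => 0) := by
  intro φ hφ hc hs
  have h1 : ∫ x in Ω, c • gradient φ x = ∫ x, c • gradient φ x := by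
    refine setIntegral_eq_integral_of_forall_compl_eq_zero fun x hx => ?_
    rw [gradient_eq_zero_of_notMem_tsupport fun h => hx (hs h), smul_zero]
  have hint : Integrable (gradient φ) volume := by
    refine (continuous_gradient (hφ.of_le (by simp))).integrable_of_hasCompactSupport ?_
    exact HasCompactSupport.intro hc fun x hx => gradient_eq_zero_of_notMem_tsupport hx
  have h2 : ∫ x, gradient φ x = 0 := by
    ext i
    have hcomm : (∫ x, gradient φ x) i = ∫ x, gradient φ x i :=
      ((EuclideanSpace.proj i : Plane →L[ℝ] ℝ).integral_comp_comm hint).symm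
    rw [hcomm]
    simp only [gradient_apply_eq_fderiv]
    have hi : Integrable (fun x => fderiv ℝ φ x (EuclideanSpace.single i 1)) := by
      have := (EuclideanSpace.proj i : Plane →L[ℝ] ℝ).integrable_comp hint
      simpa only [EuclideanSpace.coe_proj, gradient_apply_eq_fderiv] using this
    have := integral_mul_fderiv_eq_neg_fderiv_mul_of_integrable (μ := volume) (f := fun _ => (1 : ℝ))
      (g := φ) (v := EuclideanSpace.single i 1) (by simp) (by simpa using hi)
      (by simpa using hφ.continuous.integrable_of_hasCompactSupport hc)
      (by simp) (fun x _ => hφ.differentiable (by simp) x)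
    simpa using this
  rw [h1, integral_smul, h2]
  simp

theorem hasWeakGradient_of_contDiffOn {m : Plane → ℝ} (hΩ : IsOpen Ω) (hm : ContDiffOn ℝ ∞ m Ω) :
    HasWeakGradient Ω m (gradient m) := by
  have h := (hasWeakGradient_const (Ω := Ω) 1).mul_smooth hΩ
    ((locallyIntegrable_const _).locallyIntegrableOn _)
    ((locallyIntegrable_const _).locallyIntegrableOn _) hm
  simpa using h

end WeakGradient

/-! ### Convergence in `L²` -/

section LTwo

variable {α : Type*} [MeasurableSpace α] {μ : Measure α}

theorem tendsto_eLpNorm_two_of_dominated {E : Type*} [NormedAddCommGroup E] {F : ℕ → α → E}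
    {b : α → ℝ} (hF : ∀ n, AEStronglyMeasurable (F n) μ) (hb : MemLp b 2 μ)
    (h : ∀ n, ∀ᵐ x ∂μ, ‖F n x‖ ≤ b x)
    (hlim : ∀ᵐ x ∂μ, Tendsto (fun n => F n x) atTop (𝓝 0)) :
    Tendsto (fun n => eLpNorm (F n) 2 μ) atTop (𝓝 0) := by
  simp only [eLpNorm_eq_lintegral_rpow_enorm_toReal two_ne_zero ENNReal.ofNat_ne_top]
  have key : Tendsto (fun n => ∫⁻ x, ‖F n x‖ₑ ^ (2 : ENNReal).toReal ∂μ) atTop (𝓝 (∫⁻ _, 0 ∂μ)) := by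
    refine tendsto_lintegral_of_dominated_convergence' (fun x => ‖b x‖ₑ ^ (2 : ENNReal).toReal)
      (fun n => (hF n).enorm.pow_const _) (fun n => ?_) ?_ ?_
    · filter_upwards [h n] with x hx
      gcongr
      rw [enorm_le_iff_norm_le]
      exact hx.trans (le_abs_self _)
    · have := hb.2
      rw [eLpNorm_lt_top_iff_lintegral_rpow_enorm_lt_top two_ne_zero ENNReal.ofNat_ne_top] at this
      exact this.ne
    · filter_upwards [hlim] with x hx
      have h1 : Tendsto (fun n => ‖F n x‖ₑ) atTop (𝓝 0) := by
        simpa using hx.enorm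
      simpa using h1.ennrpow_const (2 : ENNReal).toReal
  simp only [lintegral_zero] at key
  simpa using key.ennrpow_const (1 / (2 : ENNReal).toReal)

/-- Hölder's inequality. Allowing any bounded bilinear `B` covers with one statement every passage
to the limit needed below: scalar times vector, product of scalars, and product with one component
of a vector. -/
theorem tendsto_integral_bilin {E F W : Type*} [NormedAddCommGroup E] [NormedSpace ℝ E]
    [NormedAddCommGroup F] [NormedSpace ℝ F] [NormedAddCommGroup W] [NormedSpace ℝ W]
    (B : E →L[ℝ] F →L[ℝ] W) {f : α → E} {fn : ℕ → α → E} {g : α → F}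
    (hg : MemLp g 2 μ) (hf : MemLp f 2 μ) (hfn : ∀ n, MemLp (fn n) 2 μ)
    (h : Tendsto (fun n => eLpNorm (fun x => f x - fn n x) 2 μ) atTop (𝓝 0)) :
    Tendsto (fun n => ∫ x, B (fn n x) (g x) ∂μ) atTop (𝓝 (∫ x, B (f x) (g x) ∂μ)) := by
  have hint : ∀ e : α → E, MemLp e 2 μ → Integrable (fun x => B (e x) (g x)) μ := fun e he =>
    memLp_one_iff_integrable.1 (he.of_bilin (fun a b => B a b) ‖B‖₊ hg
      (B.aestronglyMeasurable_comp₂ he.1 hg.1)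
      (Eventually.of_forall fun x => B.le_opNorm₂ _ _))
  refine tendsto_integral_of_L1' _ (hint f hf).1 (Eventually.of_forall fun n => hint _ (hfn n)) ?_
  have hle : ∀ n, eLpNorm ((fun x => B (fn n x) (g x)) - fun x => B (f x) (g x)) 1 μ ≤
      ‖B‖₊ * eLpNorm (fun x => f x - fn n x) 2 μ * eLpNorm g 2 μ := by
    intro n
    have e : ((fun x => B (fn n x) (g x)) - fun x => B (f x) (g x)) =
        -fun x => B (f x - fn n x) (g x) := by
      ext x; simp
    rw [e, eLpNorm_neg]
    exact eLpNorm_le_eLpNorm_mul_eLpNorm_of_nnnorm (hf.1.sub (hfn n).1) hg.1 (fun a b => B a b) ‖B‖₊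
      (Eventually.of_forall fun x => B.le_opNorm₂ _ _)
  refine tendsto_of_tendsto_of_tendsto_of_le_of_le tendsto_const_nhds ?_ (fun _ => zero_le) hle
  have h1 := ENNReal.Tendsto.const_mul (a := (‖B‖₊ : ENNReal)) h (Or.inr ENNReal.coe_ne_top)
  have h2 := ENNReal.Tendsto.mul_const (b := eLpNorm g 2 μ) h1 (Or.inr hg.2.ne)
  simpa using h2

end LTwo

/-! ### Closedness of weak gradients and mollification -/

section Approximation

variable {Ω Γ : Set Plane}

theorem locallyIntegrableOn_of_memLp_two {F : Type*} [NormedAddCommGroup F]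
    [IsFiniteMeasure (volume.restrict Ω)] {f : Plane → F} (hf : MemLp f 2 (volume.restrict Ω)) :
    LocallyIntegrableOn f Ω :=
  IntegrableOn.locallyIntegrableOn (hf.integrable one_le_two)

theorem memLp_of_continuous_compact {F : Type*} [NormedAddCommGroup F] {g : Plane → F}
    (hg : Continuous g) (hc : HasCompactSupport g) : MemLp g 2 (volume.restrict Ω) :=
  (hg.memLp_of_hasCompactSupport hc).restrict _

theorem hasCompactSupport_gradient {φ : Plane → ℝ} (hc : HasCompactSupport φ) :
    HasCompactSupport (gradient φ) :=
  HasCompactSupport.intro hc fun _ hx => gradient_eq_zero_of_notMem_tsupport hx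

theorem memLp_gradient {φ : Plane → ℝ} (hφ : ContDiff ℝ 1 φ) (hc : HasCompactSupport φ) :
    MemLp (gradient φ) 2 (volume.restrict Ω) :=
  memLp_of_continuous_compact (continuous_gradient hφ) (hasCompactSupport_gradient hc)

theorem HasWeakGradient.of_tendsto {f : Plane → ℝ} {G : Plane → Plane} {fn : ℕ → Plane → ℝ}
    {Gn : ℕ → Plane → Plane} (h : ∀ n, HasWeakGradient Ω (fn n) (Gn n))
    (hfn : ∀ n, MemLp (fn n) 2 (volume.restrict Ω)) (hGn : ∀ n, MemLp (Gn n) 2 (volume.restrict Ω))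
    (hf : MemLp f 2 (volume.restrict Ω)) (hG : MemLp G 2 (volume.restrict Ω))
    (ht : Tendsto (fun n => eLpNorm (fun x => f x - fn n x) 2 (volume.restrict Ω)) atTop (𝓝 0))
    (htG : Tendsto (fun n => eLpNorm (fun x => G x - Gn n x) 2 (volume.restrict Ω)) atTop (𝓝 0)) :
    HasWeakGradient Ω f G := by
  intro φ hφ hc hs
  have h1 := tendsto_integral_bilin (ContinuousLinearMap.lsmul ℝ ℝ (E := Plane))
    (memLp_gradient (Ω := Ω) (hφ.of_le (by simp)) hc) hf hfn ht
  have h2 := tendsto_integral_bilin (ContinuousLinearMap.lsmul ℝ ℝ (E := Plane)).flip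
    (memLp_of_continuous_compact (Ω := Ω) hφ.continuous hc) hG hGn htG
  simp only [ContinuousLinearMap.lsmul_apply, ContinuousLinearMap.flip_apply] at h1 h2
  refine tendsto_nhds_unique h1 ?_
  have : (fun n => ∫ x in Ω, fn n x • gradient φ x) = fun n => -∫ x in Ω, φ x • Gn n x := by
    ext1 n; exact h n φ hφ hc hs
  rw [this]
  exact h2.neg

-- Mollification with a radius below the moduli of uniform continuity of `g` and of its derivative,
-- and below the distance from the support to the complement of `U`. The derivative is approximated
-- too because it commutes with the convolution. This is what makes `C¹` approximants sufficient in
-- the definition of `H¹₀`.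
open Pointwise in
theorem exists_contDiff_approx {g : Plane → ℝ} (hg : ContDiff ℝ 1 g) (hc : HasCompactSupport g)
    {U : Set Plane} (hU : IsOpen U) (hs : tsupport g ⊆ U) {ε : ℝ} (hε : 0 < ε) :
    ∃ φ : Plane → ℝ, ContDiff ℝ ∞ φ ∧ HasCompactSupport φ ∧ tsupport φ ⊆ U ∧
      ∀ x, ‖g x - φ x‖ ≤ ε ∧ ‖gradient g x - gradient φ x‖ ≤ ε := by
  obtain ⟨δ₁, hδ₁, hδU⟩ := hc.isCompact.exists_cthickening_subset_open hU hs
  have u1 := hc.uniformContinuous_of_continuous hg.continuous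
  have u2 := (hc.fderiv (𝕜 := ℝ)).uniformContinuous_of_continuous (hg.continuous_fderiv (by simp))
  obtain ⟨δ₂, hδ₂, h2⟩ := Metric.uniformContinuous_iff.1 u1 ε hε
  obtain ⟨δ₃, hδ₃, h3⟩ := Metric.uniformContinuous_iff.1 u2 ε hε
  set δ := min δ₁ (min δ₂ δ₃) with hδ
  have hδ0 : 0 < δ := by positivity
  let ψ : ContDiffBump (0 : Plane) := ⟨δ / 2, δ, by positivity, by linarith⟩
  have hψr : ψ.rOut = δ := rfl
  set φ : Plane → ℝ := convolution (ψ.normed volume) g (ContinuousLinearMap.lsmul ℝ ℝ) volume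
    with hφ
  have hψi : LocallyIntegrable (ψ.normed volume) (volume : Measure Plane) :=
    ψ.continuous_normed.locallyIntegrable
  have hsub : tsupport φ ⊆ Metric.cthickening δ (tsupport g) := by
    refine closure_minimal ?_ Metric.isClosed_cthickening
    refine (support_convolution_subset_swap _).trans ?_
    rintro _ ⟨a, ha, b, hb, rfl⟩
    rw [ψ.support_normed_eq, hψr] at hb
    refine Metric.mem_cthickening_of_dist_le _ a _ _ (subset_tsupport _ ha) ?_
    simpa [dist_eq_norm] using (mem_ball_zero_iff.1 hb).le
  have hfd : ∀ x, fderiv ℝ φ x =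
      convolution (ψ.normed volume) (fderiv ℝ g)
        (ContinuousLinearMap.lsmul ℝ ℝ (E := Plane →L[ℝ] ℝ)) volume x := by
    intro x
    rw [(hc.hasFDerivAt_convolution_right (ContinuousLinearMap.lsmul ℝ ℝ) hψi hg x).fderiv]
    rfl
  refine ⟨φ, ?_, ?_, ?_, fun x => ⟨?_, ?_⟩⟩
  · exact ψ.hasCompactSupport_normed.contDiff_convolution_left _ (n := ⊤) ψ.contDiff_normed
      hg.continuous.locallyIntegrable
  · exact (hc.isCompact.cthickening (r := δ)).of_isClosed_subset isClosed_closure hsub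
  · refine hsub.trans ((Metric.cthickening_mono (min_le_left _ _) _).trans hδU)
  · rw [← dist_eq_norm, dist_comm]
    refine ψ.dist_normed_convolution_le hg.continuous.aestronglyMeasurable fun y hy => ?_
    exact (h2 ((Metric.mem_ball.1 hy).trans_le
      ((min_le_right _ _).trans (min_le_left _ _)))).le
  · have : ‖gradient g x - gradient φ x‖ = ‖fderiv ℝ g x - fderiv ℝ φ x‖ := by
      rw [gradient, gradient, ← map_sub, LinearIsometryEquiv.norm_map]
    rw [this, hfd, ← dist_eq_norm, dist_comm]
    refine ψ.dist_normed_convolution_le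
      (hg.continuous_fderiv (by simp)).aestronglyMeasurable fun y hy => ?_
    exact (h3 ((Metric.mem_ball.1 hy).trans_le
      ((min_le_right _ _).trans (min_le_right _ _)))).le

end Approximation

/-! ### The spaces `H¹` and `H¹₀` -/

section SobolevSpaces

variable {Ω Γ : Set Plane} {f g : Plane → ℝ} {F G : Plane → Plane}

theorem HasWeakGradient.sub (hΩ : MeasurableSet Ω) (hf : LocallyIntegrableOn f Ω)
    (hg : LocallyIntegrableOn g Ω) (hF : LocallyIntegrableOn F Ω) (hG : LocallyIntegrableOn G Ω)
    (h : HasWeakGradient Ω f F) (h' : HasWeakGradient Ω g G) :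
    HasWeakGradient Ω (fun x => f x - g x) (fun x => F x - G x) := by
  intro φ hφ hc hs
  have cgφ := (continuous_gradient (hφ.of_le (by simp) : ContDiff ℝ 1 φ)).continuousOn
    (s := tsupport φ)
  have i1 : ∀ e : Plane → ℝ, LocallyIntegrableOn e Ω →
      IntegrableOn (fun x => e x • gradient φ x) Ω := fun e he =>
    integrableOn_of_support_compact hΩ
      ((he.integrableOn_compact_subset hs hc).smul_continuousOn cgφ hc)
      fun x hx => by simp [gradient_eq_zero_of_notMem_tsupport hx]
  have i2 : ∀ e : Plane → Plane, LocallyIntegrableOn e Ω →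
      IntegrableOn (fun x => φ x • e x) Ω := fun e he =>
    integrableOn_of_support_compact hΩ
      ((he.integrableOn_compact_subset hs hc).continuousOn_smul hφ.continuous.continuousOn hc)
      fun x hx => by simp [image_eq_zero_of_notMem_tsupport hx]
  simp only [sub_smul, smul_sub]
  rw [integral_sub (i1 f hf) (i1 g hg), integral_sub (i2 F hF) (i2 G hG), h φ hφ hc hs,
    h' φ hφ hc hs]
  abel

theorem HasWeakGradient.congr (hΩ : MeasurableSet Ω) (h : HasWeakGradient Ω f F)
    (hfg : Set.EqOn f g Ω) (hFG : F =ᵐ[volume.restrict Ω] G) : HasWeakGradient Ω g G := by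
  intro φ hφ hc hs
  have e1 : ∫ x in Ω, g x • gradient φ x = ∫ x in Ω, f x • gradient φ x :=
    setIntegral_congr_fun hΩ fun x hx => by simp only [hfg hx]
  have e2 : ∫ x in Ω, φ x • G x = ∫ x in Ω, φ x • F x :=
    integral_congr_ae (by filter_upwards [hFG] with x hx; simp only [hx])
  rw [e1, e2, h φ hφ hc hs]

theorem HasWeakGradient.mono {Ω' : Set Plane} (h : HasWeakGradient Ω f F) (hs : Ω' ⊆ Ω) :
    HasWeakGradient Ω' f F := by
  intro φ hφ hc hsupp
  have h0 := h φ hφ hc (hsupp.trans hs)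
  rw [setIntegral_eq_integral_of_tsupport_subset (hsupp.trans hs)] at h0
  rw [setIntegral_eq_integral_of_tsupport_subset hsupp, ← h0]
  rw [setIntegral_eq_integral_of_forall_compl_eq_zero, setIntegral_eq_integral_of_forall_compl_eq_zero]
  · intro x hx
    rw [gradient_eq_zero_of_notMem_tsupport fun h => hx (hs (hsupp h)), smul_zero]
  · intro x hx
    rw [gradient_eq_zero_of_notMem_tsupport fun h => hx (hsupp h), smul_zero]

theorem IsH1With.congr (hΩ : MeasurableSet Ω) (h : IsH1With Ω f F) (hfg : Set.EqOn f g Ω)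
    (hFG : F =ᵐ[volume.restrict Ω] G) : IsH1With Ω g G where
  memLp := h.memLp.ae_eq ((ae_restrict_iff' hΩ).2 (Eventually.of_forall fun _ hx => hfg hx))
  memLp_grad := h.memLp_grad.ae_eq hFG
  weakGradient := h.weakGradient.congr hΩ hfg hFG

theorem IsH1With.sub (hΩ : MeasurableSet Ω) [IsFiniteMeasure (volume.restrict Ω)]
    (h : IsH1With Ω f F) (h' : IsH1With Ω g G) :
    IsH1With Ω (fun x => f x - g x) (fun x => F x - G x) where
  memLp := h.memLp.sub h'.memLp
  memLp_grad := h.memLp_grad.sub h'.memLp_grad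
  weakGradient := HasWeakGradient.sub hΩ (locallyIntegrableOn_of_memLp_two h.memLp)
    (locallyIntegrableOn_of_memLp_two h'.memLp) (locallyIntegrableOn_of_memLp_two h.memLp_grad)
    (locallyIntegrableOn_of_memLp_two h'.memLp_grad) h.weakGradient h'.weakGradient

theorem MemH1.sub (hΩ : MeasurableSet Ω) [IsFiniteMeasure (volume.restrict Ω)]
    (h : MemH1 Ω f) (h' : MemH1 Ω g) : MemH1 Ω (fun x => f x - g x) := by
  obtain ⟨F, hF⟩ := h
  obtain ⟨G, hG⟩ := h'
  exact ⟨_, hF.sub hΩ hG⟩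

theorem MemH1.congr (hΩ : MeasurableSet Ω) (h : MemH1 Ω f) (hfg : Set.EqOn f g Ω) : MemH1 Ω g := by
  obtain ⟨F, hF⟩ := h
  exact ⟨F, hF.congr hΩ hfg (ae_eq_refl _)⟩

theorem MemH1.mono {Ω' : Set Plane} (h : MemH1 Ω f) (hs : Ω' ⊆ Ω) : MemH1 Ω' f := by
  obtain ⟨F, hF⟩ := h
  exact ⟨F, hF.memLp.mono_measure (Measure.restrict_mono hs le_rfl),
    hF.memLp_grad.mono_measure (Measure.restrict_mono hs le_rfl), hF.weakGradient.mono hs⟩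

theorem isH1With_const [IsFiniteMeasure (volume.restrict Ω)] (c : ℝ) :
    IsH1With Ω (fun _ => c) (fun _ => 0) :=
  ⟨memLp_const c, memLp_const 0, hasWeakGradient_const c⟩

theorem IsH1With.ae_eq (hΩ : IsOpen Ω) [IsFiniteMeasure (volume.restrict Ω)]
    (h : IsH1With Ω f F) (h' : IsH1With Ω f G) : F =ᵐ[volume.restrict Ω] G :=
  h.weakGradient.ae_eq hΩ (locallyIntegrableOn_of_memLp_two h.memLp_grad) (locallyIntegrableOn_of_memLp_two h'.memLp_grad)
    h'.weakGradient

theorem tendsto_of_forall_le {a : ℕ → ENNReal} (h : ∀ n, a n ≤ ENNReal.ofReal (1 / (n + 1))) :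
    Tendsto a atTop (𝓝 0) := by
  refine tendsto_of_tendsto_of_tendsto_of_le_of_le tendsto_const_nhds ?_ (fun _ => zero_le) h
  simpa using ENNReal.tendsto_ofReal tendsto_one_div_add_atTop_nhds_zero_nat

theorem eLpNorm_two_le_of_bound [IsFiniteMeasure (volume.restrict Ω)] (hΩ : MeasurableSet Ω)
    {E : Type*} [NormedAddCommGroup E] {ε : ℝ} (hε : 0 < ε) :
    ∃ δ : ℝ, 0 < δ ∧ ∀ e : Plane → E, (∀ x ∈ Ω, ‖e x‖ ≤ δ) →
      eLpNorm e 2 (volume.restrict Ω) ≤ ENNReal.ofReal ε := by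
  set A := ((volume.restrict Ω) Set.univ ^ (2 : ENNReal).toReal⁻¹).toReal
  have hA : (volume.restrict Ω) Set.univ ^ (2 : ENNReal).toReal⁻¹ = ENNReal.ofReal A := by
    rw [ENNReal.ofReal_toReal]
    exact ENNReal.rpow_ne_top_of_nonneg (by positivity) (measure_ne_top _ _)
  have hA0 : 0 ≤ A := ENNReal.toReal_nonneg
  -- The summand `1` keeps the quotient meaningful when `Ω` is a null set.
  refine ⟨ε / (A + 1), by positivity, fun e he => ?_⟩
  refine (eLpNorm_le_of_ae_bound (C := ε / (A + 1))
    ((ae_restrict_iff' hΩ).2 (Eventually.of_forall he))).trans ?_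
  rw [hA, ← ENNReal.ofReal_mul hA0]
  refine ENNReal.ofReal_le_ofReal ?_
  rw [mul_div_assoc', div_le_iff₀ (by positivity)]
  nlinarith

theorem IsH10With.exists_approx (h : IsH10With Ω Γ f F) {ε : ℝ} (hε : 0 < ε) :
    ∃ φ : Plane → ℝ, ContDiff ℝ ∞ φ ∧ HasCompactSupport φ ∧ Disjoint (tsupport φ) Γ ∧
      eLpNorm (fun x => f x - φ x) 2 (volume.restrict Ω) ≤ ENNReal.ofReal ε ∧
      eLpNorm (fun x => F x - gradient φ x) 2 (volume.restrict Ω) ≤ ENNReal.ofReal ε := by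
  obtain ⟨-, φ, h1, h2, h3⟩ := h
  have hε' : (0 : ENNReal) < ENNReal.ofReal ε := by simpa using hε
  obtain ⟨n, hn2, hn3⟩ := ((h2.eventually (ge_mem_nhds hε')).and
    (h3.eventually (ge_mem_nhds hε'))).exists
  exact ⟨φ n, (h1 n).1, (h1 n).2.1, (h1 n).2.2, hn2, hn3⟩

/-- Each `C¹` approximant is mollified without reaching `Γ`. Membership in `H¹` need not be assumed:
square integrability follows from one approximant, and the weak gradient identity from the limit. -/
theorem isH10With_of_approx (hΩ : IsOpen Ω) [IsFiniteMeasure (volume.restrict Ω)]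
    (hΓ : IsClosed Γ) (hf : AEStronglyMeasurable f (volume.restrict Ω))
    (hF : AEStronglyMeasurable F (volume.restrict Ω))
    (h : ∀ ε : ℝ, 0 < ε → ∃ φ : Plane → ℝ, ContDiff ℝ 1 φ ∧ HasCompactSupport φ ∧
      Disjoint (tsupport φ) Γ ∧
      eLpNorm (fun x => f x - φ x) 2 (volume.restrict Ω) ≤ ENNReal.ofReal ε ∧
      eLpNorm (fun x => F x - gradient φ x) 2 (volume.restrict Ω) ≤ ENNReal.ofReal ε) :
    IsH10With Ω Γ f F := by
  have h' : ∀ n : ℕ, ∃ φ : Plane → ℝ, ContDiff ℝ ∞ φ ∧ HasCompactSupport φ ∧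
      Disjoint (tsupport φ) Γ ∧
      eLpNorm (fun x => f x - φ x) 2 (volume.restrict Ω) ≤ ENNReal.ofReal (1 / (n + 1)) ∧
      eLpNorm (fun x => F x - gradient φ x) 2 (volume.restrict Ω) ≤
        ENNReal.ofReal (1 / (n + 1)) := by
    intro n
    set ε : ℝ := 1 / (n + 1)
    have hε : 0 < ε := by positivity
    have hs : ENNReal.ofReal ε = ENNReal.ofReal (ε / 2) + ENNReal.ofReal (ε / 2) := by
      rw [← ENNReal.ofReal_add (by positivity) (by positivity), add_halves]
    obtain ⟨g, hg, hgc, hgΓ, e1, e2⟩ := h (ε / 2) (by positivity)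
    obtain ⟨δ, hδ, hδ1⟩ := eLpNorm_two_le_of_bound (Ω := Ω) hΩ.measurableSet (E := ℝ)
      (half_pos hε)
    obtain ⟨δ', hδ', hδ2⟩ := eLpNorm_two_le_of_bound (Ω := Ω) hΩ.measurableSet (E := Plane)
      (half_pos hε)
    obtain ⟨φ, hφ, hφc, hφs, hφe⟩ := exists_contDiff_approx hg hgc hΓ.isOpen_compl
      (Set.subset_compl_iff_disjoint_right.2 hgΓ) (lt_min hδ hδ')
    have hφ1 : ContDiff ℝ 1 φ := hφ.of_le (by simp)
    refine ⟨φ, hφ, hφc, Set.subset_compl_iff_disjoint_right.1 hφs, ?_, ?_⟩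
    · have : (fun x => f x - φ x) = (fun x => f x - g x) + fun x => g x - φ x := by
        ext x; simp
      rw [this, hs]
      refine (eLpNorm_add_le (hf.sub hg.continuous.aestronglyMeasurable)
        (hg.continuous.sub hφ.continuous).aestronglyMeasurable one_le_two).trans
        (add_le_add e1 (hδ1 _ fun x _ => ((hφe x).1.trans (min_le_left _ _))))
    · have : (fun x => F x - gradient φ x) =
          (fun x => F x - gradient g x) + fun x => gradient g x - gradient φ x := by
        ext x : 1; simp
      rw [this, hs]
      refine (eLpNorm_add_le (hF.sub (continuous_gradient hg).aestronglyMeasurable)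
        ((continuous_gradient hg).sub (continuous_gradient hφ1)).aestronglyMeasurable
        one_le_two).trans
        (add_le_add e2 (hδ2 _ fun x _ => ((hφe x).2.trans (min_le_right _ _))))
  choose φ hφ hφc hφΓ e1 e2 using h'
  have hφ1 : ∀ n, ContDiff ℝ 1 (φ n) := fun n => (hφ n).of_le (by simp)
  have m1 : ∀ n, MemLp (φ n) 2 (volume.restrict Ω) := fun n =>
    memLp_of_continuous_compact (hφ n).continuous (hφc n)
  have m2 : ∀ n, MemLp (gradient (φ n)) 2 (volume.restrict Ω) := fun n =>
    memLp_gradient (hφ1 n) (hφc n)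
  have t1 := tendsto_of_forall_le e1
  have t2 := tendsto_of_forall_le e2
  have mf : MemLp f 2 (volume.restrict Ω) := by
    have : MemLp (fun x => f x - φ 0 x) 2 (volume.restrict Ω) :=
      ⟨hf.sub (m1 0).1, (e1 0).trans_lt ENNReal.ofReal_lt_top⟩
    exact (this.add (m1 0)).ae_eq (Eventually.of_forall fun x => by simp)
  have mF : MemLp F 2 (volume.restrict Ω) := by
    have : MemLp (fun x => F x - gradient (φ 0) x) 2 (volume.restrict Ω) :=
      ⟨hF.sub (m2 0).1, (e2 0).trans_lt ENNReal.ofReal_lt_top⟩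
    exact (this.add (m2 0)).ae_eq (Eventually.of_forall fun x => by simp)
  exact ⟨⟨mf, mF, HasWeakGradient.of_tendsto
    (fun n => hasWeakGradient_of_contDiffOn hΩ (hφ n).contDiffOn) m1 m2 mf mF t1 t2⟩,
    φ, fun n => ⟨hφ n, hφc n, hφΓ n⟩, t1, t2⟩

/-- `H¹₀` is closed: an approximant of a late term of the sequence approximates the limit. -/
theorem isH10With_of_tendsto (hΩ : IsOpen Ω) [IsFiniteMeasure (volume.restrict Ω)]
    (hΓ : IsClosed Γ) (hf : AEStronglyMeasurable f (volume.restrict Ω))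
    (hF : AEStronglyMeasurable F (volume.restrict Ω)) {fn : ℕ → Plane → ℝ}
    {Fn : ℕ → Plane → Plane} (h : ∀ n, IsH10With Ω Γ (fn n) (Fn n))
    (t1 : Tendsto (fun n => eLpNorm (fun x => f x - fn n x) 2 (volume.restrict Ω)) atTop (𝓝 0))
    (t2 : Tendsto (fun n => eLpNorm (fun x => F x - Fn n x) 2 (volume.restrict Ω)) atTop (𝓝 0)) :
    IsH10With Ω Γ f F := by
  refine isH10With_of_approx hΩ hΓ hf hF fun ε hε => ?_
  have hε' : (0 : ENNReal) < ENNReal.ofReal (ε / 2) := by simpa using hε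
  have hs : ENNReal.ofReal ε = ENNReal.ofReal (ε / 2) + ENNReal.ofReal (ε / 2) := by
    rw [← ENNReal.ofReal_add (by positivity) (by positivity), add_halves]
  obtain ⟨n, hn1, hn2⟩ := ((t1.eventually (ge_mem_nhds hε')).and
    (t2.eventually (ge_mem_nhds hε'))).exists
  obtain ⟨φ, hφ, hφc, hφΓ, e1, e2⟩ := (h n).exists_approx (half_pos hε)
  have hφ1 : ContDiff ℝ 1 φ := hφ.of_le (by simp)
  refine ⟨φ, hφ1, hφc, hφΓ, ?_, ?_⟩
  · have : (fun x => f x - φ x) = (fun x => f x - fn n x) + fun x => fn n x - φ x := by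
      ext x; simp
    rw [this, hs]
    exact (eLpNorm_add_le (hf.sub (h n).1.memLp.1)
      ((h n).1.memLp.1.sub hφ.continuous.aestronglyMeasurable) one_le_two).trans
      (add_le_add hn1 e1)
  · have : (fun x => F x - gradient φ x) =
        (fun x => F x - Fn n x) + fun x => Fn n x - gradient φ x := by
      ext x : 1; simp
    rw [this, hs]
    exact (eLpNorm_add_le (hF.sub (h n).1.memLp_grad.1)
      ((h n).1.memLp_grad.1.sub (continuous_gradient hφ1).aestronglyMeasurable) one_le_two).trans
      (add_le_add hn2 e2)

theorem IsH10With.congr (hΩ : MeasurableSet Ω) (h : IsH10With Ω Γ f F) (hfg : Set.EqOn f g Ω)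
    (hFG : F =ᵐ[volume.restrict Ω] G) : IsH10With Ω Γ g G := by
  obtain ⟨h1, φ, h2, h3, h4⟩ := h
  refine ⟨h1.congr hΩ hfg hFG, φ, h2, ?_, ?_⟩
  · refine h3.congr fun n => eLpNorm_congr_ae ?_
    exact (ae_restrict_iff' hΩ).2 (Eventually.of_forall fun x hx => by simp only [hfg hx])
  · refine h4.congr fun n => eLpNorm_congr_ae ?_
    filter_upwards [hFG] with x hx
    simp only [hx]

theorem IsH10With.sub (hΩ : MeasurableSet Ω) [IsFiniteMeasure (volume.restrict Ω)]
    (h : IsH10With Ω Γ f F) (h' : IsH10With Ω Γ g G) :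
    IsH10With Ω Γ (fun x => f x - g x) (fun x => F x - G x) := by
  obtain ⟨h1, φ, h2, h3, h4⟩ := h
  obtain ⟨h1', φ', h2', h3', h4'⟩ := h'
  have c1 : ∀ n, ContDiff ℝ 1 (φ n) := fun n => (h2 n).1.of_le (by simp)
  have c2 : ∀ n, ContDiff ℝ 1 (φ' n) := fun n => (h2' n).1.of_le (by simp)
  have hz : ∀ {a b : ℕ → ENNReal}, Tendsto a atTop (𝓝 0) → Tendsto b atTop (𝓝 0) →
      Tendsto (fun n => a n + b n) atTop (𝓝 0) := fun ha hb => by simpa using ha.add hb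
  refine ⟨h1.sub hΩ h1', fun n x => φ n x - φ' n x, fun n => ⟨(h2 n).1.sub (h2' n).1,
    (h2 n).2.1.sub (h2' n).2.1, ?_⟩, ?_, ?_⟩
  · refine Set.disjoint_of_subset_left (tsupport_sub _ _) ?_
    exact Set.disjoint_union_left.2 ⟨(h2 n).2.2, (h2' n).2.2⟩
  · refine tendsto_of_tendsto_of_tendsto_of_le_of_le tendsto_const_nhds (hz h3 h3')
      (fun _ => zero_le) fun n => ?_
    have : (fun x => f x - g x - (φ n x - φ' n x)) =
        (fun x => f x - φ n x) - fun x => g x - φ' n x := by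
      ext x; simp only [Pi.sub_apply]; ring
    dsimp only
    rw [this]
    exact eLpNorm_sub_le (h1.memLp.1.sub (c1 n).continuous.aestronglyMeasurable)
      (h1'.memLp.1.sub (c2 n).continuous.aestronglyMeasurable) one_le_two
  · refine tendsto_of_tendsto_of_tendsto_of_le_of_le tendsto_const_nhds (hz h4 h4')
      (fun _ => zero_le) fun n => ?_
    have : (fun x => F x - G x - gradient (fun x => φ n x - φ' n x) x) =
        (fun x => F x - gradient (φ n) x) - fun x => G x - gradient (φ' n) x := by
      ext x : 1
      rw [(((c1 n).differentiable (by simp) x).hasGradientAt.sub'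
        ((c2 n).differentiable (by simp) x).hasGradientAt).gradient]
      simp only [Pi.sub_apply]; abel
    dsimp only
    rw [this]
    exact eLpNorm_sub_le (h1.memLp_grad.1.sub (continuous_gradient (c1 n)).aestronglyMeasurable)
      (h1'.memLp_grad.1.sub (continuous_gradient (c2 n)).aestronglyMeasurable) one_le_two

theorem eLpNorm_le_ofReal_mul_of_le {E E' : Type*} [NormedAddCommGroup E] [NormedAddCommGroup E']
    (hΩ : MeasurableSet Ω) {e : Plane → E} {e' : Plane → E'} {C ε : ℝ} (hC : 0 ≤ C)
    (h : ∀ x ∈ Ω, ‖e x‖ ≤ C * ‖e' x‖)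
    (he : eLpNorm e' 2 (volume.restrict Ω) ≤ ENNReal.ofReal ε) :
    eLpNorm e 2 (volume.restrict Ω) ≤ ENNReal.ofReal (C * ε) := by
  refine (eLpNorm_le_mul_eLpNorm_of_ae_le_mul
    ((ae_restrict_iff' hΩ).2 (Eventually.of_forall h)) 2).trans ?_
  rw [ENNReal.ofReal_mul hC]
  gcongr

-- The multiplier may be irregular on `Γ`, in particular at the cusp, since the approximants of `f`
-- vanish near `Γ`. On the compact set where an approximant meets the closure of `Ω` the multiplier
-- is `C¹`; a cut-off `ζ` equal to `1` near that set turns the product into a `C¹` function on the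
-- plane without changing it in `Ω`.
open scoped Manifold in
theorem IsH10With.mul (hΩ : IsOpen Ω) [IsFiniteMeasure (volume.restrict Ω)] (hΓ : IsClosed Γ)
    (h : IsH10With Ω Γ f F) {U : Set Plane} (hU : IsOpen U) (hΩU : Ω ⊆ U)
    (hcl : closure Ω ⊆ U ∪ Γ) {m : Plane → ℝ} (hm : ContDiffOn ℝ 1 m U) {C : ℝ}
    (hC : ∀ x ∈ Ω, |m x| ≤ C) (hC' : ∀ x ∈ Ω, ‖gradient m x‖ ≤ C) :
    IsH10With Ω Γ (fun x => m x * f x) (fun x => m x • F x + f x • gradient m x) := by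
  have mm : AEStronglyMeasurable m (volume.restrict Ω) :=
    (hm.continuousOn.mono hΩU).aestronglyMeasurable hΩ.measurableSet
  have mgm : AEStronglyMeasurable (gradient m) (volume.restrict Ω) :=
    ((continuousOn_gradient hU hm).mono hΩU).aestronglyMeasurable hΩ.measurableSet
  refine isH10With_of_approx hΩ hΓ (mm.mul h.1.memLp.1)
    ((mm.smul h.1.memLp_grad.1).add (h.1.memLp.1.smul mgm)) fun ε hε => ?_
  set D := |C| + 1
  have hD : 0 < D := by positivity
  have hCD : C ≤ D := (le_abs_self C).trans (by simp [D])
  obtain ⟨φ, hφ, hφc, hφΓ, e1, e2⟩ := h.exists_approx (ε := ε / (2 * D)) (by positivity)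
  have hφ1 : ContDiff ℝ 1 φ := hφ.of_le (by simp)
  have hK : IsCompact (tsupport φ ∩ closure Ω) := hφc.isCompact.inter_right isClosed_closure
  have hKU : tsupport φ ∩ closure Ω ⊆ U := fun x hx =>
    (hcl hx.2).resolve_right fun hxΓ => Set.disjoint_left.1 hφΓ hx.1 hxΓ
  obtain ⟨T, hT, hKT, hTU⟩ := exists_compact_between hK hU hKU
  obtain ⟨ζ, hζ1, hζ0, -⟩ := exists_contMDiffMap_one_nhds_of_subset_interior (n := 1)
    𝓘(ℝ, Plane) hK.isClosed hKT
  have hζ : ContDiff ℝ 1 ζ := ζ.contMDiff.contDiff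
  have hζs : tsupport ζ ⊆ T :=
    closure_minimal (fun x hx => by_contra fun hxT => hx (hζ0 x hxT)) hT.isClosed
  have hev : ∀ x ∈ Ω, (fun y => ζ y * m y * φ y) =ᶠ[𝓝 x] fun y => m y * φ y := by
    intro x hx
    by_cases hxφ : x ∈ tsupport φ
    · filter_upwards [(eventually_nhdsSet_iff_forall.1 hζ1) x ⟨hxφ, subset_closure hx⟩] with y hy
      rw [hy, one_mul]
    · filter_upwards [notMem_tsupport_iff_eventuallyEq.1 hxφ] with y hy
      simp [hy]
  have hgr : ∀ x ∈ Ω, gradient (fun y => ζ y * m y * φ y) x =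
      m x • gradient φ x + φ x • gradient m x := by
    intro x hx
    rw [(hev x hx).gradient_eq]
    exact (((hm.contDiffAt (hU.mem_nhds (hΩU hx))).differentiableAt
      (by simp)).hasGradientAt.mul' (hφ1.differentiable (by simp) x).hasGradientAt).gradient
  have hme : AEStronglyMeasurable (fun x => f x - φ x) (volume.restrict Ω) :=
    h.1.memLp.1.sub hφ.continuous.aestronglyMeasurable
  have hme' : AEStronglyMeasurable (fun x => F x - gradient φ x) (volume.restrict Ω) :=
    h.1.memLp_grad.1.sub (continuous_gradient hφ1).aestronglyMeasurable
  have hDε : D * (ε / (2 * D)) = ε / 2 := by field_simp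
  refine ⟨fun y => ζ y * m y * φ y, ?_, hφc.mul_left, ?_, ?_, ?_⟩
  · refine contDiff_of_contDiffAt_tsupport fun x hx => ?_
    have hxT : x ∈ T := hζs (tsupport_mul_subset_left (tsupport_mul_subset_left hx))
    exact (hζ.contDiffAt.mul (hm.contDiffAt (hU.mem_nhds (hTU hxT)))).mul hφ1.contDiffAt
  · exact Set.disjoint_of_subset_left tsupport_mul_subset_right hφΓ
  · refine (eLpNorm_le_ofReal_mul_of_le hΩ.measurableSet hD.le (fun x hx => ?_) e1).trans
      (ENNReal.ofReal_le_ofReal (by rw [hDε]; linarith))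
    have hx' := (hev x hx).eq_of_nhds
    dsimp only at hx' ⊢
    rw [hx', ← mul_sub, norm_mul]
    gcongr
    exact (hC x hx).trans hCD
  · have a1 : eLpNorm (fun x => m x • (F x - gradient φ x)) 2 (volume.restrict Ω) ≤
        ENNReal.ofReal (ε / 2) := by
      rw [← hDε]
      refine eLpNorm_le_ofReal_mul_of_le hΩ.measurableSet hD.le (fun x hx => ?_) e2
      rw [norm_smul]
      gcongr
      exact (hC x hx).trans hCD
    have a2 : eLpNorm (fun x => (f x - φ x) • gradient m x) 2 (volume.restrict Ω) ≤
        ENNReal.ofReal (ε / 2) := by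
      rw [← hDε]
      refine eLpNorm_le_ofReal_mul_of_le hΩ.measurableSet hD.le (fun x hx => ?_) e1
      rw [norm_smul, mul_comm]
      gcongr
      exact (hC' x hx).trans hCD
    have e : (fun x => m x • F x + f x • gradient m x - gradient (fun y => ζ y * m y * φ y) x)
        =ᵐ[volume.restrict Ω]
        (fun x => m x • (F x - gradient φ x)) + fun x => (f x - φ x) • gradient m x := by
      refine (ae_restrict_iff' hΩ.measurableSet).2 (Eventually.of_forall fun x hx => ?_)
      simp only [hgr x hx, Pi.add_apply, smul_sub, sub_smul]
      abel
    rw [eLpNorm_congr_ae e]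
    refine (eLpNorm_add_le (mm.smul hme') (hme.smul mgm) one_le_two).trans
      ((add_le_add a1 a2).trans ?_)
    rw [← ENNReal.ofReal_add (by positivity) (by positivity), add_halves]

theorem IsH10With.const_mul (hΩ : IsOpen Ω) [IsFiniteMeasure (volume.restrict Ω)]
    (hΓ : IsClosed Γ) (h : IsH10With Ω Γ f F) (c : ℝ) :
    IsH10With Ω Γ (fun x => c * f x) (fun x => c • F x) := by
  have := h.mul hΩ hΓ isOpen_univ (Set.subset_univ _) (by simp) (m := fun _ => c)
    contDiffOn_const (C := |c|) (fun _ _ => le_rfl) (fun x _ => by simp [gradient_fun_const])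
  simpa [gradient_fun_const] using this

theorem IsH1With.mul_of_memLp (hΩ : IsOpen Ω) [IsFiniteMeasure (volume.restrict Ω)]
    (h : IsH1With Ω f F) {m : Plane → ℝ} (hm : ContDiffOn ℝ ∞ m Ω)
    (h1 : MemLp (fun x => m x * f x) 2 (volume.restrict Ω))
    (h2 : MemLp (fun x => m x • F x + f x • gradient m x) 2 (volume.restrict Ω)) :
    IsH1With Ω (fun x => m x * f x) (fun x => m x • F x + f x • gradient m x) :=
  ⟨h1, h2, h.weakGradient.mul_smooth hΩ (locallyIntegrableOn_of_memLp_two h.memLp)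
    (locallyIntegrableOn_of_memLp_two h.memLp_grad) hm⟩

/-- The derivative lives on `[1, 2]`. The bound is scale invariant, so the truncations `s ↦ s Θ(n
s)` used below have derivatives bounded uniformly in `n`. -/
theorem exists_bound_mul_deriv_smoothTransition :
    ∃ C : ℝ, ∀ s, |s * deriv (fun u => Real.smoothTransition (u - 1)) s| ≤ C := by
  set Θ : ℝ → ℝ := fun u => Real.smoothTransition (u - 1)
  have hΘ : ContDiff ℝ 1 Θ := (Real.smoothTransition.contDiff (n := 1)).comp
    (contDiff_id.sub contDiff_const)
  have hc : Continuous (fun s => s * deriv Θ s) := continuous_id.mul (hΘ.continuous_deriv le_rfl)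
  obtain ⟨C, hC⟩ := isCompact_Icc.exists_bound_of_continuousOn (s := Set.Icc (1 : ℝ) 2)
    hc.continuousOn
  refine ⟨max C 0, fun s => ?_⟩
  by_cases hs : s ∈ Set.Icc (1 : ℝ) 2
  · exact (hC s hs).trans (le_max_left _ _)
  · have hd : deriv Θ s = 0 := by
      rw [Set.mem_Icc, not_and_or, not_le, not_le] at hs
      rcases hs with hs | hs
      · have : Θ =ᶠ[𝓝 s] fun _ => 0 := by
          filter_upwards [Iio_mem_nhds hs] with u hu
          exact Real.smoothTransition.zero_of_nonpos (sub_nonpos.2 (le_of_lt hu))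
        rw [this.deriv_eq, deriv_const]
      · have : Θ =ᶠ[𝓝 s] fun _ => 1 := by
          filter_upwards [Ioi_mem_nhds hs] with u hu
          refine Real.smoothTransition.one_of_one_le ?_
          have : (2 : ℝ) < u := hu
          linarith
        rw [this.deriv_eq, deriv_const]
    rw [hd]
    simp

/-- A nonnegative continuous function that vanishes on `Γ`, is smooth where it does not vanish and
has a square integrable gradient belongs to `H¹₀(Ω, Γ)`. -/
theorem isH10With_of_nonneg (hΩ : IsOpen Ω) [IsFiniteMeasure (volume.restrict Ω)]
    (hΓ : IsClosed Γ) (hf0 : ∀ x, 0 ≤ f x) (hfc : Continuous f) (hfs : HasCompactSupport f)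
    (hfΓ : ∀ x ∈ Γ, f x = 0) (hfd : ∀ x, f x ≠ 0 → ContDiffAt ℝ 1 f x)
    (hG : MemLp (gradient f) 2 (volume.restrict Ω)) : IsH10With Ω Γ f (gradient f) := by
  obtain ⟨C, hC⟩ := exists_bound_mul_deriv_smoothTransition
  set Θ : ℝ → ℝ := fun u => Real.smoothTransition (u - 1) with hΘdef
  have hΘ : ContDiff ℝ 1 Θ := (Real.smoothTransition.contDiff (n := 1)).comp
    (contDiff_id.sub contDiff_const)
  have hC0 : 0 ≤ C := (abs_nonneg _).trans (hC 0)
  have hmf : MemLp f 2 (volume.restrict Ω) := memLp_of_continuous_compact hfc hfs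
  let N : ℕ → ℝ := fun n => n + 1
  have hN : ∀ n, 0 < N n := fun n => by positivity
  -- The truncation is zero for `s ≤ 1 / N n` and the identity for `s ≥ 2 / N n`. The composition
  -- with `f` is supported where `f ≥ 1 / N n`, a set that misses `Γ` and on which `f` is `C¹`.
  let τ : ℕ → ℝ → ℝ := fun n s => s * Θ (N n * s)
  have hτd : ∀ n s, HasDerivAt (τ n) (Θ (N n * s) + N n * s * deriv Θ (N n * s)) s := by
    intro n s
    have h1 : HasDerivAt (fun s => N n * s) (N n) s := by
      simpa using (hasDerivAt_id s).const_mul (N n)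
    have h2 : HasDerivAt Θ (deriv Θ (N n * s)) (N n * s) :=
      (hΘ.differentiable (by simp) _).hasDerivAt
    have := (hasDerivAt_id s).mul (h2.comp s h1)
    refine this.congr_deriv ?_
    simp only [id, Function.comp]
    ring
  have hτc : ∀ n, ContDiff ℝ 1 (τ n) := fun n =>
    contDiff_id.mul (hΘ.comp (contDiff_const.mul contDiff_id))
  have hΘ0 : ∀ s, s ≤ 1 → Θ s = 0 := fun s hs =>
    Real.smoothTransition.zero_of_nonpos (sub_nonpos.2 hs)
  have hΘ1 : ∀ s, |Θ s| ≤ 1 := fun s => by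
    rw [abs_of_nonneg (Real.smoothTransition.nonneg _)]
    exact Real.smoothTransition.le_one _
  have hsupp : ∀ n, tsupport (fun x => τ n (f x)) ⊆ {x | 1 / N n ≤ f x} := by
    intro n
    refine closure_minimal (fun x hx => ?_) (isClosed_le continuous_const hfc)
    by_contra hlt
    rw [Set.mem_ofPred_eq, not_le, lt_div_iff₀ (hN n)] at hlt
    exact hx (by simp only [τ]; rw [hΘ0 _ (by linarith), mul_zero])
  have hcd : ∀ n, ContDiff ℝ 1 (fun x => τ n (f x)) := fun n =>
    contDiff_of_contDiffAt_tsupport fun x hx => by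
      have h1 : 1 / N n ≤ f x := hsupp n hx
      have h2 : 0 < 1 / N n := by have := hN n; positivity
      exact (hτc n).contDiffAt.comp x (hfd x (by linarith))
  -- A zero of the nonnegative `f` is a minimum, so its gradient is zero there, by the default value
  -- if `f` is not differentiable. Thus the formula for the truncated gradient below needs no
  -- exceptional set.
  have hg0 : ∀ x, f x = 0 → gradient f x = 0 := fun x hx => by
    have : IsLocalMin f x := Eventually.of_forall fun y => by rw [hx]; exact hf0 y
    simp [gradient, this.fderiv_eq_zero]
  have hgr : ∀ n x, gradient (fun x => τ n (f x)) x =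
      (Θ (N n * f x) + N n * f x * deriv Θ (N n * f x)) • gradient f x := by
    intro n x
    by_cases hx : f x = 0
    · have hx' : x ∉ tsupport (fun x => τ n (f x)) := fun h => by
        have h1 : 1 / N n ≤ f x := hsupp n h
        have h2 : 0 < 1 / N n := by have := hN n; positivity
        linarith
      rw [gradient_eq_zero_of_notMem_tsupport hx', hg0 x hx, smul_zero]
    · exact (HasGradientAt.scomp (hτd n (f x))
        ((hfd x hx).differentiableAt (by simp)).hasGradientAt).gradient
  have hlim : ∀ s, 0 < s → ∀ᶠ n in atTop, 2 < N n * s := by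
    intro s hs
    have : Tendsto (fun n : ℕ => N n * s) atTop atTop :=
      (tendsto_atTop_add_const_right _ 1 tendsto_natCast_atTop_atTop).atTop_mul_const hs
    exact this.eventually_gt_atTop 2
  have hΘe : ∀ s, 2 < s → Θ s = 1 ∧ deriv Θ s = 0 := by
    intro s hs
    have : Θ =ᶠ[𝓝 s] fun _ => 1 := by
      filter_upwards [Ioi_mem_nhds hs] with u hu
      refine Real.smoothTransition.one_of_one_le ?_
      have : (2 : ℝ) < u := hu
      linarith
    exact ⟨this.eq_of_nhds, by rw [this.deriv_eq, deriv_const]⟩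
  have happ : ∀ n, IsH10With Ω Γ (fun x => τ n (f x)) (gradient fun x => τ n (f x)) := by
    intro n
    have hc : HasCompactSupport (fun x => τ n (f x)) :=
      HasCompactSupport.intro hfs fun x hx => by
        simp [τ, image_eq_zero_of_notMem_tsupport hx]
    refine isH10With_of_approx hΩ hΓ (hcd n).continuous.aestronglyMeasurable
      (continuous_gradient (hcd n)).aestronglyMeasurable fun ε hε =>
      ⟨_, hcd n, hc, ?_, by simp, by simp⟩
    refine Set.disjoint_left.2 fun x hx hxΓ => ?_
    have h1 : 1 / N n ≤ f x := hsupp n hx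
    have h2 : 0 < 1 / N n := by have := hN n; positivity
    rw [hfΓ x hxΓ] at h1
    linarith
  refine isH10With_of_tendsto hΩ hΓ hmf.1 hG.1 happ ?_ ?_
  · refine tendsto_eLpNorm_two_of_dominated (b := fun x => 2 * f x)
      (fun n => hmf.1.sub (hcd n).continuous.aestronglyMeasurable) (hmf.const_mul 2)
      (fun n => Eventually.of_forall fun x => ?_) (Eventually.of_forall fun x => ?_)
    · have : f x - τ n (f x) = f x * (1 - Θ (N n * f x)) := by simp only [τ]; ring
      rw [this, norm_mul, mul_comm, Real.norm_of_nonneg (hf0 x)]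
      gcongr
      · exact hf0 x
      · refine (abs_sub _ _).trans ?_
        have := hΘ1 (N n * f x)
        simp only [abs_one]; linarith
    · rcases (hf0 x).eq_or_lt with hx | hx
      · simp [τ, ← hx]
      · refine tendsto_const_nhds.congr' ?_
        filter_upwards [hlim _ hx] with n hn
        simp [τ, (hΘe _ hn).1]
  · refine tendsto_eLpNorm_two_of_dominated (b := fun x => (2 + C) * ‖gradient f x‖)
      (fun n => hG.1.sub (continuous_gradient (hcd n)).aestronglyMeasurable)
      (hG.norm.const_mul _)
      (fun n => Eventually.of_forall fun x => ?_) (Eventually.of_forall fun x => ?_)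
    · rw [hgr, ← one_smul ℝ (gradient f x), smul_smul, mul_one, ← sub_smul, norm_smul, one_smul]
      gcongr
      have h1 := hΘ1 (N n * f x)
      have h2 := hC (N n * f x)
      rw [Real.norm_eq_abs]
      rw [abs_le] at h1 h2 ⊢
      constructor <;> linarith [h1.1, h1.2, h2.1, h2.2]
    · rcases (hf0 x).eq_or_lt with hx | hx
      · simp [hgr, hg0 x hx.symm]
      · refine tendsto_const_nhds.congr' ?_
        filter_upwards [hlim _ hx] with n hn
        rw [hgr, (hΘe _ hn).1, (hΘe _ hn).2]
        simp

end SobolevSpaces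

/-! ### The heights of the circles -/

section CircleHeight

/-- Multiplication by the conjugate, which displays the quadratic vanishing at `t = 0`; the order of
contact of the two circles is read off from this form. -/
theorem circleHeight_mul {R t : ℝ} (ht : |t| ≤ R) :
    circleHeight R t * (R + √(R ^ 2 - t ^ 2)) = t ^ 2 := by
  have h : 0 ≤ R ^ 2 - t ^ 2 := by nlinarith [sq_abs t, abs_nonneg t]
  have := Real.sq_sqrt h
  unfold circleHeight
  nlinarith

theorem circleHeight_nonneg {R : ℝ} (hR : 0 ≤ R) (t : ℝ) : 0 ≤ circleHeight R t := by
  unfold circleHeight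
  rw [sub_nonneg, Real.sqrt_le_left hR]
  nlinarith [sq_nonneg t]

theorem circleHeight_le {R : ℝ} (hR : 0 < R) {t : ℝ} (ht : |t| ≤ R) :
    circleHeight R t ≤ t ^ 2 / R := by
  rw [le_div_iff₀ hR, ← circleHeight_mul ht]
  have := circleHeight_nonneg hR.le t
  have := Real.sqrt_nonneg (R ^ 2 - t ^ 2)
  nlinarith

theorem circleHeight_le_radius (R t : ℝ) : circleHeight R t ≤ R := by
  have := Real.sqrt_nonneg (R ^ 2 - t ^ 2)
  unfold circleHeight
  linarith

theorem circleHeight_eq_div {R : ℝ} (hR : 0 < R) {t : ℝ} (ht : |t| ≤ R) :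
    circleHeight R t = t ^ 2 / (R + √(R ^ 2 - t ^ 2)) := by
  have := Real.sqrt_nonneg (R ^ 2 - t ^ 2)
  rw [eq_div_iff (by positivity), circleHeight_mul ht]

theorem circleHeight_anti {R₀ R₁ : ℝ} (hR₀ : 0 < R₀) (hR : R₀ ≤ R₁) {t : ℝ} (ht : |t| ≤ R₀) :
    circleHeight R₁ t ≤ circleHeight R₀ t := by
  rw [circleHeight_eq_div hR₀ ht, circleHeight_eq_div (hR₀.trans_le hR) (ht.trans hR)]
  have := Real.sqrt_nonneg (R₀ ^ 2 - t ^ 2)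
  gcongr

theorem lt_circleHeight_iff {R t y : ℝ} (hy : y ≤ R) (ht : |t| ≤ R) :
    y < circleHeight R t ↔ 2 * R * y < t ^ 2 + y ^ 2 := by
  have h : 0 ≤ R ^ 2 - t ^ 2 := by nlinarith [sq_abs t, abs_nonneg t]
  unfold circleHeight
  rw [lt_sub_comm, ← Real.sqrt_sq (sub_nonneg.2 hy), Real.sqrt_lt_sqrt_iff h]
  constructor <;> intro h <;> nlinarith

theorem circleHeight_lt_iff {R t y : ℝ} (hy : y ≤ R) :
    circleHeight R t < y ↔ t ^ 2 + y ^ 2 < 2 * R * y := by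
  unfold circleHeight
  rw [sub_lt_comm, Real.lt_sqrt (by linarith)]
  constructor <;> intro h <;> nlinarith

theorem continuous_circleHeight (R : ℝ) : Continuous (circleHeight R) := by
  unfold circleHeight; fun_prop

end CircleHeight

/-! ### The cuspidal region -/

section Region

variable {R₀ R₁ : ℝ}

theorem mem_cuspidalAnnulus (hR₀ : 0 < R₀) (hR₁ : 0 < R₁) {x : Plane} :
    x ∈ cuspidalAnnulus R₀ R₁ ↔
      x 0 ^ 2 + x 1 ^ 2 < 2 * R₁ * x 1 ∧ 2 * R₀ * x 1 < x 0 ^ 2 + x 1 ^ 2 := by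
  have key : ∀ R : ℝ, ‖x - diskCenter R‖ ^ 2 = x 0 ^ 2 + (x 1 - R) ^ 2 := fun R => by
    rw [norm_sq_eq]; simp [diskCenter]
  rw [cuspidalAnnulus, Set.mem_sdiff, mem_ball_iff_norm, mem_closedBall_iff_norm, not_le,
    ← sq_lt_sq₀ (norm_nonneg _) hR₁.le, ← sq_lt_sq₀ hR₀.le (norm_nonneg _), key, key]
  constructor <;> rintro ⟨h1, h2⟩ <;> constructor <;> nlinarith

theorem isOpen_cuspidalAnnulus : IsOpen (cuspidalAnnulus R₀ R₁) :=
  Metric.isOpen_ball.sdiff Metric.isClosed_closedBall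

instance isFiniteMeasure_cuspidalAnnulus :
    IsFiniteMeasure (volume.restrict (cuspidalAnnulus R₀ R₁)) := by
  rw [isFiniteMeasure_restrict]
  exact ((measure_mono Set.sdiff_subset).trans_lt measure_ball_lt_top).ne

theorem isClosed_innerBoundary : IsClosed (innerBoundary R₀) := Metric.isClosed_sphere

theorem zero_mem_innerBoundary (hR₀ : 0 < R₀) : (0 : Plane) ∈ innerBoundary R₀ := by
  have : ‖diskCenter R₀‖ ^ 2 = R₀ ^ 2 := by rw [norm_sq_eq]; simp [diskCenter]
  rw [innerBoundary, mem_sphere_iff_norm, zero_sub, norm_neg]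
  exact (sq_eq_sq₀ (norm_nonneg _) hR₀.le).1 this

theorem mem_innerBoundary (hR₀ : 0 < R₀) {x : Plane} :
    x ∈ innerBoundary R₀ ↔ x 0 ^ 2 + (x 1 - R₀) ^ 2 = R₀ ^ 2 := by
  have : ‖x - diskCenter R₀‖ ^ 2 = x 0 ^ 2 + (x 1 - R₀) ^ 2 := by
    rw [norm_sq_eq]; simp [diskCenter]
  rw [innerBoundary, mem_sphere_iff_norm, ← sq_eq_sq₀ (norm_nonneg _) hR₀.le, this]

/-- The part of the cuspidal annulus below the core. -/
def cuspRegion (R₀ R₁ : ℝ) : Set Plane :=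
  {x | |x 0| < R₀ ∧ circleHeight R₁ (x 0) < x 1 ∧ x 1 < circleHeight R₀ (x 0)}

theorem isOpen_cuspRegion : IsOpen (cuspRegion R₀ R₁) := by
  have c0 : Continuous fun x : Plane => x 0 := by fun_prop
  have c1 : Continuous fun x : Plane => x 1 := by fun_prop
  exact (isOpen_lt c0.abs continuous_const).inter
    ((isOpen_lt ((continuous_circleHeight R₁).comp c0) c1).inter
      (isOpen_lt c1 ((continuous_circleHeight R₀).comp c0)))

theorem cuspRegion_subset (hR₀ : 0 < R₀) (hR : R₀ < R₁) :
    cuspRegion R₀ R₁ ⊆ cuspidalAnnulus R₀ R₁ := by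
  rintro x ⟨h0, h1, h2⟩
  have h3 := circleHeight_le_radius R₀ (x 0)
  rw [mem_cuspidalAnnulus hR₀ (hR₀.trans hR)]
  exact ⟨(circleHeight_lt_iff (by linarith)).1 h1,
    (lt_circleHeight_iff (by linarith) h0.le).1 h2⟩

theorem mem_cuspRegion (hR₀ : 0 < R₀) (hR : R₀ < R₁) {x : Plane}
    (hx : x ∈ cuspidalAnnulus R₀ R₁) (h0 : |x 0| < R₀) (h1 : x 1 < R₀) : x ∈ cuspRegion R₀ R₁ := by
  rw [mem_cuspidalAnnulus hR₀ (hR₀.trans hR)] at hx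
  exact ⟨h0, (circleHeight_lt_iff (by linarith)).2 hx.1, (lt_circleHeight_iff h1.le h0.le).2 hx.2⟩

theorem mem_cuspRegion_of_norm_lt (hR₀ : 0 < R₀) (hR : R₀ < R₁) {x : Plane}
    (hx : x ∈ cuspidalAnnulus R₀ R₁) (h : ‖x‖ < R₀) : x ∈ cuspRegion R₀ R₁ :=
  mem_cuspRegion hR₀ hR hx ((abs_coord_le_norm x 0).trans_lt h)
    ((le_abs_self _).trans_lt ((abs_coord_le_norm x 1).trans_lt h))

instance isFiniteMeasure_cuspRegion : IsFiniteMeasure (volume.restrict (cuspRegion R₀ R₁)) := by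
  rw [isFiniteMeasure_restrict]
  have : cuspRegion R₀ R₁ ⊆ Metric.closedBall 0 (R₀ + (|R₀| + 2 * |R₁|)) := by
    rintro x ⟨h0, h1, h2⟩
    rw [mem_closedBall_zero_iff]
    refine (norm_le_abs_add_abs x).trans (add_le_add h0.le ?_)
    have h3 := circleHeight_le_radius R₀ (x 0)
    have h4 : -(2 * |R₁|) ≤ circleHeight R₁ (x 0) := by
      unfold circleHeight
      have : √(R₁ ^ 2 - x 0 ^ 2) ≤ |R₁| := Real.sqrt_le_iff.2 ⟨abs_nonneg _, by
        rw [sq_abs]; nlinarith [sq_nonneg (x 0)]⟩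
      linarith [neg_abs_le R₁]
    rw [abs_le]
    constructor <;> linarith [le_abs_self R₀, abs_nonneg R₀, abs_nonneg R₁]
  exact ((measure_mono this).trans_lt measure_closedBall_lt_top).ne

end Region

/-! ### Slicing -/

section Slicing

theorem measurePreserving_toPlane :
    MeasurePreserving (fun p : ℝ × ℝ => (!₂[p.1, p.2] : Plane)) :=
  (PiLp.volume_preserving_toLp (Fin 2)).comp (volume_preserving_finTwoArrow ℝ).symm

theorem measurableEmbedding_toPlane :
    MeasurableEmbedding (fun p : ℝ × ℝ => (!₂[p.1, p.2] : Plane)) :=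
  (MeasurableEquiv.toLp 2 (Fin 2 → ℝ)).measurableEmbedding.comp
    MeasurableEquiv.finTwoArrow.symm.measurableEmbedding

theorem integral_eq_of_slices {A B : Plane → ℝ} (hA : Integrable A) (hB : Integrable B)
    (h : ∀ t, ∫ y, A !₂[t, y] = ∫ y, B !₂[t, y]) : ∫ x, A x = ∫ x, B x := by
  have key : ∀ C : Plane → ℝ, Integrable C → ∫ x, C x = ∫ t, ∫ y, C !₂[t, y] := fun C hC => by
    rw [← measurePreserving_toPlane.integral_comp measurableEmbedding_toPlane, Measure.volume_eq_prod,
      integral_prod]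
    exact (measurePreserving_toPlane.integrable_comp_emb measurableEmbedding_toPlane).2 hC
  rw [key A hA, key B hB]
  exact integral_congr_ae (Eventually.of_forall h)

theorem lintegral_slices {A : Plane → ENNReal} (hA : Measurable A) :
    ∫⁻ x, A x = ∫⁻ t, ∫⁻ y, A !₂[t, y] := by
  rw [← measurePreserving_toPlane.lintegral_comp_emb measurableEmbedding_toPlane, Measure.volume_eq_prod,
      lintegral_prod]
  exact (hA.comp measurePreserving_toPlane.measurable).aemeasurable

end Slicing

/-! ### Integration along the slices of the cusp -/

section Cusp

variable {R₀ R₁ : ℝ}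

theorem eLpNorm_two_eq_ofReal_sqrt {α E : Type*} [MeasurableSpace α] {μ : Measure α}
    [NormedAddCommGroup E] {f : α → E} (hf : MemLp f 2 μ) :
    eLpNorm f 2 μ = ENNReal.ofReal (√(∫ x, ‖f x‖ ^ 2 ∂μ)) := by
  rw [hf.eLpNorm_eq_integral_rpow_norm two_ne_zero ENNReal.ofNat_ne_top, Real.sqrt_eq_rpow]
  simp

theorem hasDerivAt_slice {φ : Plane → ℝ} (hφ : ContDiff ℝ 1 φ) (t y : ℝ) :
    HasDerivAt (fun y => φ !₂[t, y]) (gradient φ !₂[t, y] 1) y := by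
  have h1 : HasDerivAt (fun y => (!₂[t, y] : Plane)) (EuclideanSpace.single 1 1) y := by
    have e : (fun y => (!₂[t, y] : Plane)) =
        fun y => (!₂[t, 0] : Plane) + y • EuclideanSpace.single (1 : Fin 2) (1 : ℝ) := by
      ext y i
      fin_cases i <;> simp
    rw [e]
    simpa using ((hasDerivAt_id y).smul_const
      (EuclideanSpace.single (1 : Fin 2) (1 : ℝ) : Plane)).const_add (!₂[t, 0] : Plane)
  rw [gradient_apply_eq_fderiv]
  exact (hφ.differentiable (by simp) _).hasFDerivAt.comp_hasDerivAt y h1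

theorem slice_indicator_cuspRegion (A : Plane → ℝ) (t : ℝ) :
    ∫ y, (cuspRegion R₀ R₁).indicator A !₂[t, y] =
      if |t| < R₀ then ∫ y in Set.Ioo (circleHeight R₁ t) (circleHeight R₀ t), A !₂[t, y]
      else 0 := by
  split_ifs with ht
  · rw [← integral_indicator measurableSet_Ioo]
    refine integral_congr_ae (Eventually.of_forall fun y => ?_)
    by_cases hy : y ∈ Set.Ioo (circleHeight R₁ t) (circleHeight R₀ t)
    · have : (!₂[t, y] : Plane) ∈ cuspRegion R₀ R₁ := ⟨ht, by simpa using hy.1, by simpa using hy.2⟩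
      dsimp only
      rw [Set.indicator_of_mem this, Set.indicator_of_mem hy]
    · have : (!₂[t, y] : Plane) ∉ cuspRegion R₀ R₁ := fun h => hy
        ⟨by simpa using h.2.1, by simpa using h.2.2⟩
      dsimp only
      rw [Set.indicator_of_notMem this, Set.indicator_of_notMem hy]
  · have : ∀ y, (cuspRegion R₀ R₁).indicator A !₂[t, y] = 0 := fun y =>
      Set.indicator_of_notMem (fun h => ht (by simpa using h.1)) _
    simp [this]

/-- On each vertical slice, integrate the derivative of `(y - H₁) φ`. The first factor vanishes at
the outer end and `φ` at the inner end, so no condition on the outer circle is needed. A weight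
depending only on `x 0` is constant along the slice. The lemma is used with `a = t⁻⁴` for the
Poincaré inequality, and with the cut-off to turn the source into a flux. -/
theorem setIntegral_cuspRegion_eq_neg (hR₀ : 0 < R₀) (hR : R₀ < R₁) {φ : Plane → ℝ}
    (hφ : ContDiff ℝ 1 φ) (hφ0 : ∀ x ∈ innerBoundary R₀, φ x = 0) (a : ℝ → ℝ)
    (h1 : IntegrableOn (fun x => a (x 0) * φ x) (cuspRegion R₀ R₁))
    (h2 : IntegrableOn (fun x => a (x 0) * ((x 1 - circleHeight R₁ (x 0)) * gradient φ x 1))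
      (cuspRegion R₀ R₁)) :
    ∫ x in cuspRegion R₀ R₁, a (x 0) * φ x =
      -∫ x in cuspRegion R₀ R₁, a (x 0) * ((x 1 - circleHeight R₁ (x 0)) * gradient φ x 1) := by
  have hS := (isOpen_cuspRegion (R₀ := R₀) (R₁ := R₁)).measurableSet
  rw [← integral_neg, ← integral_indicator hS, ← integral_indicator hS]
  refine integral_eq_of_slices (h1.integrable_indicator hS) (h2.neg.integrable_indicator hS)
    fun t => ?_
  rw [slice_indicator_cuspRegion, slice_indicator_cuspRegion]
  split_ifs with ht
  swap
  · rfl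
  have hle := circleHeight_anti hR₀ hR.le ht.le
  rw [← integral_Ioc_eq_integral_Ioo, ← integral_Ioc_eq_integral_Ioo,
    ← intervalIntegral.integral_of_le hle, ← intervalIntegral.integral_of_le hle]
  simp only [Matrix.cons_val_zero, Matrix.cons_val_one]
  rw [intervalIntegral.integral_const_mul, intervalIntegral.integral_neg,
    intervalIntegral.integral_const_mul, ← mul_neg]
  congr 1
  have cs : Continuous fun y : ℝ => (!₂[t, y] : Plane) := by fun_prop
  have cφ : Continuous fun y => φ !₂[t, y] := hφ.continuous.comp cs
  have cp : Continuous fun x : Plane => x 1 := by fun_prop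
  have cg : Continuous fun y => (y - circleHeight R₁ t) * gradient φ !₂[t, y] 1 :=
    (continuous_id.sub continuous_const).mul (cp.comp ((continuous_gradient hφ).comp cs))
  rw [eq_neg_iff_add_eq_zero, ← intervalIntegral.integral_add (cφ.intervalIntegrable _ _)
    (cg.intervalIntegrable _ _)]
  have hd : ∀ y, HasDerivAt (fun y => (y - circleHeight R₁ t) * φ !₂[t, y])
      (φ !₂[t, y] + (y - circleHeight R₁ t) * gradient φ !₂[t, y] 1) y := by
    intro y
    refine (((hasDerivAt_id y).sub_const (circleHeight R₁ t)).mul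
      (hasDerivAt_slice hφ t y)).congr_deriv ?_
    simp
  rw [intervalIntegral.integral_eq_sub_of_hasDerivAt (fun y _ => hd y)
    ((cφ.add cg).intervalIntegrable _ _)]
  have hz : φ !₂[t, circleHeight R₀ t] = 0 := by
    refine hφ0 _ ((mem_innerBoundary hR₀).2 ?_)
    have hn : 0 ≤ R₀ ^ 2 - t ^ 2 := by nlinarith [sq_abs t, abs_nonneg t]
    simp [circleHeight, Real.sq_sqrt hn]
  rw [hz]
  simp

theorem cuspRegion_bounds (hR₀ : 0 < R₀) (hR : R₀ < R₁) {x : Plane} (hx : x ∈ cuspRegion R₀ R₁) :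
    x 0 ≠ 0 ∧ 0 < x 1 ∧ x 1 ≤ x 0 ^ 2 / R₀ ∧ 0 < x 1 - circleHeight R₁ (x 0) ∧
      x 1 - circleHeight R₁ (x 0) ≤ x 0 ^ 2 / R₀ ∧ ‖x‖ ≤ 2 * |x 0| := by
  obtain ⟨h0, h1, h2⟩ := hx
  have h3 := circleHeight_nonneg (hR₀.trans hR).le (x 0)
  have h4 := circleHeight_le hR₀ h0.le
  have h5 : x 0 ^ 2 / R₀ ≤ |x 0| := by
    rw [div_le_iff₀ hR₀]
    nlinarith [sq_abs (x 0), abs_nonneg (x 0)]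
  have h6 : 0 < x 1 := by linarith
  refine ⟨fun h => ?_, h6, by linarith, by linarith, by linarith, ?_⟩
  · rw [h] at h4
    simp only [ne_eq, OfNat.ofNat_ne_zero, not_false_eq_true, zero_pow, zero_div] at h4
    rw [h] at h2
    linarith
  · have := norm_le_abs_add_abs x
    rw [abs_of_pos h6] at this
    linarith

/-- The cusp point lies on the inner circle, so a function vanishing near that circle vanishes near
the cusp. Negative powers of `x 0` are then harmless on its support. -/
theorem exists_le_abs_of_disjoint (hR₀ : 0 < R₀) (hR : R₀ < R₁) {φ : Plane → ℝ}
    (hφ : Disjoint (tsupport φ) (innerBoundary R₀)) :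
    ∃ ε > 0, ∀ x ∈ cuspRegion R₀ R₁, x ∈ tsupport φ → ε ≤ |x 0| := by
  have h0 : (tsupport φ)ᶜ ∈ 𝓝 (0 : Plane) := (isClosed_tsupport φ).isOpen_compl.mem_nhds
    fun h => Set.disjoint_left.1 hφ h (zero_mem_innerBoundary hR₀)
  obtain ⟨ε, hε, hb⟩ := Metric.mem_nhds_iff.1 h0
  refine ⟨ε / 2, by positivity, fun x hx hxs => ?_⟩
  by_contra hlt
  have := (cuspRegion_bounds hR₀ hR hx).2.2.2.2.2
  exact hb (mem_ball_zero_iff.2 (by linarith)) hxs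

theorem integrableOn_of_bounded {S : Set Plane} (hS : MeasurableSet S)
    [IsFiniteMeasure (volume.restrict S)] {A : Plane → ℝ} (hA : Measurable A) {C : ℝ}
    (h : ∀ x ∈ S, |A x| ≤ C) : IntegrableOn A S :=
  Integrable.of_bound hA.aestronglyMeasurable C ((ae_restrict_iff' hS).2 (Eventually.of_forall h))

theorem measurable_coord (i : Fin 2) : Measurable fun x : Plane => x i := by fun_prop

/-- Apply the slice identity to `φ²` with weight `t⁻⁴`. Since `y - H₁ ≤ t² / R₀`, the right-hand
side is at most `(2 / R₀) ∫ |φ / t²| |∇φ|`, and Young's inequality absorbs half of the left-hand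
side. The absorption is legitimate because the support condition makes that side finite. -/
theorem poincare_smooth (hR₀ : 0 < R₀) (hR : R₀ < R₁) {φ : Plane → ℝ} (hφ : ContDiff ℝ 1 φ)
    (hc : HasCompactSupport φ) (hφΓ : Disjoint (tsupport φ) (innerBoundary R₀)) :
    eLpNorm (fun x => φ x / x 0 ^ 2) 2 (volume.restrict (cuspRegion R₀ R₁)) ≤
      ENNReal.ofReal (2 / R₀) * eLpNorm (gradient φ) 2 (volume.restrict (cuspRegion R₀ R₁)) := by
  have hS := (isOpen_cuspRegion (R₀ := R₀) (R₁ := R₁)).measurableSet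
  obtain ⟨ε, hε, hεφ⟩ := exists_le_abs_of_disjoint hR₀ hR hφΓ
  obtain ⟨C, hC⟩ := hc.exists_bound_of_continuous hφ.continuous
  obtain ⟨D, hD⟩ := (hasCompactSupport_gradient hc).exists_bound_of_continuous
    (continuous_gradient hφ)
  have hC0 : 0 ≤ C := (norm_nonneg _).trans (hC 0)
  have hD0 : 0 ≤ D := (norm_nonneg _).trans (hD 0)
  have mφ : Measurable φ := hφ.continuous.measurable
  have mg : Measurable (gradient φ) := (continuous_gradient hφ).measurable
  have mg1 : Measurable fun x => gradient φ x 1 := (measurable_coord 1).comp mg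
  have mH : Measurable fun x : Plane => circleHeight R₁ (x 0) :=
    (continuous_circleHeight R₁).measurable.comp (measurable_coord 0)
  have m0 := measurable_coord 0
  have m1 := measurable_coord 1
  set p : Plane → ℝ := fun x => φ x / x 0 ^ 2 with hp
  have mp : Measurable p := mφ.div (m0.pow_const 2)
  have hpb : ∀ x ∈ cuspRegion R₀ R₁, |p x| ≤ C / ε ^ 2 := by
    intro x hx
    by_cases hxs : x ∈ tsupport φ
    · have h1 := hεφ x hx hxs
      simp only [hp, abs_div, abs_pow]
      gcongr
      exact hC x
    · simp only [hp, image_eq_zero_of_notMem_tsupport hxs, zero_div, abs_zero]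
      positivity
  have lp : MemLp p 2 (volume.restrict (cuspRegion R₀ R₁)) :=
    MemLp.of_bound mp.aestronglyMeasurable _ ((ae_restrict_iff' hS).2 (Eventually.of_forall hpb))
  have lg : MemLp (gradient φ) 2 (volume.restrict (cuspRegion R₀ R₁)) := memLp_gradient hφ hc
  have ip : IntegrableOn (fun x => p x ^ 2) (cuspRegion R₀ R₁) := lp.integrable_sq
  have ig : IntegrableOn (fun x => ‖gradient φ x‖ ^ 2) (cuspRegion R₀ R₁) := lg.norm.integrable_sq
  have hgr : ∀ x, gradient (fun x => φ x * φ x) x = (2 * φ x) • gradient φ x := fun x => by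
    have := (hφ.differentiable (by simp) x).hasGradientAt
    rw [(this.mul' this).gradient, ← add_smul, two_mul]
  have e1 : ∀ x : Plane, (x 0 ^ 4)⁻¹ * (φ x * φ x) = p x ^ 2 := fun x => by
    simp only [hp]; rw [div_pow, ← pow_mul]; ring
  have hb2 : ∀ x ∈ cuspRegion R₀ R₁, |(x 0 ^ 4)⁻¹ * ((x 1 - circleHeight R₁ (x 0)) *
      gradient (fun x => φ x * φ x) x 1)| ≤ 2 / R₀ * |p x| * ‖gradient φ x‖ := by
    intro x hx
    obtain ⟨b0, -, -, b1, b2, -⟩ := cuspRegion_bounds hR₀ hR hx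
    rw [hgr, PiLp.smul_apply, smul_eq_mul, abs_mul, abs_mul, abs_mul, abs_of_pos b1]
    have h3 : |(x 0 ^ 4)⁻¹| = (x 0 ^ 2)⁻¹ * (x 0 ^ 2)⁻¹ := by
      rw [abs_of_nonneg (by positivity), ← mul_inv]; ring
    have hx0 : 0 < x 0 ^ 2 := by positivity
    have h4 : |p x| = |φ x| * (x 0 ^ 2)⁻¹ := by
      simp only [hp, abs_div, abs_of_pos hx0]; rfl
    have h5 : (x 0 ^ 2)⁻¹ * (x 1 - circleHeight R₁ (x 0)) ≤ 1 / R₀ := by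
      rw [inv_mul_le_iff₀ hx0]
      exact b2.trans (le_of_eq (by ring))
    have h6 := abs_coord_le_norm (gradient φ x) 1
    rw [h3, h4, abs_mul, abs_of_pos (zero_lt_two' ℝ)]
    calc _ = ((x 0 ^ 2)⁻¹ * (x 1 - circleHeight R₁ (x 0))) * (2 * (|φ x| * (x 0 ^ 2)⁻¹)) *
          |gradient φ x 1| := by ring
      _ ≤ (1 / R₀) * (2 * (|φ x| * (x 0 ^ 2)⁻¹)) * ‖gradient φ x‖ := by gcongr
      _ = _ := by ring
  have i2 : IntegrableOn (fun x : Plane => (x 0 ^ 4)⁻¹ * ((x 1 - circleHeight R₁ (x 0)) *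
      gradient (fun x => φ x * φ x) x 1)) (cuspRegion R₀ R₁) := by
    refine integrableOn_of_bounded hS ?_ (C := 2 / R₀ * (C / ε ^ 2) * D) fun x hx =>
      (hb2 x hx).trans ?_
    · simp only [hgr, PiLp.smul_apply, smul_eq_mul]
      fun_prop
    · have := hpb x hx
      have := hD x
      gcongr
  have key := setIntegral_cuspRegion_eq_neg hR₀ hR (hφ.mul hφ)
    (fun x hx => by simp [image_eq_zero_of_notMem_tsupport fun h => Set.disjoint_left.1 hφΓ h hx])
    (fun t => (t ^ 4)⁻¹) (by simpa only [e1] using ip) i2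
  simp only [e1] at key
  have hle : ∫ x in cuspRegion R₀ R₁, p x ^ 2 ≤
      ∫ x in cuspRegion R₀ R₁, (1 / 2 * p x ^ 2 + 2 / R₀ ^ 2 * ‖gradient φ x‖ ^ 2) := by
    rw [key, ← integral_neg]
    refine setIntegral_mono_on i2.neg ((ip.const_mul _).add (ig.const_mul _)) hS fun x hx => ?_
    refine (neg_le_abs _).trans ((hb2 x hx).trans ?_)
    have : 0 ≤ (|p x| - 2 / R₀ * ‖gradient φ x‖) ^ 2 := sq_nonneg _
    rw [← sq_abs (p x)]
    have e : 2 / R₀ ^ 2 = (2 / R₀) ^ 2 / 2 := by field_simp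
    rw [e]
    nlinarith
  rw [integral_add (ip.const_mul _) (ig.const_mul _), integral_const_mul, integral_const_mul] at hle
  rw [eLpNorm_two_eq_ofReal_sqrt lp, eLpNorm_two_eq_ofReal_sqrt lg,
    ← ENNReal.ofReal_mul (by positivity)]
  refine ENNReal.ofReal_le_ofReal ?_
  rw [← Real.sqrt_sq (show 0 ≤ 2 / R₀ by positivity), ← Real.sqrt_mul (by positivity)]
  refine Real.sqrt_le_sqrt ?_
  simp only [Real.norm_eq_abs, sq_abs]
  have e : (2 / R₀) ^ 2 = 2 * (2 / R₀ ^ 2) := by field_simp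
  rw [e]
  linarith

/-- The singular weight `t⁻²` excludes passing to the limit in norm; Fatou's lemma along an almost
everywhere convergent subsequence of approximants is enough. -/
theorem IsH10With.poincare (hR₀ : 0 < R₀) (hR : R₀ < R₁) {v : Plane → ℝ} {V : Plane → Plane}
    (h : IsH10With (cuspidalAnnulus R₀ R₁) (innerBoundary R₀) v V) :
    eLpNorm (fun x => v x / x 0 ^ 2) 2 (volume.restrict (cuspRegion R₀ R₁)) ≤
      ENNReal.ofReal (2 / R₀) * eLpNorm V 2 (volume.restrict (cuspidalAnnulus R₀ R₁)) := by
  obtain ⟨hv, φ, hφ, t1, t2⟩ := h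
  have hsub : volume.restrict (cuspRegion R₀ R₁) ≤ volume.restrict (cuspidalAnnulus R₀ R₁) :=
    Measure.restrict_mono (cuspRegion_subset hR₀ hR) le_rfl
  have hφ1 : ∀ n, ContDiff ℝ 1 (φ n) := fun n => (hφ n).1.of_le (by simp)
  have t1' : Tendsto (fun n => eLpNorm (φ n - v) 2 (volume.restrict (cuspidalAnnulus R₀ R₁)))
      atTop (𝓝 0) := by
    refine t1.congr fun n => ?_
    rw [eLpNorm_sub_comm]; rfl
  obtain ⟨ns, hns, hae⟩ := (tendstoInMeasure_of_tendsto_eLpNorm (by simp)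
    (fun n => (hφ1 n).continuous.aestronglyMeasurable) hv.memLp.1 t1').exists_seq_tendsto_ae
  have m0 := measurable_coord 0
  have hlim : ∀ᵐ x ∂(volume.restrict (cuspRegion R₀ R₁)),
      Tendsto (fun i => φ (ns i) x / x 0 ^ 2) atTop (𝓝 (v x / x 0 ^ 2)) := by
    filter_upwards [ae_mono hsub hae] with x hx
    exact hx.div_const _
  refine (Lp.eLpNorm_lim_le_liminf_eLpNorm (fun i => ?_) _ hlim).trans ?_
  · exact ((hφ1 _).continuous.measurable.div (m0.pow_const 2)).aestronglyMeasurable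
  have hb : ∀ i, eLpNorm (fun x => φ (ns i) x / x 0 ^ 2) 2 (volume.restrict (cuspRegion R₀ R₁)) ≤
      ENNReal.ofReal (2 / R₀) * (eLpNorm V 2 (volume.restrict (cuspidalAnnulus R₀ R₁)) +
        eLpNorm (fun x => V x - gradient (φ (ns i)) x) 2
          (volume.restrict (cuspidalAnnulus R₀ R₁))) := by
    intro i
    refine (poincare_smooth hR₀ hR (hφ1 _) (hφ _).2.1 (hφ _).2.2).trans ?_
    gcongr
    refine (eLpNorm_mono_measure _ hsub).trans ?_
    have e : gradient (φ (ns i)) = V - fun x => V x - gradient (φ (ns i)) x := by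
      ext x : 1; simp
    conv_lhs => rw [e]
    exact eLpNorm_sub_le hv.memLp_grad.1
      (hv.memLp_grad.1.sub (continuous_gradient (hφ1 _)).aestronglyMeasurable) one_le_two
  have ht : Tendsto (fun i => ENNReal.ofReal (2 / R₀) *
      (eLpNorm V 2 (volume.restrict (cuspidalAnnulus R₀ R₁)) +
        eLpNorm (fun x => V x - gradient (φ (ns i)) x) 2
          (volume.restrict (cuspidalAnnulus R₀ R₁)))) atTop
      (𝓝 (ENNReal.ofReal (2 / R₀) *
        (eLpNorm V 2 (volume.restrict (cuspidalAnnulus R₀ R₁)) + 0))) :=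
    ENNReal.Tendsto.const_mul (tendsto_const_nhds.add (t2.comp hns.tendsto_atTop))
      (Or.inr ENNReal.ofReal_ne_top)
  rw [add_zero] at ht
  rw [← ht.liminf_eq]
  exact liminf_le_liminf (Eventually.of_forall hb)

/-- The slice identity extended by density, for a weight without singularity. It trades a source of
order zero for a vertical flux of size `t²`. -/
theorem IsH10With.setIntegral_cuspRegion (hR₀ : 0 < R₀) (hR : R₀ < R₁) {v : Plane → ℝ}
    {V : Plane → Plane} (h : IsH10With (cuspidalAnnulus R₀ R₁) (innerBoundary R₀) v V)
    {a : ℝ → ℝ} (ha : Continuous a) :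
    ∫ x in cuspRegion R₀ R₁, v x * a (x 0) =
      -∫ x in cuspRegion R₀ R₁, V x 1 * (a (x 0) * (x 1 - circleHeight R₁ (x 0))) := by
  have hS := (isOpen_cuspRegion (R₀ := R₀) (R₁ := R₁)).measurableSet
  obtain ⟨hv, φ, hφ, t1, t2⟩ := h
  have hsub : volume.restrict (cuspRegion R₀ R₁) ≤ volume.restrict (cuspidalAnnulus R₀ R₁) :=
    Measure.restrict_mono (cuspRegion_subset hR₀ hR) le_rfl
  have hφ1 : ∀ n, ContDiff ℝ 1 (φ n) := fun n => (hφ n).1.of_le (by simp)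
  have hz : ∀ {a b : ℕ → ENNReal}, (∀ n, b n ≤ a n) → Tendsto a atTop (𝓝 0) →
      Tendsto b atTop (𝓝 0) := fun hle ha =>
    tendsto_of_tendsto_of_tendsto_of_le_of_le tendsto_const_nhds ha (fun _ => zero_le) hle
  obtain ⟨C, hC⟩ := isCompact_Icc.exists_bound_of_continuousOn (s := Set.Icc (-R₀) R₀)
    ha.continuousOn
  have hC' : ∀ x ∈ cuspRegion R₀ R₁, |a (x 0)| ≤ C := fun x hx =>
    hC _ ⟨(abs_lt.1 hx.1).1.le, (abs_lt.1 hx.1).2.le⟩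
  have m0 := measurable_coord 0
  have m1 := measurable_coord 1
  have ma : Measurable fun x : Plane => a (x 0) := ha.measurable.comp m0
  have mH : Measurable fun x : Plane => circleHeight R₁ (x 0) :=
    (continuous_circleHeight R₁).measurable.comp m0
  have l1 : MemLp (fun x : Plane => a (x 0)) 2 (volume.restrict (cuspRegion R₀ R₁)) :=
    MemLp.of_bound ma.aestronglyMeasurable C ((ae_restrict_iff' hS).2 (Eventually.of_forall hC'))
  have l2 : MemLp (fun x : Plane => a (x 0) * (x 1 - circleHeight R₁ (x 0))) 2
      (volume.restrict (cuspRegion R₀ R₁)) := by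
    refine MemLp.of_bound (ma.mul (m1.sub mH)).aestronglyMeasurable (C * R₀)
      ((ae_restrict_iff' hS).2 (Eventually.of_forall fun x hx => ?_))
    obtain ⟨-, -, -, b1, b2, -⟩ := cuspRegion_bounds hR₀ hR hx
    rw [norm_mul]
    have h1 := hC' x hx
    have h2 := circleHeight_le_radius R₀ (x 0)
    have h3 := circleHeight_nonneg (hR₀.trans hR).le (x 0)
    have h4 : ‖x 1 - circleHeight R₁ (x 0)‖ ≤ R₀ := by
      rw [Real.norm_of_nonneg b1.le]; linarith [hx.2.2]
    have : 0 ≤ C := (abs_nonneg _).trans h1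
    exact mul_le_mul h1 h4 (norm_nonneg _) this
  have A1 := tendsto_integral_bilin (ContinuousLinearMap.mul ℝ ℝ) l1
    (hv.memLp.mono_measure hsub)
    (fun n => memLp_of_continuous_compact (hφ1 n).continuous (hφ n).2.1)
    (hz (fun n => eLpNorm_mono_measure _ hsub) t1)
  have A2 := tendsto_integral_bilin
    ((ContinuousLinearMap.mul ℝ ℝ).comp (EuclideanSpace.proj 1 : Plane →L[ℝ] ℝ)) l2
    (hv.memLp_grad.mono_measure hsub)
    (fun n => memLp_gradient (hφ1 n) (hφ n).2.1)
    (hz (fun n => eLpNorm_mono_measure _ hsub) t2)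
  simp only [ContinuousLinearMap.mul_apply', ContinuousLinearMap.comp_apply,
    EuclideanSpace.coe_proj] at A1 A2
  refine tendsto_nhds_unique A1 ?_
  refine A2.neg.congr fun n => ?_
  have lφ : MemLp (φ n) 2 (volume.restrict (cuspRegion R₀ R₁)) :=
    memLp_of_continuous_compact (hφ1 n).continuous (hφ n).2.1
  have lg : MemLp (fun x => gradient (φ n) x 1) 2 (volume.restrict (cuspRegion R₀ R₁)) :=
    (memLp_gradient (hφ1 n) (hφ n).2.1).continuousLinearMap_comp
      (EuclideanSpace.proj 1 : Plane →L[ℝ] ℝ)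
  have key := setIntegral_cuspRegion_eq_neg hR₀ hR (hφ1 n)
    (fun x hx => image_eq_zero_of_notMem_tsupport fun h => Set.disjoint_left.1 (hφ n).2.2 h hx) a
    (l1.integrable_mul lφ)
    ((l2.integrable_mul lg).congr (Eventually.of_forall fun x => by simp only [Pi.mul_apply]; ring))
  simp only [mul_comm (φ n _)]
  rw [key]
  congr 2
  ext x
  ring

/-- A feature of the cusp that fails in a full disk: the slice at `t` has length at most `t² / R₀`,
which compensates the factor `t⁻²` exactly. This admits fluxes of size `|x|³` with the weight
`|x|⁻⁴`. -/
theorem memLp_inv_norm (hR₀ : 0 < R₀) (hR : R₀ < R₁) :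
    MemLp (fun x : Plane => ‖x‖⁻¹) 2 (volume.restrict (cuspidalAnnulus R₀ R₁)) := by
  have hS := (isOpen_cuspRegion (R₀ := R₀) (R₁ := R₁)).measurableSet
  have hΩ := (isOpen_cuspidalAnnulus (R₀ := R₀) (R₁ := R₁)).measurableSet
  have m0 := measurable_coord 0
  have hm : Measurable fun x : Plane => ‖x‖⁻¹ := measurable_norm.inv
  have hfin : ∫⁻ x in cuspRegion R₀ R₁, ENNReal.ofReal ((x 0 ^ 2)⁻¹) < ⊤ := by
    rw [← lintegral_indicator hS, lintegral_slices (by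
      exact Measurable.indicator (by fun_prop) hS)]
    have hb : ∀ t, ∫⁻ y, (cuspRegion R₀ R₁).indicator
        (fun x => ENNReal.ofReal ((x 0 ^ 2)⁻¹)) !₂[t, y] ≤
        (Set.Ioo (-R₀) R₀).indicator (fun _ => ENNReal.ofReal (1 / R₀)) t := by
      intro t
      by_cases ht : t ∈ Set.Ioo (-R₀) R₀
      · rw [Set.indicator_of_mem ht]
        have hle : ∀ y, (cuspRegion R₀ R₁).indicator
            (fun x => ENNReal.ofReal ((x 0 ^ 2)⁻¹)) !₂[t, y] ≤
            (Set.Ioo (0 : ℝ) (t ^ 2 / R₀)).indicator (fun _ => ENNReal.ofReal ((t ^ 2)⁻¹)) y := by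
          intro y
          by_cases hy : (!₂[t, y] : Plane) ∈ cuspRegion R₀ R₁
          · have hb := cuspRegion_bounds hR₀ hR hy
            have hlt := hy.2.2
            have hH := circleHeight_le hR₀ hy.1.le
            have : y ∈ Set.Ioo (0 : ℝ) (t ^ 2 / R₀) :=
              ⟨by simpa using hb.2.1, by simpa using hlt.trans_le hH⟩
            rw [Set.indicator_of_mem hy, Set.indicator_of_mem this]
            simp
          · rw [Set.indicator_of_notMem hy]
            exact zero_le
        refine (lintegral_mono hle).trans ?_
        rw [lintegral_indicator measurableSet_Ioo, setLIntegral_const, Real.volume_Ioo, sub_zero,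
          ← ENNReal.ofReal_mul (by positivity)]
        refine ENNReal.ofReal_le_ofReal ?_
        rcases eq_or_ne t 0 with rfl | ht0
        · simp; positivity
        · apply le_of_eq; field_simp
      · rw [Set.indicator_of_notMem ht]
        have : ∀ y, (cuspRegion R₀ R₁).indicator
            (fun x => ENNReal.ofReal ((x 0 ^ 2)⁻¹)) !₂[t, y] = 0 := fun y =>
          Set.indicator_of_notMem (fun h => ht (by simpa [abs_lt] using h.1)) _
        simp [this]
    refine (lintegral_mono hb).trans_lt ?_
    rw [lintegral_indicator measurableSet_Ioo, setLIntegral_const, Real.volume_Ioo]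
    exact ENNReal.mul_lt_top ENNReal.ofReal_lt_top ENNReal.ofReal_lt_top
  have l1 : MemLp (fun x : Plane => ‖x‖⁻¹) 2 (volume.restrict (cuspRegion R₀ R₁)) := by
    refine (memLp_two_iff_integrable_sq hm.aestronglyMeasurable).2
      ⟨(hm.pow_const 2).aestronglyMeasurable, ?_⟩
    refine lt_of_le_of_lt (setLIntegral_mono' hS fun x hx => ?_) hfin
    rw [Real.enorm_of_nonneg (by positivity)]
    refine ENNReal.ofReal_le_ofReal ?_
    have hx0 := (cuspRegion_bounds hR₀ hR hx).1
    dsimp only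
    rw [inv_pow]
    have : 0 < x 0 ^ 2 := by positivity
    refine inv_anti₀ this ?_
    rw [norm_sq_eq]; nlinarith [sq_nonneg (x 1)]
  have l2 : MemLp (fun x : Plane => ‖x‖⁻¹) 2
      (volume.restrict (cuspidalAnnulus R₀ R₁ \ cuspRegion R₀ R₁)) := by
    have : IsFiniteMeasure (volume.restrict (cuspidalAnnulus R₀ R₁ \ cuspRegion R₀ R₁)) :=
      isFiniteMeasure_of_le (volume.restrict (cuspidalAnnulus R₀ R₁))
        (Measure.restrict_mono Set.sdiff_subset le_rfl)
    refine MemLp.of_bound hm.aestronglyMeasurable R₀⁻¹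
      ((ae_restrict_iff' (hΩ.diff hS)).2 (Eventually.of_forall fun x hx => ?_))
    have : R₀ ≤ ‖x‖ := by
      by_contra hlt
      exact hx.2 (mem_cuspRegion_of_norm_lt hR₀ hR hx.1 (not_le.1 hlt))
    rw [norm_inv, norm_norm]
    gcongr
  have hu : cuspidalAnnulus R₀ R₁ = cuspRegion R₀ R₁ ∪ (cuspidalAnnulus R₀ R₁ \ cuspRegion R₀ R₁) :=
    (Set.union_sdiff_cancel (cuspRegion_subset hR₀ hR)).symm
  rw [memLp_two_iff_integrable_sq hm.aestronglyMeasurable] at l1 l2 ⊢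
  rw [hu]
  exact IntegrableOn.union l1 l2

end Cusp

/-! ### The weighted energy estimate -/

section Weighted

variable {R₀ R₁ : ℝ}

theorem cuspidalAnnulus_bounds (hR₀ : 0 < R₀) (hR : R₀ < R₁) {x : Plane}
    (hx : x ∈ cuspidalAnnulus R₀ R₁) : 0 < ‖x‖ ∧ ‖x‖ ≤ 2 * R₁ ∧ 0 < x 1 ∧ 2 * R₀ * x 1 ≤ ‖x‖ ^ 2 := by
  obtain ⟨h1, h2⟩ := (mem_cuspidalAnnulus hR₀ (hR₀.trans hR)).1 hx
  have hR₁ := hR₀.trans hR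
  have h3 : 0 < x 1 := by
    by_contra h
    nlinarith [sq_nonneg (x 0), sq_nonneg (x 1)]
  have h4 := norm_sq_eq x
  have h5 : 0 < ‖x‖ := by
    rw [norm_pos_iff]
    rintro rfl
    simp at h3
  refine ⟨h5, ?_, h3, by linarith⟩
  have h6 := (le_abs_self _).trans (abs_coord_le_norm x 1)
  nlinarith

theorem hasGradientAt_inv_pow {δ : ℝ} {x : Plane} (h : 0 < ‖x‖ ^ 2 + δ) (j : ℕ) :
    HasGradientAt (fun y : Plane => ((‖y‖ ^ 2 + δ) ^ j)⁻¹)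
      (-(2 * j * ((‖x‖ ^ 2 + δ) ^ (j + 1))⁻¹) • x) x := by
  have h1 : HasGradientAt (fun y : Plane => ‖y‖ ^ 2 + δ) ((2 : ℝ) • x) x := by
    rw [hasGradientAt_iff_hasFDerivAt]
    refine ((hasStrictFDerivAt_norm_sq x).hasFDerivAt.add_const δ).congr_fderiv ?_
    ext y
    simp
  have h2 : HasDerivAt (fun s : ℝ => (s ^ j)⁻¹) (-(j * ((‖x‖ ^ 2 + δ) ^ (j + 1))⁻¹))
      (‖x‖ ^ 2 + δ) := by
    refine ((hasDerivAt_pow j (‖x‖ ^ 2 + δ)).fun_inv (by positivity)).congr_deriv ?_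
    rcases j with _ | j
    · simp
    · simp only [Nat.add_sub_cancel]
      field_simp
      ring
  have := HasGradientAt.scomp (f := fun y : Plane => ‖y‖ ^ 2 + δ) h2 h1
  convert this using 1
  rw [smul_smul]
  congr 1
  ring

theorem contDiff_inv_pow {δ : ℝ} (hδ : 0 < δ) (j : ℕ) :
    ContDiff ℝ ∞ (fun y : Plane => ((‖y‖ ^ 2 + δ) ^ j)⁻¹) := by
  refine ContDiff.inv (((contDiff_norm_sq ℝ).add contDiff_const).pow j) fun x => ?_
  positivity

/-- With `δ > 0` the weight is smooth on the whole plane and bounded on the annulus with its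
gradient. The product is therefore an admissible test function, which is not yet known for `δ = 0`.
-/
theorem IsH10With.mul_inv_pow (hR₀ : 0 < R₀) (hR : R₀ < R₁) {w : Plane → ℝ} {K : Plane → Plane}
    (hw : IsH10With (cuspidalAnnulus R₀ R₁) (innerBoundary R₀) w K) {δ : ℝ} (hδ : 0 < δ) (j : ℕ) :
    IsH10With (cuspidalAnnulus R₀ R₁) (innerBoundary R₀)
      (fun x => ((‖x‖ ^ 2 + δ) ^ j)⁻¹ * w x)
      (fun x => ((‖x‖ ^ 2 + δ) ^ j)⁻¹ • K x -
        (2 * j * ((‖x‖ ^ 2 + δ) ^ (j + 1))⁻¹ * w x) • x) := by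
  have hg : ∀ x : Plane, gradient (fun y : Plane => ((‖y‖ ^ 2 + δ) ^ j)⁻¹) x =
      -(2 * j * ((‖x‖ ^ 2 + δ) ^ (j + 1))⁻¹) • x := fun x =>
    (hasGradientAt_inv_pow (by positivity) j).gradient
  have hle : ∀ (x : Plane) (i : ℕ), ((‖x‖ ^ 2 + δ) ^ i)⁻¹ ≤ (δ ^ i)⁻¹ := fun x i => by
    gcongr
    nlinarith [sq_nonneg ‖x‖]
  have h := hw.mul isOpen_cuspidalAnnulus isClosed_innerBoundary isOpen_univ (Set.subset_univ _)
    (by simp) ((contDiff_inv_pow hδ j).of_le (by simp)).contDiffOn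
    (C := max (δ ^ j)⁻¹ (2 * j * (δ ^ (j + 1))⁻¹ * (2 * R₁))) (fun x _ => ?_) (fun x hx => ?_)
  · refine h.congr isOpen_cuspidalAnnulus.measurableSet (fun _ _ => rfl)
      (Eventually.of_forall fun x => ?_)
    simp only [hg, neg_smul, smul_neg, smul_smul, ← sub_eq_add_neg]
    rw [mul_comm (w x)]
  · rw [abs_of_pos (by positivity)]
    exact (hle x j).trans (le_max_left _ _)
  · rw [hg, norm_smul, norm_neg, Real.norm_of_nonneg (by positivity)]
    refine le_trans ?_ (le_max_right _ _)
    have := (cuspidalAnnulus_bounds hR₀ hR hx).2.1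
    have := hle x (j + 1)
    gcongr

theorem integrable_inner_of_memLp {μ : Measure Plane} {A B : Plane → Plane} (hA : MemLp A 2 μ)
    (hB : MemLp B 2 μ) : Integrable (fun x => inner ℝ (A x) (B x)) μ :=
  memLp_one_iff_integrable.1 (hA.of_bilin (fun a b => inner ℝ a b) 1 hB (hA.1.inner hB.1)
    (Eventually.of_forall fun x => by simpa using! nnnorm_inner_le_nnnorm (𝕜 := ℝ) (A x) (B x)))

set_option maxHeartbeats 800000 in
/-- The pointwise inequality behind the weighted energy estimate. -/
theorem energy_pointwise {x K F : Plane} {w g lam δ A r R₁ q : ℝ} (hx : 0 < ‖x‖) (hδ : 0 < δ)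
    (hxR : ‖x‖ ≤ 2 * R₁) (hlam : 0 ≤ lam) (hr : 0 < r) (hA : A = 18 + (lam + 1) * (2 * R₁) ^ 2)
    (hq0 : 0 ≤ q) (hq : ‖x‖ < r → (((‖x‖ ^ 2 + δ) ^ 2)⁻¹ * w) ^ 2 / ‖x‖ ^ 4 ≤ q) :
    (‖((‖x‖ ^ 2 + δ) ^ 2)⁻¹ • K - (4 * ((‖x‖ ^ 2 + δ) ^ 3)⁻¹ * w) • x‖ ^ 2 -
      inner ℝ K (((‖x‖ ^ 2 + δ) ^ 4)⁻¹ • K - (8 * ((‖x‖ ^ 2 + δ) ^ 5)⁻¹ * w) • x)) +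
      lam * (w * (((‖x‖ ^ 2 + δ) ^ 4)⁻¹ * w)) + g * (((‖x‖ ^ 2 + δ) ^ 4)⁻¹ * w) +
      inner ℝ F (((‖x‖ ^ 2 + δ) ^ 4)⁻¹ • K - (8 * ((‖x‖ ^ 2 + δ) ^ 5)⁻¹ * w) • x) ≤
    1 / 2 * ‖((‖x‖ ^ 2 + δ) ^ 2)⁻¹ • K - (4 * ((‖x‖ ^ 2 + δ) ^ 3)⁻¹ * w) • x‖ ^ 2 +
      A * r ^ 2 * q + A * (r ^ 10)⁻¹ * w ^ 2 + ((‖x‖ ^ 4)⁻¹ * g) ^ 2 +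
      3 * ‖(‖x‖ ^ 4)⁻¹ • F‖ ^ 2 := by
  set n := ‖x‖ with hn
  set s := (n ^ 2 + δ)⁻¹ with hs
  have hσ : 0 < n ^ 2 + δ := by positivity
  have hs0 : 0 < s := by positivity
  have hsn : s * n ^ 2 ≤ 1 := by
    rw [hs, inv_mul_le_iff₀ hσ]; linarith
  set W := s ^ 2 * w with hW
  set Y : Plane := s ^ 2 • K - (4 * s ^ 3 * w) • x with hY
  set f := ‖(n ^ 4)⁻¹ • F‖ with hf
  have hf' : f = (n ^ 4)⁻¹ * ‖F‖ := by rw [hf, norm_smul, Real.norm_of_nonneg (by positivity)]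
  set γ := (n ^ 4)⁻¹ * g with hγ
  simp only [← inv_pow, ← hs] at hq ⊢
  rw [← hY]
  -- the left-hand side in terms of `W`, `Y`
  have eY : ‖Y‖ ^ 2 = s ^ 4 * ‖K‖ ^ 2 - 8 * s ^ 5 * w * inner ℝ K x + 16 * s ^ 6 * w ^ 2 * n ^ 2 := by
    rw [hY, norm_sub_sq_real, norm_smul, norm_smul, inner_smul_left, inner_smul_right, mul_pow,
      mul_pow, Real.norm_eq_abs, Real.norm_eq_abs, sq_abs, sq_abs]
    simp only [conj_trivial]
    ring
  have eK : inner ℝ K (s ^ 4 • K - (8 * s ^ 5 * w) • x) =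
      s ^ 4 * ‖K‖ ^ 2 - 8 * s ^ 5 * w * inner ℝ K x := by
    rw [inner_sub_right, inner_smul_right, inner_smul_right, real_inner_self_eq_norm_sq]
  have eF : inner ℝ F (s ^ 4 • K - (8 * s ^ 5 * w) • x) =
      s ^ 2 * inner ℝ F Y - 4 * s ^ 3 * W * inner ℝ F x := by
    rw [hY, hW, inner_sub_right, inner_sub_right, inner_smul_right, inner_smul_right,
      inner_smul_right, inner_smul_right]
    ring
  have n4 : s ^ 2 ≤ (n ^ 4)⁻¹ := by
    rw [le_inv_comm₀ (by positivity) (by positivity), hs, inv_pow, inv_inv]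
    nlinarith [sq_nonneg n]
  -- In `‖Y‖² - ⟪K, V⟫` the cross terms cancel, as in `|∇(m w)|² = ∇w · ∇(m² w) + w² |∇m|²` with `m
  -- = σ⁻²`. Only the term with the gradient of the weight remains.
  have b1 : 16 * s ^ 6 * w ^ 2 * n ^ 2 ≤ 16 * (W ^ 2 / n ^ 2) := by
    have : 16 * s ^ 6 * w ^ 2 * n ^ 2 = 16 * (W ^ 2 / n ^ 2) * (s * n ^ 2) ^ 2 := by
      rw [hW]; field_simp
    rw [this]
    have h1 : (s * n ^ 2) ^ 2 ≤ 1 := pow_le_one₀ (by positivity) hsn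
    exact mul_le_of_le_one_right (by positivity) h1
  have b2 : g * (s ^ 4 * w) ≤ 1 / 2 * γ ^ 2 + 1 / 2 * W ^ 2 := by
    have h1 : g * (s ^ 4 * w) = γ * (s ^ 2 * n ^ 4) * W := by
      rw [hW, hγ]; field_simp
    have h2 : (s ^ 2 * n ^ 4) ^ 2 ≤ 1 := pow_le_one₀ (by positivity) (by
      rw [← le_div_iff₀ (by positivity), one_div]; exact n4)
    have h3 : (γ * (s ^ 2 * n ^ 4)) ^ 2 ≤ γ ^ 2 := by
      rw [mul_pow]; exact mul_le_of_le_one_right (sq_nonneg _) h2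
    rw [h1]
    nlinarith [sq_nonneg (γ * (s ^ 2 * n ^ 4) - W)]
  have b3 : s ^ 2 * inner ℝ F Y ≤ 1 / 2 * ‖Y‖ ^ 2 + 1 / 2 * f ^ 2 := by
    have h1 : s ^ 2 * inner ℝ F Y ≤ f * ‖Y‖ := by
      rw [hf']
      calc s ^ 2 * inner ℝ F Y ≤ s ^ 2 * (‖F‖ * ‖Y‖) := by gcongr; exact real_inner_le_norm F Y
        _ ≤ (n ^ 4)⁻¹ * (‖F‖ * ‖Y‖) := by gcongr
        _ = _ := by ring
    nlinarith [sq_nonneg (f - ‖Y‖)]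
  have b4 : -(4 * s ^ 3 * W * inner ℝ F x) ≤ 2 * (W ^ 2 / n ^ 2) + 2 * f ^ 2 := by
    have h1 : -(4 * s ^ 3 * W * inner ℝ F x) ≤ 4 * (|W| / n) * f := by
      calc -(4 * s ^ 3 * W * inner ℝ F x) ≤ |4 * s ^ 3 * W * inner ℝ F x| := neg_le_abs _
        _ = 4 * s ^ 3 * |W| * |inner ℝ F x| := by
          rw [abs_mul, abs_mul, abs_of_pos (show 0 < 4 * s ^ 3 by positivity)]
        _ ≤ 4 * s ^ 3 * |W| * (‖F‖ * n) := by gcongr; exact abs_real_inner_le_norm F x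
        _ = 4 * (|W| / n) * (s ^ 2 * ‖F‖) * (s * n ^ 2) := by field_simp
        _ ≤ 4 * (|W| / n) * ((n ^ 4)⁻¹ * ‖F‖) * 1 := by gcongr
        _ = _ := by rw [hf', mul_one]
    have h2 : (|W| / n) ^ 2 = W ^ 2 / n ^ 2 := by rw [div_pow, sq_abs]
    nlinarith [sq_nonneg (|W| / n - f)]
  -- Here `18 = 16 + 2` collects the contributions of the weight and of the flux; the zero order
  -- terms are brought to the same form by `n ≤ 2 R₁`.
  have b5 : (18 / n ^ 2 + (lam + 1)) * W ^ 2 ≤ A * (W ^ 2 / n ^ 2) := by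
    have : A * (W ^ 2 / n ^ 2) = (18 / n ^ 2 + (lam + 1) * ((2 * R₁) ^ 2 / n ^ 2)) * W ^ 2 := by
      rw [hA]; ring
    rw [this]
    have h1 : 1 ≤ (2 * R₁) ^ 2 / n ^ 2 := by
      rw [one_le_div (by positivity)]; gcongr
    have h2 : lam + 1 ≤ (lam + 1) * ((2 * R₁) ^ 2 / n ^ 2) :=
      le_mul_of_one_le_right (by positivity) h1
    exact mul_le_mul_of_nonneg_right (by linarith) (sq_nonneg W)
  have hA0 : 0 ≤ A := by rw [hA]; positivity
  -- Near the cusp `W² / n² = n² · W² / n⁴`, which gains the small factor `r²` over the quantity in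
  -- the Poincaré inequality. Farther away the weights are bounded, since `W² ≤ n⁻⁸ w²`.
  have b6 : A * (W ^ 2 / n ^ 2) ≤ A * r ^ 2 * q + A * (r ^ 10)⁻¹ * w ^ 2 := by
    rcases lt_or_ge n r with h | h
    · have h1 : W ^ 2 / n ^ 2 ≤ r ^ 2 * q := by
        have h2 : W ^ 2 / n ^ 2 = n ^ 2 * (W ^ 2 / n ^ 4) := by field_simp
        rw [h2]
        have := hq h
        gcongr
      have h3 : 0 ≤ A * (r ^ 10)⁻¹ * w ^ 2 := by positivity
      nlinarith [mul_le_mul_of_nonneg_left h1 hA0]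
    · have h1 : W ^ 2 / n ^ 2 ≤ (r ^ 10)⁻¹ * w ^ 2 := by
        have h2 : W ^ 2 ≤ ((n ^ 4)⁻¹) ^ 2 * w ^ 2 := by
          rw [hW, mul_pow]; gcongr
        calc W ^ 2 / n ^ 2 ≤ (((n ^ 4)⁻¹) ^ 2 * w ^ 2) / n ^ 2 := by gcongr
          _ = (n ^ 10)⁻¹ * w ^ 2 := by field_simp
          _ ≤ _ := by gcongr
      have h3 : 0 ≤ A * r ^ 2 * q := by positivity
      nlinarith [mul_le_mul_of_nonneg_left h1 hA0]
  rw [eK, eF, inv_pow r]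
  have e1 : lam * (w * (s ^ 4 * w)) = lam * W ^ 2 := by rw [hW]; ring
  have e2 : (18 / n ^ 2 + (lam + 1)) * W ^ 2 = 18 * (W ^ 2 / n ^ 2) + lam * W ^ 2 + W ^ 2 := by ring
  rw [e1]
  have h7 : 0 ≤ γ ^ 2 := sq_nonneg _
  have h8 : 0 ≤ f ^ 2 := sq_nonneg _
  have h9 : 0 ≤ W ^ 2 := sq_nonneg _
  linarith

end Weighted

/-! ### Uniform weighted energy bound and removal of the regularisation -/

section WeightedEstimate

variable {R₀ R₁ : ℝ}

theorem memLp_of_memLp_inv_pow_smul (hR₀ : 0 < R₀) (hR : R₀ < R₁) {E : Type*}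
    [NormedAddCommGroup E] [NormedSpace ℝ E] {F : Plane → E} (j : ℕ)
    (hF : MemLp (fun x => (‖x‖ ^ j)⁻¹ • F x) 2 (volume.restrict (cuspidalAnnulus R₀ R₁))) :
    MemLp F 2 (volume.restrict (cuspidalAnnulus R₀ R₁)) := by
  have hΩ := (isOpen_cuspidalAnnulus (R₀ := R₀) (R₁ := R₁)).measurableSet
  have hm : Measurable fun x : Plane => ‖x‖ ^ j := measurable_norm.pow_const j
  have e : (fun x => ‖x‖ ^ j • ((‖x‖ ^ j)⁻¹ • F x)) =ᵐ[volume.restrict (cuspidalAnnulus R₀ R₁)] F := by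
    refine (ae_restrict_iff' hΩ).2 (Eventually.of_forall fun x hx => ?_)
    have := (cuspidalAnnulus_bounds hR₀ hR hx).1
    dsimp only
    rw [smul_smul, mul_inv_cancel₀ (by positivity), one_smul]
  refine MemLp.ae_eq e ?_
  refine MemLp.of_le_mul (c := (2 * R₁) ^ j) hF (hm.aestronglyMeasurable.smul hF.1)
    ((ae_restrict_iff' hΩ).2 (Eventually.of_forall fun x hx => ?_))
  rw [norm_smul, norm_pow, norm_norm]
  have := (cuspidalAnnulus_bounds hR₀ hR hx).2.1
  gcongr

/-- Test the equation with `σ⁻⁴ w`, where `σ = ‖x‖² + δ`, and integrate `energy_pointwise`. The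
equation makes the inner products cancel and leaves the energy of `σ⁻² w` on the left. The crucial
point is that no constant depends on `δ`. -/
theorem IsH10With.energy_bound (hR₀ : 0 < R₀) (hR : R₀ < R₁) {lam : ℝ} (hlam : 0 ≤ lam)
    {w g : Plane → ℝ} {K F : Plane → Plane}
    (hw : IsH10With (cuspidalAnnulus R₀ R₁) (innerBoundary R₀) w K)
    (hg : MemLp (fun x => (‖x‖ ^ 4)⁻¹ * g x) 2 (volume.restrict (cuspidalAnnulus R₀ R₁)))
    (hF : MemLp (fun x => (‖x‖ ^ 4)⁻¹ • F x) 2 (volume.restrict (cuspidalAnnulus R₀ R₁)))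
    (heq : ∀ v V, IsH10With (cuspidalAnnulus R₀ R₁) (innerBoundary R₀) v V →
      ∫ x in cuspidalAnnulus R₀ R₁, inner ℝ (K x) (V x) =
        lam * (∫ x in cuspidalAnnulus R₀ R₁, w x * v x) +
        (∫ x in cuspidalAnnulus R₀ R₁, g x * v x) +
        ∫ x in cuspidalAnnulus R₀ R₁, inner ℝ (F x) (V x)) :
    ∃ M : ENNReal, M ≠ ⊤ ∧ ∀ δ : ℝ, 0 < δ →
      eLpNorm (fun x => ((‖x‖ ^ 2 + δ) ^ 2)⁻¹ • K x - (4 * ((‖x‖ ^ 2 + δ) ^ 3)⁻¹ * w x) • x) 2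
        (volume.restrict (cuspidalAnnulus R₀ R₁)) ≤ M := by
  have hΩ := (isOpen_cuspidalAnnulus (R₀ := R₀) (R₁ := R₁)).measurableSet
  have hS := (isOpen_cuspRegion (R₀ := R₀) (R₁ := R₁)).measurableSet
  set A := 18 + (lam + 1) * (2 * R₁) ^ 2 with hA
  have hA0 : 0 < A := by positivity
  -- the radius below which the lower order terms are absorbed
  obtain ⟨r, hr0, hrR, hrA⟩ : ∃ r : ℝ, 0 < r ∧ r ≤ R₀ ∧ A * r ^ 2 * (2 / R₀) ^ 2 ≤ 1 / 4 := by
    refine ⟨R₀ * min 1 (1 / (16 * A)), by positivity, mul_le_of_le_one_right hR₀.le (min_le_left _ _),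
      ?_⟩
    set μ := min 1 (1 / (16 * A))
    have h1 : 0 < μ := by positivity
    have h2 : μ ^ 2 ≤ μ := by
      have : μ ≤ 1 := min_le_left _ _
      nlinarith
    have h3 : A * μ ≤ 1 / 16 := by
      have : μ ≤ 1 / (16 * A) := min_le_right _ _
      rw [le_div_iff₀ (by positivity)] at this
      linarith
    have : A * (R₀ * μ) ^ 2 * (2 / R₀) ^ 2 = 4 * (A * μ ^ 2) := by field_simp; norm_num
    rw [this]
    nlinarith
  have lg := memLp_of_memLp_inv_pow_smul hR₀ hR (F := g) 4 hg
  have lF := memLp_of_memLp_inv_pow_smul hR₀ hR 4 hF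
  have lw := hw.1.memLp
  have lK := hw.1.memLp_grad
  set c := A * (r ^ 10)⁻¹ * (∫ x in cuspidalAnnulus R₀ R₁, w x ^ 2) +
    (∫ x in cuspidalAnnulus R₀ R₁, ((‖x‖ ^ 4)⁻¹ * g x) ^ 2) +
    3 * ∫ x in cuspidalAnnulus R₀ R₁, ‖(‖x‖ ^ 4)⁻¹ • F x‖ ^ 2 with hc
  -- With `I` the energy, the estimate reads `I ≤ I / 2 + I / 4 + c`: one half comes from Young's
  -- inequality for the flux, one quarter from the choice of `r` and the Poincaré inequality. Hence
  -- `I ≤ 4 c`.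
  refine ⟨ENNReal.ofReal (√(4 * c)), ENNReal.ofReal_ne_top, fun δ hδ => ?_⟩
  have hW := hw.mul_inv_pow hR₀ hR hδ 2
  have hv := hw.mul_inv_pow hR₀ hR hδ 4
  norm_num at hW hv
  set Y : Plane → Plane := fun x =>
    ((‖x‖ ^ 2 + δ) ^ 2)⁻¹ • K x - (4 * ((‖x‖ ^ 2 + δ) ^ 3)⁻¹ * w x) • x with hY
  set V : Plane → Plane := fun x =>
    ((‖x‖ ^ 2 + δ) ^ 4)⁻¹ • K x - (8 * ((‖x‖ ^ 2 + δ) ^ 5)⁻¹ * w x) • x with hV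
  set v : Plane → ℝ := fun x => ((‖x‖ ^ 2 + δ) ^ 4)⁻¹ * w x with hvdef
  set W : Plane → ℝ := fun x => ((‖x‖ ^ 2 + δ) ^ 2)⁻¹ * w x with hWdef
  have lY : MemLp Y 2 (volume.restrict (cuspidalAnnulus R₀ R₁)) := hW.1.memLp_grad
  have lV : MemLp V 2 (volume.restrict (cuspidalAnnulus R₀ R₁)) := hv.1.memLp_grad
  have lv : MemLp v 2 (volume.restrict (cuspidalAnnulus R₀ R₁)) := hv.1.memLp
  have iY := lY.norm.integrable_sq
  have hP := hW.poincare hR₀ hR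
  have lWS : MemLp (fun x => W x / x 0 ^ 2) 2 (volume.restrict (cuspRegion R₀ R₁)) := by
    refine ⟨?_, hP.trans_lt (ENNReal.mul_lt_top ENNReal.ofReal_lt_top lY.2)⟩
    have : AEStronglyMeasurable W (volume.restrict (cuspRegion R₀ R₁)) :=
      hW.1.memLp.1.mono_measure (Measure.restrict_mono (cuspRegion_subset hR₀ hR) le_rfl)
    exact this.div₀ ((measurable_coord 0).pow_const 2).aestronglyMeasurable
  have hP' : ∫ x in cuspRegion R₀ R₁, (W x / x 0 ^ 2) ^ 2 ≤
      (2 / R₀) ^ 2 * ∫ x in cuspidalAnnulus R₀ R₁, ‖Y x‖ ^ 2 := by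
    rw [eLpNorm_two_eq_ofReal_sqrt lWS, eLpNorm_two_eq_ofReal_sqrt lY,
      ← ENNReal.ofReal_mul (by positivity), ENNReal.ofReal_le_ofReal_iff (by positivity),
      ← Real.sqrt_sq (show 0 ≤ 2 / R₀ by positivity), ← Real.sqrt_mul (by positivity),
      Real.sqrt_le_sqrt_iff (by positivity)] at hP
    simpa only [Real.norm_eq_abs, sq_abs] using hP
  set q : Plane → ℝ := (cuspRegion R₀ R₁).indicator fun x => (W x / x 0 ^ 2) ^ 2 with hq
  have iq : IntegrableOn q (cuspidalAnnulus R₀ R₁) := by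
    have : Integrable q := (integrable_indicator_iff hS).2 lWS.integrable_sq
    exact this.integrableOn
  have eq : ∫ x in cuspidalAnnulus R₀ R₁, q x =
      ∫ x in cuspRegion R₀ R₁, (W x / x 0 ^ 2) ^ 2 := by
    rw [hq, setIntegral_indicator hS, Set.inter_eq_right.2 (cuspRegion_subset hR₀ hR)]
  have iKV := integrable_inner_of_memLp lK lV
  have iFV := integrable_inner_of_memLp lF lV
  have iwv : Integrable (fun x => w x * v x) (volume.restrict (cuspidalAnnulus R₀ R₁)) :=
    lw.integrable_mul lv
  have igv : Integrable (fun x => g x * v x) (volume.restrict (cuspidalAnnulus R₀ R₁)) :=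
    lg.integrable_mul lv
  have iw2 := lw.integrable_sq
  have ig2 := hg.integrable_sq
  have iF2 := hF.norm.integrable_sq
  have hmono := setIntegral_mono_on (μ := volume) (s := cuspidalAnnulus R₀ R₁)
    (f := fun x => (‖Y x‖ ^ 2 - inner ℝ (K x) (V x)) + lam * (w x * v x) + g x * v x +
      inner ℝ (F x) (V x))
    (g := fun x => 1 / 2 * ‖Y x‖ ^ 2 + A * r ^ 2 * q x + A * (r ^ 10)⁻¹ * w x ^ 2 +
      ((‖x‖ ^ 4)⁻¹ * g x) ^ 2 + 3 * ‖(‖x‖ ^ 4)⁻¹ • F x‖ ^ 2)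
    (((((iY.sub iKV).add (iwv.const_mul lam)).add igv).add iFV).congr
      (Eventually.of_forall fun _ => rfl))
    ((((((iY.const_mul (1 / 2)).add (iq.const_mul (A * r ^ 2))).add
      (iw2.const_mul (A * (r ^ 10)⁻¹))).add ig2).add (iF2.const_mul 3)).congr
      (Eventually.of_forall fun _ => rfl)) hΩ
    (fun x hx => by
      have hb := cuspidalAnnulus_bounds hR₀ hR hx
      refine energy_pointwise hb.1 hδ hb.2.1 hlam hr0 hA
        (Set.indicator_nonneg (fun x _ => sq_nonneg _) x) fun hxr => ?_
      have hxS := mem_cuspRegion_of_norm_lt hR₀ hR hx (hxr.trans_le hrR)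
      rw [hq, Set.indicator_of_mem hxS, div_pow, ← pow_mul]
      have hx0 := (cuspRegion_bounds hR₀ hR hxS).1
      have h1 : x 0 ^ (2 * 2) ≤ ‖x‖ ^ 4 := by
        have : x 0 ^ 2 ≤ ‖x‖ ^ 2 := by rw [norm_sq_eq]; nlinarith [sq_nonneg (x 1)]
        calc x 0 ^ (2 * 2) = (x 0 ^ 2) ^ 2 := by ring
          _ ≤ (‖x‖ ^ 2) ^ 2 := by gcongr
          _ = ‖x‖ ^ 4 := by ring
      have h2 : 0 < x 0 ^ (2 * 2) := by rw [pow_mul]; positivity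
      exact div_le_div_of_nonneg_left (sq_nonneg _) h2 h1)
  rw [integral_add, integral_add, integral_add, integral_sub iY iKV, integral_const_mul,
    integral_add, integral_add, integral_add, integral_add, integral_const_mul, integral_const_mul,
    integral_const_mul, integral_const_mul, heq v V hv, eq] at hmono
  rotate_left
  · exact iY.const_mul _
  · exact iq.const_mul _
  · exact (iY.const_mul _).add (iq.const_mul _)
  · exact iw2.const_mul _
  · exact ((iY.const_mul _).add (iq.const_mul _)).add (iw2.const_mul _)
  · exact ig2
  · exact (((iY.const_mul _).add (iq.const_mul _)).add (iw2.const_mul _)).add ig2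
  · exact iF2.const_mul _
  · exact iY.sub iKV
  · exact iwv.const_mul lam
  · exact (iY.sub iKV).add (iwv.const_mul lam)
  · exact igv
  · exact ((iY.sub iKV).add (iwv.const_mul lam)).add igv
  · exact iFV
  have hI : 0 ≤ ∫ x in cuspidalAnnulus R₀ R₁, ‖Y x‖ ^ 2 := integral_nonneg fun x => by positivity
  have hfin : A * r ^ 2 * ∫ x in cuspRegion R₀ R₁, (W x / x 0 ^ 2) ^ 2 ≤
      1 / 4 * ∫ x in cuspidalAnnulus R₀ R₁, ‖Y x‖ ^ 2 := by
    refine (mul_le_mul_of_nonneg_left hP' (by positivity)).trans ?_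
    rw [← mul_assoc]
    exact mul_le_mul_of_nonneg_right hrA hI
  rw [eLpNorm_two_eq_ofReal_sqrt lY]
  refine ENNReal.ofReal_le_ofReal (Real.sqrt_le_sqrt ?_)
  linarith

/-- A function of `H¹₀` that solves the equation with a right-hand side decaying like `‖x‖ ^ 4` in
the mean square sense still belongs to `H¹₀` after division by `‖x‖ ^ 4`. -/
theorem IsH10With.inv_pow_four_mul (hR₀ : 0 < R₀) (hR : R₀ < R₁) {lam : ℝ} (hlam : 0 ≤ lam)
    {w g : Plane → ℝ} {K F : Plane → Plane}
    (hw : IsH10With (cuspidalAnnulus R₀ R₁) (innerBoundary R₀) w K)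
    (hg : MemLp (fun x => (‖x‖ ^ 4)⁻¹ * g x) 2 (volume.restrict (cuspidalAnnulus R₀ R₁)))
    (hF : MemLp (fun x => (‖x‖ ^ 4)⁻¹ • F x) 2 (volume.restrict (cuspidalAnnulus R₀ R₁)))
    (heq : ∀ v V, IsH10With (cuspidalAnnulus R₀ R₁) (innerBoundary R₀) v V →
      ∫ x in cuspidalAnnulus R₀ R₁, inner ℝ (K x) (V x) =
        lam * (∫ x in cuspidalAnnulus R₀ R₁, w x * v x) +
        (∫ x in cuspidalAnnulus R₀ R₁, g x * v x) +
        ∫ x in cuspidalAnnulus R₀ R₁, inner ℝ (F x) (V x)) :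
    IsH10With (cuspidalAnnulus R₀ R₁) (innerBoundary R₀) (fun x => (‖x‖ ^ 4)⁻¹ * w x)
      (fun x => (‖x‖ ^ 4)⁻¹ • K x - (4 * (‖x‖ ^ 6)⁻¹ * w x) • x) := by
  have hΩ := (isOpen_cuspidalAnnulus (R₀ := R₀) (R₁ := R₁)).measurableSet
  have hS := (isOpen_cuspRegion (R₀ := R₀) (R₁ := R₁)).measurableSet
  obtain ⟨M, hM, hb⟩ := hw.energy_bound hR₀ hR hlam hg hF heq
  have lw := hw.1.memLp
  have lK := hw.1.memLp_grad
  have hsub : volume.restrict (cuspRegion R₀ R₁) ≤ volume.restrict (cuspidalAnnulus R₀ R₁) :=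
    Measure.restrict_mono (cuspRegion_subset hR₀ hR) le_rfl
  let d : ℕ → ℝ := fun n => 1 / (n + 1)
  have hd : ∀ n, 0 < d n := fun n => by positivity
  have hd0 : Tendsto d atTop (𝓝 0) := tendsto_one_div_add_atTop_nhds_zero_nat
  have hσ : ∀ x : Plane, Tendsto (fun n => ‖x‖ ^ 2 + d n) atTop (𝓝 (‖x‖ ^ 2)) := fun x => by
    simpa using hd0.const_add (‖x‖ ^ 2)
  have hσi : ∀ x : Plane, 0 < ‖x‖ → ∀ j : ℕ,
      Tendsto (fun n => ((‖x‖ ^ 2 + d n) ^ j)⁻¹) atTop (𝓝 ((‖x‖ ^ (2 * j))⁻¹)) := fun x hx j => by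
    rw [pow_mul]
    exact ((hσ x).pow j).inv₀ (by positivity)
  have hle : ∀ (x : Plane), 0 < ‖x‖ → ∀ (j n : ℕ),
      ((‖x‖ ^ 2 + d n) ^ j)⁻¹ ≤ (‖x‖ ^ (2 * j))⁻¹ := fun x hx j n => by
    rw [pow_mul]
    gcongr
    linarith [hd n]
  have hWn := fun n => hw.mul_inv_pow hR₀ hR (hd n) 2
  norm_num at hWn
  set Y : ℕ → Plane → Plane := fun n x =>
    ((‖x‖ ^ 2 + d n) ^ 2)⁻¹ • K x - (4 * ((‖x‖ ^ 2 + d n) ^ 3)⁻¹ * w x) • x with hY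
  set Yₗ : Plane → Plane := fun x => (‖x‖ ^ 4)⁻¹ • K x - (4 * (‖x‖ ^ 6)⁻¹ * w x) • x with hYi
  have mn : ∀ j : ℕ, Measurable fun x : Plane => (‖x‖ ^ j)⁻¹ := fun j =>
    (measurable_norm.pow_const j).inv
  have mY : AEStronglyMeasurable Yₗ (volume.restrict (cuspidalAnnulus R₀ R₁)) :=
    ((mn 4).aestronglyMeasurable.smul lK.1).sub
      ((((mn 6).const_mul 4).aestronglyMeasurable.mul lw.1).smul
        measurable_id.aestronglyMeasurable)
  have limY : ∀ x ∈ cuspidalAnnulus R₀ R₁, Tendsto (fun n => Y n x) atTop (𝓝 (Yₗ x)) := by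
    intro x hx
    have h0 := (cuspidalAnnulus_bounds hR₀ hR hx).1
    exact ((hσi x h0 2).smul_const _).sub ((((hσi x h0 3).const_mul 4).mul_const _).smul_const _)
  have lY : MemLp Yₗ 2 (volume.restrict (cuspidalAnnulus R₀ R₁)) := by
    refine ⟨mY, lt_of_le_of_lt (Lp.eLpNorm_lim_le_liminf_eLpNorm
      (fun n => (hWn n).1.memLp_grad.1) _
      ((ae_restrict_iff' hΩ).2 (Eventually.of_forall limY))) ?_⟩
    refine lt_of_le_of_lt (liminf_le_liminf (Eventually.of_forall fun n => hb _ (hd n))) ?_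
    simpa using hM.lt_top
  have lS : MemLp (fun x => (‖x‖ ^ 4)⁻¹ * w x / x 0 ^ 2) 2
      (volume.restrict (cuspRegion R₀ R₁)) := by
    have mx : Measurable fun x : Plane => x 0 ^ 2 := (measurable_coord 0).pow_const 2
    refine ⟨((mn 4).aestronglyMeasurable.mul (lw.1.mono_measure hsub)).div₀
      mx.aestronglyMeasurable, ?_⟩
    refine lt_of_le_of_lt (Lp.eLpNorm_lim_le_liminf_eLpNorm
      (f := fun n x => ((‖x‖ ^ 2 + d n) ^ 2)⁻¹ * w x / x 0 ^ 2) (fun n => ?_) _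
      ((ae_restrict_iff' hS).2 (Eventually.of_forall fun x hx => ?_))) ?_
    · exact ((hWn n).1.memLp.1.mono_measure hsub).div₀ mx.aestronglyMeasurable
    · have h0 := (cuspidalAnnulus_bounds hR₀ hR (cuspRegion_subset hR₀ hR hx)).1
      exact (((hσi x h0 2).mul_const _).div_const _)
    · refine lt_of_le_of_lt (liminf_le_liminf (Eventually.of_forall fun n =>
        ((hWn n).poincare hR₀ hR).trans (mul_le_mul_right (hb _ (hd n)) _))) ?_
      simpa using ENNReal.mul_lt_top ENNReal.ofReal_lt_top hM.lt_top
  -- Near the cusp the Poincaré inequality even controls `‖x‖⁻⁶ w`. The fifth power is what the term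
  -- `4 ‖x‖⁻⁶ w x` of the weighted gradient requires, so the two parts of that gradient are square
  -- integrable separately.
  have lw5 : MemLp (fun x => (‖x‖ ^ 5)⁻¹ * w x) 2 (volume.restrict (cuspidalAnnulus R₀ R₁)) := by
    set b : Plane → ℝ := (cuspRegion R₀ R₁).indicator fun x => (‖x‖ ^ 4)⁻¹ * w x / x 0 ^ 2
    have lb : MemLp b 2 (volume.restrict (cuspidalAnnulus R₀ R₁)) :=
      ((memLp_indicator_iff_restrict hS).2 lS).restrict _
    refine MemLp.of_le ((lb.norm.const_mul (2 * R₁)).add (lw.norm.const_mul (R₀ ^ 5)⁻¹))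
      ((mn 5).aestronglyMeasurable.mul lw.1)
      ((ae_restrict_iff' hΩ).2 (Eventually.of_forall fun x hx => ?_))
    obtain ⟨h0, h1, -, -⟩ := cuspidalAnnulus_bounds hR₀ hR hx
    have hR₁ := hR₀.trans hR
    simp only [Pi.add_apply]
    rw [Real.norm_of_nonneg (by positivity : 0 ≤ 2 * R₁ * ‖b x‖ + (R₀ ^ 5)⁻¹ * ‖w x‖), norm_mul,
      Real.norm_of_nonneg (by positivity)]
    rcases lt_or_ge ‖x‖ R₀ with h | h
    · have hxS := mem_cuspRegion_of_norm_lt hR₀ hR hx h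
      have hx0 := (cuspRegion_bounds hR₀ hR hxS).1
      have hx2 : 0 < x 0 ^ 2 := by positivity
      have h3 : x 0 ^ 2 ≤ 2 * R₁ * ‖x‖ := by
        have : x 0 ^ 2 ≤ ‖x‖ ^ 2 := by rw [norm_sq_eq]; nlinarith [sq_nonneg (x 1)]
        nlinarith
      have h4 : (‖x‖ ^ 5)⁻¹ * ‖w x‖ ≤ 2 * R₁ * ‖b x‖ := by
        simp only [b, Set.indicator_of_mem hxS]
        rw [norm_div, norm_mul, Real.norm_of_nonneg (by positivity : 0 ≤ (‖x‖ ^ 4)⁻¹),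
          Real.norm_of_nonneg hx2.le, mul_div_assoc', le_div_iff₀ hx2]
        calc (‖x‖ ^ 5)⁻¹ * ‖w x‖ * x 0 ^ 2 ≤ (‖x‖ ^ 5)⁻¹ * ‖w x‖ * (2 * R₁ * ‖x‖) := by gcongr
          _ = _ := by field_simp
      have : 0 ≤ (R₀ ^ 5)⁻¹ * ‖w x‖ := by positivity
      linarith
    · have h4 : (‖x‖ ^ 5)⁻¹ * ‖w x‖ ≤ (R₀ ^ 5)⁻¹ * ‖w x‖ := by gcongr
      have : 0 ≤ 2 * R₁ * ‖b x‖ := by positivity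
      linarith
  have lK4 : MemLp (fun x => (‖x‖ ^ 4)⁻¹ • K x) 2 (volume.restrict (cuspidalAnnulus R₀ R₁)) := by
    refine MemLp.of_le (lY.norm.add (lw5.norm.const_mul 4))
      ((mn 4).aestronglyMeasurable.smul lK.1)
      ((ae_restrict_iff' hΩ).2 (Eventually.of_forall fun x hx => ?_))
    obtain ⟨h0, -, -, -⟩ := cuspidalAnnulus_bounds hR₀ hR hx
    have e : (‖x‖ ^ 4)⁻¹ • K x = Yₗ x + (4 * (‖x‖ ^ 6)⁻¹ * w x) • x := by simp [hYi]
    simp only [Pi.add_apply]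
    rw [Real.norm_of_nonneg (by positivity), e]
    refine (norm_add_le _ _).trans (add_le_add le_rfl (le_of_eq ?_))
    rw [norm_smul, norm_mul, norm_mul, norm_mul, Real.norm_of_nonneg (by positivity : 0 ≤ (‖x‖ ^ 6)⁻¹),
      Real.norm_of_nonneg (by positivity : 0 ≤ (‖x‖ ^ 5)⁻¹), Real.norm_of_nonneg (by norm_num : (0:ℝ) ≤ 4)]
    field_simp
  have lw4 : MemLp (fun x => (‖x‖ ^ 4)⁻¹ * w x) 2 (volume.restrict (cuspidalAnnulus R₀ R₁)) := by
    refine MemLp.of_le (lw5.norm.const_mul (2 * R₁)) ((mn 4).aestronglyMeasurable.mul lw.1)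
      ((ae_restrict_iff' hΩ).2 (Eventually.of_forall fun x hx => ?_))
    obtain ⟨h0, h1, -, -⟩ := cuspidalAnnulus_bounds hR₀ hR hx
    have hR₁ := hR₀.trans hR
    rw [Real.norm_of_nonneg (by positivity : 0 ≤ 2 * R₁ * ‖(‖x‖ ^ 5)⁻¹ * w x‖), norm_mul, norm_mul,
      Real.norm_of_nonneg (by positivity : 0 ≤ (‖x‖ ^ 4)⁻¹),
      Real.norm_of_nonneg (by positivity : 0 ≤ (‖x‖ ^ 5)⁻¹)]
    calc (‖x‖ ^ 4)⁻¹ * ‖w x‖ = ‖x‖ * ((‖x‖ ^ 5)⁻¹ * ‖w x‖) := by field_simp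
      _ ≤ _ := by gcongr
  -- Fatou's lemma gave only integrability of the limits. Norm convergence follows by domination,
  -- because every regularised weight is at most its limit as `δ → 0`.
  refine isH10With_of_tendsto isOpen_cuspidalAnnulus isClosed_innerBoundary lw4.1 mY hWn ?_ ?_
  · refine tendsto_eLpNorm_two_of_dominated (b := fun x => 2 * ‖(‖x‖ ^ 4)⁻¹ * w x‖)
      (fun n => lw4.1.sub (hWn n).1.memLp.1) (lw4.norm.const_mul 2) (fun n => ?_) ?_
    · refine (ae_restrict_iff' hΩ).2 (Eventually.of_forall fun x hx => ?_)
      obtain ⟨h0, -, -, -⟩ := cuspidalAnnulus_bounds hR₀ hR hx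
      have h2 := hle x h0 2 n
      have h3 : 0 ≤ ((‖x‖ ^ 2 + d n) ^ 2)⁻¹ := by have := hd n; positivity
      refine (norm_sub_le _ _).trans ?_
      rw [two_mul, norm_mul, norm_mul, Real.norm_of_nonneg h3,
        Real.norm_of_nonneg (by positivity : 0 ≤ (‖x‖ ^ 4)⁻¹)]
      gcongr
    · refine (ae_restrict_iff' hΩ).2 (Eventually.of_forall fun x hx => ?_)
      obtain ⟨h0, -, -, -⟩ := cuspidalAnnulus_bounds hR₀ hR hx
      have := ((hσi x h0 2).mul_const (w x)).const_sub ((‖x‖ ^ 4)⁻¹ * w x)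
      rwa [show 2 * 2 = 4 by norm_num, sub_self] at this
  · refine tendsto_eLpNorm_two_of_dominated
      (b := fun x => ‖Yₗ x‖ + (‖(‖x‖ ^ 4)⁻¹ • K x‖ + 4 * ‖(‖x‖ ^ 5)⁻¹ * w x‖))
      (fun n => mY.sub (hWn n).1.memLp_grad.1)
      (lY.norm.add (lK4.norm.add (lw5.norm.const_mul 4))) (fun n => ?_) ?_
    · refine (ae_restrict_iff' hΩ).2 (Eventually.of_forall fun x hx => ?_)
      obtain ⟨h0, -, -, -⟩ := cuspidalAnnulus_bounds hR₀ hR hx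
      have h2 := hle x h0 2 n
      have h2' := hle x h0 3 n
      have h3 : 0 ≤ ((‖x‖ ^ 2 + d n) ^ 2)⁻¹ := by have := hd n; positivity
      have h3' : 0 ≤ ((‖x‖ ^ 2 + d n) ^ 3)⁻¹ := by have := hd n; positivity
      refine (norm_sub_le _ _).trans (add_le_add le_rfl ((norm_sub_le _ _).trans
        (add_le_add ?_ ?_)))
      · rw [norm_smul, norm_smul, Real.norm_of_nonneg h3,
          Real.norm_of_nonneg (by positivity : 0 ≤ (‖x‖ ^ 4)⁻¹)]
        gcongr
      · rw [norm_smul, norm_mul, norm_mul, norm_mul, Real.norm_of_nonneg h3',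
          Real.norm_of_nonneg (by positivity : 0 ≤ (‖x‖ ^ 5)⁻¹),
          Real.norm_of_nonneg (by norm_num : (0:ℝ) ≤ 4)]
        calc 4 * ((‖x‖ ^ 2 + d n) ^ 3)⁻¹ * ‖w x‖ * ‖x‖ ≤ 4 * (‖x‖ ^ (2 * 3))⁻¹ * ‖w x‖ * ‖x‖ := by
              gcongr
          _ = _ := by norm_num; field_simp
    · refine (ae_restrict_iff' hΩ).2 (Eventually.of_forall fun x hx => ?_)
      simpa using (limY x hx).const_sub (Yₗ x)

end WeightedEstimate

/-! ### The corrector near the cusp -/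

section Model

variable {R₀ R₁ : ℝ}

/-- The thickness `circleHeight R₀ t - circleHeight R₁ t` divided by `t ^ 2`. -/
def relThickness (R₀ R₁ t : ℝ) : ℝ := (R₀ + √(R₀ ^ 2 - t ^ 2))⁻¹ - (R₁ + √(R₁ ^ 2 - t ^ 2))⁻¹

/-- The square of the ratio of the principal part of the thickness and the thickness. -/
def thicknessFactor (R₀ R₁ t : ℝ) : ℝ := ((1 / (2 * R₀) - 1 / (2 * R₁)) / relThickness R₀ R₁ t) ^ 2

/-- The continuous extension by zero of `cuspCutoff R₀ χ x * stretchedCorrector R₀ R₁ 2 1 x`. -/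
def modelCorrector (R₀ R₁ : ℝ) (χ : ℝ → ℝ) (x : Plane) : ℝ :=
  χ (x 0) * thicknessFactor R₀ R₁ (x 0) *
    max 0 ((circleHeight R₀ (x 0) - circleHeight R₁ (x 0)) ^ 2 - (x 1 - circleHeight R₁ (x 0)) ^ 2)

theorem relThickness_pos (hR₀ : 0 < R₀) (hR : R₀ < R₁) (t : ℝ) : 0 < relThickness R₀ R₁ t := by
  have h0 := Real.sqrt_nonneg (R₀ ^ 2 - t ^ 2)
  have h1 : √(R₀ ^ 2 - t ^ 2) ≤ √(R₁ ^ 2 - t ^ 2) := Real.sqrt_le_sqrt (by nlinarith)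
  rw [relThickness, sub_pos]
  exact inv_strictAnti₀ (by positivity) (by linarith)

theorem thicknessFactor_pos (hR₀ : 0 < R₀) (hR : R₀ < R₁) (t : ℝ) :
    0 < thicknessFactor R₀ R₁ t := by
  have h := relThickness_pos hR₀ hR t
  have : 0 < 1 / (2 * R₀) - 1 / (2 * R₁) := by
    rw [sub_pos]; exact one_div_lt_one_div_of_lt (by positivity) (by linarith)
  unfold thicknessFactor
  positivity

theorem continuous_relThickness (hR₀ : 0 < R₀) (hR : R₀ < R₁) :
    Continuous (relThickness R₀ R₁) := by
  have hR₁ := hR₀.trans hR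
  have key : ∀ R : ℝ, 0 < R → Continuous fun t : ℝ => (R + √(R ^ 2 - t ^ 2))⁻¹ := fun R hR => by
    refine Continuous.inv₀ (by fun_prop) fun t => ?_
    have := Real.sqrt_nonneg (R ^ 2 - t ^ 2)
    positivity
  exact (key R₀ hR₀).sub (key R₁ hR₁)

theorem continuous_thicknessFactor (hR₀ : 0 < R₀) (hR : R₀ < R₁) :
    Continuous (thicknessFactor R₀ R₁) :=
  (continuous_const.div (continuous_relThickness hR₀ hR)
    fun t => (relThickness_pos hR₀ hR t).ne').pow 2

theorem circleHeight_sub_eq (hR₀ : 0 < R₀) (hR : R₀ < R₁) {t : ℝ} (ht : |t| ≤ R₀) :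
    circleHeight R₀ t - circleHeight R₁ t = t ^ 2 * relThickness R₀ R₁ t := by
  rw [circleHeight_eq_div hR₀ ht, circleHeight_eq_div (hR₀.trans hR) (ht.trans hR.le), relThickness]
  ring

theorem exists_le_relThickness (hR₀ : 0 < R₀) (hR : R₀ < R₁) :
    ∃ η : ℝ, 0 < η ∧ ∀ t, |t| ≤ R₀ → η ≤ relThickness R₀ R₁ t := by
  obtain ⟨t₀, -, h⟩ := isCompact_Icc.exists_isMinOn (s := Set.Icc (-R₀) R₀)
    ⟨0, by constructor <;> linarith⟩ (continuous_relThickness hR₀ hR).continuousOn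
  exact ⟨_, relThickness_pos hR₀ hR t₀, fun t ht => h (abs_le.1 ht)⟩

theorem hasDerivAt_sqrt_sub {R t : ℝ} (ht : |t| < R) :
    HasDerivAt (fun t => √(R ^ 2 - t ^ 2)) (-(t / √(R ^ 2 - t ^ 2))) t := by
  have h : 0 < R ^ 2 - t ^ 2 := by nlinarith [sq_abs t, abs_nonneg t]
  refine (((hasDerivAt_pow 2 t).const_sub (R ^ 2)).sqrt h.ne').congr_deriv ?_
  have := Real.sqrt_pos.2 h
  field_simp
  norm_num

theorem hasDerivAt_circleHeight {R t : ℝ} (ht : |t| < R) :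
    HasDerivAt (circleHeight R) (t / √(R ^ 2 - t ^ 2)) t := by
  simpa [circleHeight] using! (hasDerivAt_sqrt_sub ht).const_sub R

theorem hasDerivAt_relThickness (hR₀ : 0 < R₀) (hR : R₀ < R₁) {t : ℝ} (ht : |t| < R₀) :
    HasDerivAt (relThickness R₀ R₁)
      (t / (√(R₀ ^ 2 - t ^ 2) * (R₀ + √(R₀ ^ 2 - t ^ 2)) ^ 2) -
        t / (√(R₁ ^ 2 - t ^ 2) * (R₁ + √(R₁ ^ 2 - t ^ 2)) ^ 2)) t := by
  have key : ∀ R : ℝ, 0 < R → |t| < R → HasDerivAt (fun t : ℝ => (R + √(R ^ 2 - t ^ 2))⁻¹)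
      (t / (√(R ^ 2 - t ^ 2) * (R + √(R ^ 2 - t ^ 2)) ^ 2)) t := fun R hR0 hR => by
    have h : 0 < R ^ 2 - t ^ 2 := by nlinarith [sq_abs t, abs_nonneg t]
    have hs := Real.sqrt_pos.2 h
    refine (((hasDerivAt_sqrt_sub hR).const_add R).fun_inv (by positivity)).congr_deriv ?_
    field_simp
  exact (key R₀ hR₀ ht).sub (key R₁ (hR₀.trans hR) (ht.trans hR))

theorem sqrt_sub_bounds (hR₀ : 0 < R₀) (hR : R₀ < R₁) {t : ℝ} (ht : |t| < R₀) :
    0 < √(R₀ ^ 2 - t ^ 2) ∧ √(R₀ ^ 2 - t ^ 2) ≤ √(R₁ ^ 2 - t ^ 2) ∧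
      R₀ - |t| ≤ √(R₀ ^ 2 - t ^ 2) := by
  have h : 0 < R₀ ^ 2 - t ^ 2 := by nlinarith [sq_abs t, abs_nonneg t]
  refine ⟨Real.sqrt_pos.2 h, Real.sqrt_le_sqrt (by nlinarith), Real.le_sqrt_of_sq_le ?_⟩
  nlinarith [sq_abs t, abs_nonneg t]

/-- Both `(R + √(R² - t²))⁻¹` equal `1 / (2R)` up to `O(t²)`, so the factor is `1 + O(t²)`. Its
derivative can be unbounded as `|t| → R₀`, where the inner circle has a vertical tangent; only the
product with `√(R₀² - t²)` is bounded, and the cut-off will supply that product. -/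
theorem exists_deriv_thicknessFactor (hR₀ : 0 < R₀) (hR : R₀ < R₁) :
    ∃ C : ℝ, 0 ≤ C ∧ ∀ t, |t| < R₀ → thicknessFactor R₀ R₁ t ≤ C ∧
      |1 - thicknessFactor R₀ R₁ t| ≤ C * t ^ 2 ∧
      ∃ p : ℝ, HasDerivAt (thicknessFactor R₀ R₁) p t ∧ |p| * √(R₀ ^ 2 - t ^ 2) ≤ C := by
  have hR₁ := hR₀.trans hR
  obtain ⟨η, hη, hηt⟩ := exists_le_relThickness hR₀ hR
  set κ := 1 / (2 * R₀) - 1 / (2 * R₁) with hκ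
  have hκ0 : 0 < κ := by
    rw [hκ, sub_pos]; exact one_div_lt_one_div_of_lt (by positivity) (by linarith)
  have hκ1 : κ ≤ 1 / R₀ := by
    have h1 : 0 < 1 / (2 * R₁) := by positivity
    have h2 : 1 / (2 * R₀) ≤ 1 / R₀ := one_div_le_one_div_of_le hR₀ (by linarith)
    linarith
  set C₁ := (κ / η) ^ 2
  set C₂ := (R₀ ^ 3)⁻¹ * (2 / R₀) / η ^ 2
  set C₃ := 2 * κ ^ 2 / η ^ 3 * (2 / R₀)
  have hC₁ : 0 ≤ C₁ := by positivity
  have hC₂ : 0 ≤ C₂ := by positivity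
  have hC₃ : 0 ≤ C₃ := by positivity
  refine ⟨C₁ + C₂ + C₃, by positivity, fun t ht => ?_⟩
  have hh := relThickness_pos hR₀ hR t
  have hh1 := hηt t ht.le
  obtain ⟨hs0, hs1, -⟩ := sqrt_sub_bounds hR₀ hR ht
  have hs1' := hs0.trans_le hs1
  set h := relThickness R₀ R₁ t with hh'
  set s₀ := √(R₀ ^ 2 - t ^ 2) with hs₀
  set s₁ := √(R₁ ^ 2 - t ^ 2) with hs₁
  refine ⟨?_, ?_, ?_⟩
  · have : thicknessFactor R₀ R₁ t ≤ C₁ := by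
      change (κ / h) ^ 2 ≤ (κ / η) ^ 2
      gcongr
    linarith
  · have e : 1 - thicknessFactor R₀ R₁ t = (h - κ) * (h + κ) / h ^ 2 := by
      change 1 - (κ / h) ^ 2 = _
      field_simp
      ring
    have key : ∀ R : ℝ, R₀ ≤ R → 0 ≤ (R + √(R ^ 2 - t ^ 2))⁻¹ - 1 / (2 * R) ∧
        (R + √(R ^ 2 - t ^ 2))⁻¹ - 1 / (2 * R) ≤ t ^ 2 * (R₀ ^ 3)⁻¹ := by
      intro R hRR
      have hRp := hR₀.trans_le hRR
      have hs := Real.sqrt_nonneg (R ^ 2 - t ^ 2)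
      have e2 : (R + √(R ^ 2 - t ^ 2))⁻¹ - 1 / (2 * R) =
          circleHeight R t / (2 * R * (R + √(R ^ 2 - t ^ 2))) := by
        unfold circleHeight; field_simp; ring
      have hH := circleHeight_le hRp (ht.le.trans hRR)
      have hH0 := circleHeight_nonneg hRp.le t
      rw [e2]
      refine ⟨by positivity, ?_⟩
      calc circleHeight R t / (2 * R * (R + √(R ^ 2 - t ^ 2))) ≤ (t ^ 2 / R₀) / (1 * R₀ * R₀) := by
            gcongr
            · exact hH.trans (by gcongr)
            · norm_num
            · linarith
        _ = _ := by field_simp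
    have k0 := key R₀ le_rfl
    have k1 := key R₁ hR.le
    have hdiff : |h - κ| ≤ t ^ 2 * (R₀ ^ 3)⁻¹ := by
      have : h - κ = ((R₀ + s₀)⁻¹ - 1 / (2 * R₀)) - ((R₁ + s₁)⁻¹ - 1 / (2 * R₁)) := by
        rw [hh', hκ, relThickness]; ring
      rw [this, abs_le]
      constructor <;> linarith [k0.1, k0.2, k1.1, k1.2]
    have hle : h ≤ 1 / R₀ := by
      have h1 : 0 < (R₁ + s₁)⁻¹ := by positivity
      have h2 : (R₀ + s₀)⁻¹ ≤ 1 / R₀ := by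
        rw [one_div]; gcongr; linarith
      rw [hh', relThickness]; linarith
    have : |1 - thicknessFactor R₀ R₁ t| ≤ C₂ * t ^ 2 := by
      rw [e, abs_div, abs_mul, abs_of_pos (show 0 < h ^ 2 by positivity),
        abs_of_pos (show 0 < h + κ by positivity)]
      calc |h - κ| * (h + κ) / h ^ 2 ≤ (t ^ 2 * (R₀ ^ 3)⁻¹) * (2 / R₀) / η ^ 2 := by
            gcongr
            have : 2 / R₀ = 1 / R₀ + 1 / R₀ := by ring
            linarith
        _ = _ := by simp only [C₂]; ring
    have h2 : 0 ≤ t ^ 2 := sq_nonneg t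
    nlinarith
  · refine ⟨_, (((hasDerivAt_relThickness hR₀ hR ht).fun_inv hh.ne').const_mul κ).pow 2, ?_⟩
    set h' := t / (s₀ * (R₀ + s₀) ^ 2) - t / (s₁ * (R₁ + s₁) ^ 2) with hh'd
    have hb : |h'| * s₀ ≤ 2 / R₀ := by
      have b0 : |t / (s₀ * (R₀ + s₀) ^ 2)| ≤ R₀ / (s₀ * R₀ ^ 2) := by
        rw [abs_div, abs_of_pos (by positivity : 0 < s₀ * (R₀ + s₀) ^ 2)]
        gcongr
        linarith
      have b1 : |t / (s₁ * (R₁ + s₁) ^ 2)| ≤ R₀ / (s₀ * R₀ ^ 2) := by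
        rw [abs_div, abs_of_pos (by positivity : 0 < s₁ * (R₁ + s₁) ^ 2)]
        gcongr
        linarith
      have b2 : |h'| ≤ R₀ / (s₀ * R₀ ^ 2) + R₀ / (s₀ * R₀ ^ 2) :=
        (abs_sub _ _).trans (add_le_add b0 b1)
      calc |h'| * s₀ ≤ (R₀ / (s₀ * R₀ ^ 2) + R₀ / (s₀ * R₀ ^ 2)) * s₀ := by gcongr
        _ = 2 / R₀ := by field_simp; norm_num
    rw [← hh']
    have e : |((2 : ℕ) : ℝ) * (κ * h⁻¹) ^ (2 - 1) * (κ * (-h' / h ^ 2))| * s₀ =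
        2 * κ ^ 2 / h ^ 3 * (|h'| * s₀) := by
      have : ((2 : ℕ) : ℝ) * (κ * h⁻¹) ^ (2 - 1) * (κ * (-h' / h ^ 2)) = -(2 * κ ^ 2 / h ^ 3 * h') := by
        norm_num
        field_simp
      rw [this, abs_neg, abs_mul, abs_of_pos (by positivity)]
      ring
    rw [e]
    have : 2 * κ ^ 2 / h ^ 3 * (|h'| * s₀) ≤ C₃ := by
      simp only [C₃]
      gcongr
    linarith

/-- By the mean value inequality `χ` vanishes at least linearly at `±R₀`. Together with `R₀ - |t| ≤
√(R₀² - t²)` this compensates the infinite slope of the inner circle there. -/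
theorem IsCutoff.exists_bounds {χ : ℝ → ℝ} (hR₀ : 0 < R₀) (hχ : IsCutoff R₀ χ) :
    ∃ C : ℝ, 0 ≤ C ∧ ∀ t, |t| ≤ R₀ → |deriv χ t| ≤ C ∧ χ t ≤ C * (R₀ - |t|) := by
  have hχ1 : ContDiff ℝ 1 χ := hχ.smooth.of_le (by simp)
  obtain ⟨C, hC⟩ := isCompact_Icc.exists_bound_of_continuousOn (s := Set.Icc (-R₀) R₀)
    (hχ1.continuous_deriv le_rfl).continuousOn
  have hC0 : 0 ≤ C := (norm_nonneg _).trans (hC 0 ⟨by linarith, hR₀.le⟩)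
  refine ⟨C, hC0, fun t ht => ⟨hC t (abs_le.1 ht), ?_⟩⟩
  have key : ∀ a ∈ Set.Icc (-R₀) R₀, R₀ ≤ |a| → χ t ≤ C * |t - a| := fun a ha haR => by
    have := (convex_Icc (-R₀) R₀).norm_image_sub_le_of_norm_deriv_le
      (fun y _ => hχ1.differentiable (by simp) y) hC ha (abs_le.1 ht)
    rw [hχ.eq_zero a haR, sub_zero] at this
    exact (le_abs_self _).trans this
  rcases le_total 0 t with h | h
  · have := key R₀ ⟨by linarith, le_rfl⟩ (le_abs_self _)
    rw [abs_of_nonneg h] at ht ⊢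
    rwa [abs_of_nonpos (by linarith), neg_sub] at this
  · have := key (-R₀) ⟨le_rfl, by linarith⟩ (by rw [abs_neg]; exact le_abs_self _)
    rw [abs_of_nonpos h] at ht ⊢
    rw [abs_of_nonneg (by linarith)] at this
    convert this using 2
    ring

end Model

/-! ### Order of vanishing of the model corrector and its membership in `H¹₀` -/

section ModelCorrector

variable {R₀ R₁ : ℝ} {χ : ℝ → ℝ}

theorem modelCorrector_nonneg (hχ : IsCutoff R₀ χ) (x : Plane) : 0 ≤ modelCorrector R₀ R₁ χ x :=
  mul_nonneg (mul_nonneg (hχ.nonneg _) (sq_nonneg _)) (le_max_left _ _)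

theorem continuous_modelCorrector (hR₀ : 0 < R₀) (hR : R₀ < R₁) (hχ : IsCutoff R₀ χ) :
    Continuous (modelCorrector R₀ R₁ χ) := by
  have c0 : Continuous fun x : Plane => x 0 := by fun_prop
  have c1 : Continuous fun x : Plane => x 1 := by fun_prop
  have cH : ∀ R, Continuous fun x : Plane => circleHeight R (x 0) := fun R =>
    (continuous_circleHeight R).comp c0
  exact ((hχ.smooth.continuous.comp c0).mul ((continuous_thicknessFactor hR₀ hR).comp c0)).mul
    (continuous_const.max ((((cH R₀).sub (cH R₁)).pow 2).sub ((c1.sub (cH R₁)).pow 2)))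

theorem abs_lt_of_cutoff_ne_zero (hχ : IsCutoff R₀ χ) {t : ℝ} (h : χ t ≠ 0) : |t| < R₀ :=
  not_le.1 fun hle => h (hχ.eq_zero t hle)

theorem of_modelCorrector_ne_zero (hχ : IsCutoff R₀ χ) {x : Plane}
    (h : modelCorrector R₀ R₁ χ x ≠ 0) : |x 0| < R₀ ∧
      (x 1 - circleHeight R₁ (x 0)) ^ 2 < (circleHeight R₀ (x 0) - circleHeight R₁ (x 0)) ^ 2 := by
  refine ⟨abs_lt_of_cutoff_ne_zero hχ fun h0 => h (by simp [modelCorrector, h0]), ?_⟩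
  by_contra hle
  exact h (by rw [modelCorrector, max_eq_left (by linarith), mul_zero])

theorem mem_cuspRegion_of_modelCorrector_ne_zero (hR₀ : 0 < R₀) (hR : R₀ < R₁)
    (hχ : IsCutoff R₀ χ) {x : Plane} (hx : x ∈ cuspidalAnnulus R₀ R₁)
    (h : modelCorrector R₀ R₁ χ x ≠ 0) : x ∈ cuspRegion R₀ R₁ := by
  obtain ⟨h0, h1⟩ := of_modelCorrector_ne_zero hχ h
  have h2 := circleHeight_anti hR₀ hR.le h0.le
  have h3 := abs_lt_of_sq_lt_sq h1 (by linarith)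
  have h4 := circleHeight_le_radius R₀ (x 0)
  exact mem_cuspRegion hR₀ hR hx h0 (by linarith [(abs_lt.1 h3).2])

theorem hasCompactSupport_modelCorrector (hR₀ : 0 < R₀) (hR : R₀ < R₁) (hχ : IsCutoff R₀ χ) :
    HasCompactSupport (modelCorrector R₀ R₁ χ) := by
  refine HasCompactSupport.intro (isCompact_closedBall (0 : Plane) (2 * R₀)) fun x hx => ?_
  by_contra h
  obtain ⟨h0, h1⟩ := of_modelCorrector_ne_zero hχ h
  have h2 := circleHeight_anti hR₀ hR.le h0.le
  have h3 := abs_lt.1 (abs_lt_of_sq_lt_sq h1 (by linarith))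
  have h4 := circleHeight_le_radius R₀ (x 0)
  have h5 := circleHeight_nonneg (hR₀.trans hR).le (x 0)
  refine hx (mem_closedBall_zero_iff.2 ((norm_le_abs_add_abs x).trans ?_))
  have : |x 1| ≤ R₀ := abs_le.2 ⟨by linarith, by linarith⟩
  linarith

theorem modelCorrector_eq_zero_of_mem (hR₀ : 0 < R₀) (hR : R₀ < R₁) (hχ : IsCutoff R₀ χ) {x : Plane}
    (hx : x ∈ innerBoundary R₀) : modelCorrector R₀ R₁ χ x = 0 := by
  by_contra h
  obtain ⟨h0, h1⟩ := of_modelCorrector_ne_zero hχ h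
  have h2 := circleHeight_anti hR₀ hR.le h0.le
  have h3 := abs_lt.1 (abs_lt_of_sq_lt_sq h1 (by linarith))
  have h4 : x 1 < circleHeight R₀ (x 0) := by linarith
  have h5 := circleHeight_le_radius R₀ (x 0)
  have h6 := (lt_circleHeight_iff (by linarith) h0.le).1 h4
  have h7 := (mem_innerBoundary hR₀).1 hx
  nlinarith

theorem modelCorrector_eventuallyEq {x : Plane}
    (h : (x 1 - circleHeight R₁ (x 0)) ^ 2 <
      (circleHeight R₀ (x 0) - circleHeight R₁ (x 0)) ^ 2) :
    modelCorrector R₀ R₁ χ =ᶠ[𝓝 x] fun y => (χ (y 0) * thicknessFactor R₀ R₁ (y 0)) *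
      ((circleHeight R₀ (y 0) - circleHeight R₁ (y 0)) ^ 2 -
        (y 1 - circleHeight R₁ (y 0)) ^ 2) := by
  have c0 : Continuous fun x : Plane => x 0 := by fun_prop
  have c1 : Continuous fun x : Plane => x 1 := by fun_prop
  have cH : ∀ R, Continuous fun x : Plane => circleHeight R (x 0) := fun R =>
    (continuous_circleHeight R).comp c0
  have ho : IsOpen {y : Plane | (y 1 - circleHeight R₁ (y 0)) ^ 2 <
      (circleHeight R₀ (y 0) - circleHeight R₁ (y 0)) ^ 2} :=
    isOpen_lt ((c1.sub (cH R₁)).pow 2) (((cH R₀).sub (cH R₁)).pow 2)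
  filter_upwards [ho.mem_nhds h] with y hy
  have hy' : (y 1 - circleHeight R₁ (y 0)) ^ 2 <
      (circleHeight R₀ (y 0) - circleHeight R₁ (y 0)) ^ 2 := hy
  rw [modelCorrector, max_eq_right (by linarith)]

theorem contDiffAt_modelCorrector (hR₀ : 0 < R₀) (hR : R₀ < R₁) (hχ : IsCutoff R₀ χ) {x : Plane}
    (h : modelCorrector R₀ R₁ χ x ≠ 0) : ContDiffAt ℝ 1 (modelCorrector R₀ R₁ χ) x := by
  obtain ⟨h0, h1⟩ := of_modelCorrector_ne_zero hχ h
  refine ContDiffAt.congr_of_eventuallyEq ?_ (modelCorrector_eventuallyEq h1)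
  have d0 : ContDiffAt ℝ 1 (fun y : Plane => y 0) x := by fun_prop
  have d1 : ContDiffAt ℝ 1 (fun y : Plane => y 1) x := by fun_prop
  have ds : ∀ R, |x 0| < R → ContDiffAt ℝ 1 (fun y : Plane => √(R ^ 2 - y 0 ^ 2)) x := fun R hR =>
    (contDiffAt_const.sub (d0.pow 2)).sqrt (by
      have : 0 < R ^ 2 - x 0 ^ 2 := by nlinarith [sq_abs (x 0), abs_nonneg (x 0)]
      exact this.ne')
  have hR₁ := hR₀.trans hR
  have dH : ∀ R, |x 0| < R → ContDiffAt ℝ 1 (fun y : Plane => circleHeight R (y 0)) x :=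
    fun R hR => contDiffAt_const.sub (ds R hR)
  have di : ∀ R, 0 < R → |x 0| < R →
      ContDiffAt ℝ 1 (fun y : Plane => (R + √(R ^ 2 - y 0 ^ 2))⁻¹) x := fun R hRp hR =>
    (contDiffAt_const.add (ds R hR)).inv (by
      have := Real.sqrt_nonneg (R ^ 2 - x 0 ^ 2)
      positivity)
  have dP : ContDiffAt ℝ 1 (fun y : Plane => thicknessFactor R₀ R₁ (y 0)) x :=
    (contDiffAt_const.div ((di R₀ hR₀ h0).sub (di R₁ hR₁ (h0.trans hR)))
      (relThickness_pos hR₀ hR (x 0)).ne').pow 2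
  have dχ : ContDiffAt ℝ 1 (fun y : Plane => χ (y 0)) x :=
    (hχ.smooth.of_le (by simp) : ContDiff ℝ 1 χ).contDiffAt.comp x d0
  exact (dχ.mul dP).mul ((((dH R₀ h0).sub (dH R₁ (h0.trans hR))).pow 2).sub
    ((d1.sub (dH R₁ (h0.trans hR))).pow 2))

theorem hasGradientAt_comp_coord_zero {a : ℝ → ℝ} {a' : ℝ} {x : Plane} (h : HasDerivAt a a' (x 0)) :
    HasGradientAt (fun y : Plane => a (y 0)) (EuclideanSpace.single 0 a') x := by
  have := HasGradientAt.scomp (f := fun y : Plane => y 0) h (hasGradientAt_coord 0 x)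
  convert this using 1
  ext i
  fin_cases i <;> simp

/-- The gradient of the model corrector in the cusp, with its order of vanishing. -/
theorem exists_gradient_modelCorrector (hR₀ : 0 < R₀) (hR : R₀ < R₁) (hχ : IsCutoff R₀ χ) :
    ∃ C : ℝ, 0 ≤ C ∧ ∀ x ∈ cuspRegion R₀ R₁, modelCorrector R₀ R₁ χ x ≤ C * x 0 ^ 4 ∧
      |gradient (modelCorrector R₀ R₁ χ) x 0| ≤ C * |x 0| ^ 3 ∧
      gradient (modelCorrector R₀ R₁ χ) x 1 =
        -(2 * χ (x 0) * thicknessFactor R₀ R₁ (x 0) * (x 1 - circleHeight R₁ (x 0))) := by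
  obtain ⟨C₁, hC₁, hP⟩ := exists_deriv_thicknessFactor hR₀ hR
  obtain ⟨C₂, hC₂, hχb⟩ := hχ.exists_bounds hR₀
  set D := C₁ / R₀ ^ 2 + (C₂ * C₁ * R₀ / R₀ ^ 2 + C₂ * C₁ * R₀ / R₀ ^ 2 + C₂ * C₁ * (6 / R₀)) with hD
  refine ⟨D, by positivity, fun x hx => ?_⟩
  obtain ⟨b0, -, -, b1, b2, -⟩ := cuspRegion_bounds hR₀ hR hx
  obtain ⟨h0, h1, h2⟩ := hx
  obtain ⟨hPC, -, p, hp, hpb⟩ := hP _ h0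
  obtain ⟨hχ', hχs⟩ := hχb _ h0.le
  obtain ⟨hs0, hs1, hs2⟩ := sqrt_sub_bounds hR₀ hR h0
  have hP0 := thicknessFactor_pos hR₀ hR (x 0)
  have hχ0 := hχ.nonneg (x 0)
  have hχ1 := hχ.le_one (x 0)
  have hH1 := circleHeight_nonneg (hR₀.trans hR).le (x 0)
  have hH0 := circleHeight_le hR₀ h0.le
  have dH0 := hasDerivAt_circleHeight h0
  have dH1 := hasDerivAt_circleHeight (h0.trans hR)
  have dχ : HasDerivAt χ (deriv χ (x 0)) (x 0) := (hχ.smooth.differentiable (by simp) _).hasDerivAt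
  set t := x 0 with ht
  set y := x 1 with hy
  set s₀ := √(R₀ ^ 2 - t ^ 2)
  set s₁ := √(R₁ ^ 2 - t ^ 2)
  set P := thicknessFactor R₀ R₁ t
  set H₀ := circleHeight R₀ t
  set H₁ := circleHeight R₁ t
  have hlt : (y - H₁) ^ 2 < (H₀ - H₁) ^ 2 := by
    apply pow_lt_pow_left₀ (by linarith) b1.le (by norm_num)
  -- Each factor `1 / s₀` produced by differentiating the inner height or the thickness factor is
  -- paired with this `s₀`.
  have hχs' : χ t ≤ C₂ * s₀ := hχs.trans (by gcongr)
  have hR0t : |t| ≤ R₀ := h0.le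
  have ht2 : t ^ 2 = |t| ^ 2 := (sq_abs t).symm
  have hthick : H₀ - H₁ ≤ t ^ 2 / R₀ := by linarith
  have hQ : (H₀ - H₁) ^ 2 - (y - H₁) ^ 2 ≤ |t| ^ 4 / R₀ ^ 2 := by
    have : (H₀ - H₁) ^ 2 ≤ (t ^ 2 / R₀) ^ 2 := by
      apply pow_le_pow_left₀ (by linarith) hthick
    have e : (t ^ 2 / R₀) ^ 2 = |t| ^ 4 / R₀ ^ 2 := by rw [ht2]; ring
    nlinarith [sq_nonneg (y - H₁)]
  have hQ0 : 0 ≤ (H₀ - H₁) ^ 2 - (y - H₁) ^ 2 := by linarith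
  have hgrad : HasGradientAt (modelCorrector R₀ R₁ χ)
      (EuclideanSpace.single 0 ((deriv χ t * P + χ t * p) * ((H₀ - H₁) ^ 2 - (y - H₁) ^ 2) +
        χ t * P * (2 * (H₀ - H₁) * (t / s₀ - t / s₁) + 2 * (y - H₁) * (t / s₁))) +
      EuclideanSpace.single 1 (-(2 * χ t * P * (y - H₁)))) x := by
    refine HasGradientAt.congr_of_eventuallyEq ?_ (modelCorrector_eventuallyEq hlt)
    have ga := hasGradientAt_comp_coord_zero (x := x) (dχ.mul hp)
    have gb := hasGradientAt_comp_coord_zero (x := x) ((dH0.sub dH1).pow 2)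
    have gc := hasGradientAt_comp_coord_zero (x := x) dH1
    have gd := (hasGradientAt_coord 1 x).sub' gc
    have ge := HasGradientAt.scomp (f := fun z : Plane => z 1 - circleHeight R₁ (z 0))
      (hasDerivAt_pow 2 (x 1 - circleHeight R₁ (x 0))) gd
    have := ga.mul' (gb.sub' ge)
    convert this using 1
    · ext z
      simp
    · ext i
      fin_cases i
      · simp [P, H₀, H₁, t, y]
        ring
      · simp [P, H₁, t, y]
        ring
  refine ⟨?_, ?_, ?_⟩
  · rw [modelCorrector, max_eq_right hQ0]
    calc χ t * P * ((H₀ - H₁) ^ 2 - (y - H₁) ^ 2) ≤ 1 * C₁ * (|t| ^ 4 / R₀ ^ 2) := by gcongr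
      _ = C₁ / R₀ ^ 2 * t ^ 4 := by
        rw [show |t| ^ 4 = t ^ 4 from Even.pow_abs (by decide) t]; ring
      _ ≤ D * t ^ 4 := by
        gcongr
        rw [hD]
        have : 0 ≤ C₂ * C₁ * R₀ / R₀ ^ 2 + C₂ * C₁ * R₀ / R₀ ^ 2 + C₂ * C₁ * (6 / R₀) := by
          positivity
        linarith
  · rw [hgrad.gradient]
    simp only [PiLp.add_apply, PiLp.single_apply]
    norm_num
    have e1 : |(deriv χ t * P) * ((H₀ - H₁) ^ 2 - (y - H₁) ^ 2)| ≤
        C₂ * C₁ * R₀ / R₀ ^ 2 * |t| ^ 3 := by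
      rw [abs_mul, abs_mul, abs_of_pos hP0, abs_of_nonneg hQ0]
      calc _ ≤ C₂ * C₁ * (|t| ^ 4 / R₀ ^ 2) := by gcongr
        _ = C₂ * C₁ * |t| / R₀ ^ 2 * |t| ^ 3 := by ring
        _ ≤ _ := by gcongr
    have e2 : |(χ t * p) * ((H₀ - H₁) ^ 2 - (y - H₁) ^ 2)| ≤
        C₂ * C₁ * R₀ / R₀ ^ 2 * |t| ^ 3 := by
      rw [abs_mul, abs_mul, abs_of_nonneg hχ0, abs_of_nonneg hQ0]
      calc _ ≤ (C₂ * s₀) * |p| * (|t| ^ 4 / R₀ ^ 2) := by gcongr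
        _ = C₂ * (|p| * s₀) * |t| / R₀ ^ 2 * |t| ^ 3 := by ring
        _ ≤ C₂ * C₁ * R₀ / R₀ ^ 2 * |t| ^ 3 := by gcongr
    have e3 : |χ t * P * (2 * (H₀ - H₁) * (t / s₀ - t / s₁) + 2 * (y - H₁) * (t / s₁))| ≤
        C₂ * C₁ * (6 / R₀) * |t| ^ 3 := by
      have hs1' := hs0.trans_le hs1
      have f0 : |t / s₀| = |t| / s₀ := by rw [abs_div, abs_of_pos hs0]
      have f1 : |t / s₁| ≤ |t| / s₀ := by
        rw [abs_div, abs_of_pos hs1']; gcongr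
      have f2 : |2 * (H₀ - H₁) * (t / s₀ - t / s₁) + 2 * (y - H₁) * (t / s₁)| ≤
          6 / R₀ * |t| ^ 3 / s₀ := by
        refine (abs_add_le _ _).trans ?_
        rw [abs_mul (2 * (H₀ - H₁)), abs_mul (2 * (y - H₁)),
          abs_of_nonneg (show 0 ≤ 2 * (H₀ - H₁) by linarith),
          abs_of_nonneg (show 0 ≤ 2 * (y - H₁) by linarith)]
        have f3 : |t / s₀ - t / s₁| ≤ |t| / s₀ + |t| / s₀ :=
          (abs_sub _ _).trans (add_le_add f0.le f1)
        calc _ ≤ 2 * (t ^ 2 / R₀) * (|t| / s₀ + |t| / s₀) + 2 * (t ^ 2 / R₀) * (|t| / s₀) := by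
              gcongr
          _ = _ := by rw [ht2]; ring
      rw [abs_mul, abs_mul, abs_of_nonneg hχ0, abs_of_pos hP0]
      calc _ ≤ (C₂ * s₀) * C₁ * (6 / R₀ * |t| ^ 3 / s₀) := by gcongr
        _ = _ := by field_simp
    have e4 : (deriv χ t * P + χ t * p) * ((H₀ - H₁) ^ 2 - (y - H₁) ^ 2) =
      (deriv χ t * P) * ((H₀ - H₁) ^ 2 - (y - H₁) ^ 2) +
      (χ t * p) * ((H₀ - H₁) ^ 2 - (y - H₁) ^ 2) := by ring
    rw [e4]
    refine (abs_add_le _ _).trans ((add_le_add ((abs_add_le _ _).trans (add_le_add e1 e2)) e3).trans ?_)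
    rw [← add_mul, ← add_mul]
    gcongr
    rw [hD]
    have : 0 ≤ C₁ / R₀ ^ 2 := by positivity
    linarith
  · rw [hgrad.gradient]
    simp only [PiLp.add_apply, PiLp.single_apply]
    norm_num

theorem gradient_modelCorrector_eq_zero (hχ : IsCutoff R₀ χ) {x : Plane}
    (h : modelCorrector R₀ R₁ χ x = 0) : gradient (modelCorrector R₀ R₁ χ) x = 0 := by
  have : IsLocalMin (modelCorrector R₀ R₁ χ) x :=
    Eventually.of_forall fun y => by rw [h]; exact modelCorrector_nonneg hχ y
  simp [gradient, this.fderiv_eq_zero]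

theorem measurable_gradient (f : Plane → ℝ) : Measurable (gradient f) :=
  (InnerProductSpace.toDual ℝ Plane).symm.continuous.measurable.comp (measurable_fderiv ℝ f)

/-- The positive part in the definition creates kinks, but only on the zero set, so the criterion
for nonnegative functions applies. Its hypothesis on the gradient holds because the gradient is
bounded: it is zero at zeros of the function, and elsewhere the estimates in the cusp are available.
-/
theorem isH10With_modelCorrector (hR₀ : 0 < R₀) (hR : R₀ < R₁) (hχ : IsCutoff R₀ χ) :
    IsH10With (cuspidalAnnulus R₀ R₁) (innerBoundary R₀) (modelCorrector R₀ R₁ χ)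
      (gradient (modelCorrector R₀ R₁ χ)) := by
  obtain ⟨C, hC, hb⟩ := exists_gradient_modelCorrector hR₀ hR hχ
  obtain ⟨C₁, hC₁, hP⟩ := exists_deriv_thicknessFactor hR₀ hR
  refine isH10With_of_nonneg isOpen_cuspidalAnnulus isClosed_innerBoundary
    (modelCorrector_nonneg hχ) (continuous_modelCorrector hR₀ hR hχ)
    (hasCompactSupport_modelCorrector hR₀ hR hχ)
    (fun x hx => modelCorrector_eq_zero_of_mem hR₀ hR hχ hx)
    (fun x hx => contDiffAt_modelCorrector hR₀ hR hχ hx) ?_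
  refine MemLp.of_bound (measurable_gradient _).aestronglyMeasurable
    (C * R₀ ^ 3 + 2 * 1 * C₁ * R₀)
    ((ae_restrict_iff' isOpen_cuspidalAnnulus.measurableSet).2 (Eventually.of_forall fun x hx => ?_))
  by_cases h : modelCorrector R₀ R₁ χ x = 0
  · rw [gradient_modelCorrector_eq_zero hχ h, norm_zero]
    positivity
  have hxS := mem_cuspRegion_of_modelCorrector_ne_zero hR₀ hR hχ hx h
  obtain ⟨-, g0, g1⟩ := hb x hxS
  obtain ⟨-, -, -, b1, b2, -⟩ := cuspRegion_bounds hR₀ hR hxS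
  have hx0 := hxS.1.le
  have hP0 := (thicknessFactor_pos hR₀ hR (x 0)).le
  have hP1 := (hP _ hxS.1).1
  have hχ0 := hχ.nonneg (x 0)
  have hχ1 := hχ.le_one (x 0)
  have hle : x 1 - circleHeight R₁ (x 0) ≤ R₀ := by
    have := circleHeight_le_radius R₀ (x 0)
    have := circleHeight_nonneg (hR₀.trans hR).le (x 0)
    linarith [hxS.2.2]
  refine (norm_le_abs_add_abs _).trans (add_le_add (g0.trans (by gcongr)) ?_)
  rw [g1, abs_neg, abs_of_nonneg (by positivity)]
  gcongr

/-- In the cusp `(Hᵖ)² (1 - η²) = (Hᵖ / H)² (H² - (x₂ - H₁)²)`. Elsewhere in the annulus both sides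
vanish, in particular above the core. -/
theorem modelCorrector_eq (hR₀ : 0 < R₀) (hR : R₀ < R₁) (hχ : IsCutoff R₀ χ) (lam c₀ : ℝ) {x : Plane}
    (hx : x ∈ cuspidalAnnulus R₀ R₁) :
    cuspCutoff R₀ χ x * stretchedCorrector R₀ R₁ lam c₀ x =
      lam * c₀ / 2 * modelCorrector R₀ R₁ χ x := by
  by_cases hS : x ∈ cuspRegion R₀ R₁
  · obtain ⟨b0, -, -, b1, b2, -⟩ := cuspRegion_bounds hR₀ hR hS
    have h0 := hS.1
    have hlt : x 1 < R₀ := hS.2.2.trans_le (circleHeight_le_radius _ _)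
    have hh := relThickness_pos hR₀ hR (x 0)
    have e := circleHeight_sub_eq hR₀ hR h0.le
    have hlt2 : (x 1 - circleHeight R₁ (x 0)) ^ 2 ≤
        (circleHeight R₀ (x 0) - circleHeight R₁ (x 0)) ^ 2 :=
      pow_le_pow_left₀ b1.le (by linarith [hS.2.2]) 2
    rw [cuspCutoff, if_pos hlt, stretchedCorrector, modelCorrector, max_eq_right (by linarith),
      stretchedCoord, thicknessFactor, e]
    unfold principalHeight
    field_simp
  · have h1 : modelCorrector R₀ R₁ χ x = 0 := by
      by_contra h
      exact hS (mem_cuspRegion_of_modelCorrector_ne_zero hR₀ hR hχ hx h)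
    have h2 : cuspCutoff R₀ χ x = 0 := by
      rw [cuspCutoff]
      split_ifs with hlt
      · refine hχ.eq_zero _ (not_lt.1 fun h => hS (mem_cuspRegion hR₀ hR hx h hlt))
      · rfl
    rw [h1, h2]
    simp

end ModelCorrector

/-! ### The remainder after subtraction of the model corrector -/

section Remainder

variable {R₀ R₁ : ℝ} {χ : ℝ → ℝ}

/-- The form of the slice identity that enters the weak equation: the part `χ` of the source becomes
a flux in the direction of `x₂`, extended by zero outside the cusp region. -/
theorem integral_cutoff_mul (hR₀ : 0 < R₀) (hR : R₀ < R₁) (hχ : IsCutoff R₀ χ) {v : Plane → ℝ}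
    {V : Plane → Plane} (h : IsH10With (cuspidalAnnulus R₀ R₁) (innerBoundary R₀) v V) :
    ∫ x in cuspidalAnnulus R₀ R₁, (cuspRegion R₀ R₁).indicator (fun x => χ (x 0)) x * v x =
      -∫ x in cuspidalAnnulus R₀ R₁, inner ℝ (EuclideanSpace.single (1 : Fin 2)
        ((cuspRegion R₀ R₁).indicator
          (fun x => χ (x 0) * (x 1 - circleHeight R₁ (x 0))) x) : Plane) (V x) := by
  have hS := (isOpen_cuspRegion (R₀ := R₀) (R₁ := R₁)).measurableSet
  have hi := Set.inter_eq_right.2 (cuspRegion_subset hR₀ hR)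
  have e1 : (fun x => (cuspRegion R₀ R₁).indicator (fun x => χ (x 0)) x * v x) =
      (cuspRegion R₀ R₁).indicator fun x => v x * χ (x 0) := by
    ext x
    by_cases hx : x ∈ cuspRegion R₀ R₁ <;> simp [hx, mul_comm]
  have e2 : (fun x => inner ℝ (EuclideanSpace.single (1 : Fin 2)
        ((cuspRegion R₀ R₁).indicator
          (fun x => χ (x 0) * (x 1 - circleHeight R₁ (x 0))) x) : Plane) (V x)) =
      (cuspRegion R₀ R₁).indicator fun x => V x 1 * (χ (x 0) * (x 1 - circleHeight R₁ (x 0))) := by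
    ext x
    by_cases hx : x ∈ cuspRegion R₀ R₁ <;> simp [hx, EuclideanSpace.inner_single_left, mul_comm]
  rw [e1, e2, setIntegral_indicator hS, setIntegral_indicator hS, hi,
    h.setIntegral_cuspRegion hR₀ hR hχ.smooth.continuous]

theorem coord_pow_le (x : Plane) (j : ℕ) : |x 0| ^ j ≤ ‖x‖ ^ j := by
  have := abs_coord_le_norm x 0
  gcongr

/-- The right-hand side left by the model corrector is of fourth order at the cusp. -/
theorem memLp_source (hR₀ : 0 < R₀) (hR : R₀ < R₁) (hχ : IsCutoff R₀ χ) (a b : ℝ) :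
    MemLp (fun x => (‖x‖ ^ 4)⁻¹ *
      (a * (1 - (cuspRegion R₀ R₁).indicator (fun x => χ (x 0)) x) + b * modelCorrector R₀ R₁ χ x)) 2
      (volume.restrict (cuspidalAnnulus R₀ R₁)) := by
  have hS := (isOpen_cuspRegion (R₀ := R₀) (R₁ := R₁)).measurableSet
  obtain ⟨C, hC, hb⟩ := exists_gradient_modelCorrector hR₀ hR hχ
  have m1 : Measurable ((cuspRegion R₀ R₁).indicator fun x : Plane => χ (x 0)) :=
    (hχ.smooth.continuous.measurable.comp (measurable_coord 0)).indicator hS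
  have m2 := (continuous_modelCorrector hR₀ hR hχ).measurable
  have m3 : Measurable fun x : Plane => (‖x‖ ^ 4)⁻¹ := (measurable_norm.pow_const 4).inv
  refine MemLp.of_bound (m3.mul (((m1.const_sub 1).const_mul a).add
    (m2.const_mul b))).aestronglyMeasurable (|a| * (2 / R₀) ^ 4 + |b| * C)
    ((ae_restrict_iff' isOpen_cuspidalAnnulus.measurableSet).2 (Eventually.of_forall fun x hx => ?_))
  have hx0 := (cuspidalAnnulus_bounds hR₀ hR hx).1
  have hf : modelCorrector R₀ R₁ χ x ≤ C * ‖x‖ ^ 4 := by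
    by_cases h : modelCorrector R₀ R₁ χ x = 0
    · rw [h]; positivity
    · refine (hb x (mem_cuspRegion_of_modelCorrector_ne_zero hR₀ hR hχ hx h)).1.trans ?_
      have := coord_pow_le x 4
      rw [Even.pow_abs (by decide)] at this
      gcongr
  -- The left side is zero for `‖x‖ < R₀ / 2`, and at most `1` elsewhere, where the right side is at
  -- least `1`.
  have hi : |1 - (cuspRegion R₀ R₁).indicator (fun x => χ (x 0)) x| ≤ (2 / R₀) ^ 4 * ‖x‖ ^ 4 := by
    rcases lt_or_ge ‖x‖ (R₀ / 2) with h | h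
    · have hxS := mem_cuspRegion_of_norm_lt hR₀ hR hx (by linarith)
      rw [Set.indicator_of_mem hxS, hχ.eq_one _ ((abs_coord_le_norm x 0).trans h.le), sub_self,
        abs_zero]
      positivity
    · have h1 : |1 - (cuspRegion R₀ R₁).indicator (fun x => χ (x 0)) x| ≤ 1 := by
        by_cases hxS : x ∈ cuspRegion R₀ R₁
        · rw [Set.indicator_of_mem hxS, abs_le]
          constructor <;> linarith [hχ.nonneg (x 0), hχ.le_one (x 0)]
        · simp [hxS]
      refine h1.trans ?_
      rw [← mul_pow]
      refine one_le_pow₀ ?_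
      rw [div_mul_eq_mul_div, le_div_iff₀ hR₀]
      linarith
  rw [norm_mul, Real.norm_of_nonneg (by positivity), inv_mul_le_iff₀ (by positivity)]
  refine (norm_add_le _ _).trans ?_
  rw [norm_mul, norm_mul, Real.norm_of_nonneg (modelCorrector_nonneg hχ x), Real.norm_eq_abs,
    Real.norm_eq_abs, Real.norm_eq_abs]
  calc _ ≤ |a| * ((2 / R₀) ^ 4 * ‖x‖ ^ 4) + |b| * (C * ‖x‖ ^ 4) := by gcongr
    _ = _ := by ring

/-- The decisive cancellation. With `P` the thickness factor, the vertical component is `2 χ (1 - P)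
(x₂ - H₁) = O(t⁴)`, whereas each of its two summands is only `O(t²)`. The order three comes from the
horizontal derivative, which nothing cancels. -/
theorem exists_norm_flux_le (hR₀ : 0 < R₀) (hR : R₀ < R₁) (hχ : IsCutoff R₀ χ) :
    ∃ C : ℝ, 0 ≤ C ∧ ∀ x ∈ cuspidalAnnulus R₀ R₁,
      ‖(EuclideanSpace.single (1 : Fin 2) (2 * (cuspRegion R₀ R₁).indicator
          (fun x => χ (x 0) * (x 1 - circleHeight R₁ (x 0))) x) : Plane) +
        gradient (modelCorrector R₀ R₁ χ) x‖ ≤ C * ‖x‖ ^ 3 := by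
  obtain ⟨C, hC, hb⟩ := exists_gradient_modelCorrector hR₀ hR hχ
  obtain ⟨C₁, hC₁, hP⟩ := exists_deriv_thicknessFactor hR₀ hR
  refine ⟨C + 2 * C₁, by positivity, fun x hx => ?_⟩
  by_cases hxS : x ∈ cuspRegion R₀ R₁
  · obtain ⟨-, g0, g1⟩ := hb x hxS
    obtain ⟨-, -, -, b1, b2, -⟩ := cuspRegion_bounds hR₀ hR hxS
    obtain ⟨-, p1, -⟩ := hP _ hxS.1
    have hχ0 := hχ.nonneg (x 0)
    have hχ1 := hχ.le_one (x 0)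
    refine (norm_le_abs_add_abs _).trans ?_
    simp only [PiLp.add_apply, PiLp.single_apply, g1, Set.indicator_of_mem hxS]
    norm_num
    have e : 2 * (χ (x 0) * (x 1 - circleHeight R₁ (x 0))) +
        -(2 * χ (x 0) * thicknessFactor R₀ R₁ (x 0) * (x 1 - circleHeight R₁ (x 0))) =
        2 * χ (x 0) * (1 - thicknessFactor R₀ R₁ (x 0)) * (x 1 - circleHeight R₁ (x 0)) := by ring
    have h3 := coord_pow_le x 3
    have hlt := hxS.1.le
    have e2 : |2 * χ (x 0) * (1 - thicknessFactor R₀ R₁ (x 0)) * (x 1 - circleHeight R₁ (x 0))| ≤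
        2 * C₁ * |x 0| ^ 3 := by
      rw [abs_mul, abs_mul, abs_of_pos b1, abs_of_nonneg (by positivity : 0 ≤ 2 * χ (x 0))]
      calc _ ≤ 2 * 1 * (C₁ * x 0 ^ 2) * (x 0 ^ 2 / R₀) := by gcongr
        _ = 2 * C₁ * |x 0| ^ 3 * (|x 0| / R₀) := by rw [← sq_abs (x 0)]; ring
        _ ≤ 2 * C₁ * |x 0| ^ 3 * 1 := by
          gcongr
          rw [div_le_one hR₀]; exact hlt
        _ = _ := by ring
    rw [e, add_mul]
    exact add_le_add (g0.trans (by gcongr)) (e2.trans (by gcongr))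
  · have h1 : modelCorrector R₀ R₁ χ x = 0 := by
      by_contra h
      exact hxS (mem_cuspRegion_of_modelCorrector_ne_zero hR₀ hR hχ hx h)
    rw [gradient_modelCorrector_eq_zero hχ h1, Set.indicator_of_notMem hxS]
    simp
    positivity

/-- Write `λ u = λ w + λ k f + λ c₀ (1 - X) + λ c₀ X` with `k = λ c₀ / 2`. The last term becomes the
flux `-2 k Y` by `integral_cutoff_mul` and joins `-k ∇f` in `F`; the two middle terms form `g`. Both
right-hand sides then satisfy the hypotheses of the weighted estimate. -/
theorem IsKissingSolution.isH10With_remainder (hR₀ : 0 < R₀) (hR : R₀ < R₁) {lam c₀ : ℝ}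
    (hlam : 0 ≤ lam) {u : Plane → ℝ} (hu : IsKissingSolution R₀ R₁ lam c₀ u)
    (hχ : IsCutoff R₀ χ) :
    ∃ K : Plane → Plane, IsH10With (cuspidalAnnulus R₀ R₁) (innerBoundary R₀)
      (fun x => (‖x‖ ^ 4)⁻¹ * (u x - c₀ - lam * c₀ / 2 * modelCorrector R₀ R₁ χ x)) K := by
  have hΩ := (isOpen_cuspidalAnnulus (R₀ := R₀) (R₁ := R₁)).measurableSet
  have hS := (isOpen_cuspRegion (R₀ := R₀) (R₁ := R₁)).measurableSet
  obtain ⟨⟨G', hG'⟩, G, hG, heq⟩ := hu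
  set k := lam * c₀ / 2 with hk
  set f := modelCorrector R₀ R₁ χ with hf
  set Y : Plane → ℝ := (cuspRegion R₀ R₁).indicator
    fun x => χ (x 0) * (x 1 - circleHeight R₁ (x 0)) with hY
  set X : Plane → ℝ := (cuspRegion R₀ R₁).indicator fun x => χ (x 0) with hX
  -- The boundary condition and the weak equation each bring their own weak gradient, of `u - c₀`
  -- and of `u`; uniqueness identifies them.
  have hGG : G' =ᵐ[volume.restrict (cuspidalAnnulus R₀ R₁)] G := by
    have := hG.sub hΩ (isH1With_const c₀)
    simp only [sub_zero] at this
    exact hG'.1.ae_eq isOpen_cuspidalAnnulus this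
  have hmod : IsH10With (cuspidalAnnulus R₀ R₁) (innerBoundary R₀) f (gradient f) :=
    isH10With_modelCorrector hR₀ hR hχ
  have hw := hG'.sub hΩ (hmod.const_mul isOpen_cuspidalAnnulus isClosed_innerBoundary k)
  set F : Plane → Plane := fun x => (-k) • ((EuclideanSpace.single (1 : Fin 2) (2 * Y x) : Plane) +
    gradient f x) with hF
  have mY : Measurable Y := by
    refine Measurable.indicator ?_ hS
    exact (hχ.smooth.continuous.measurable.comp (measurable_coord 0)).mul
      ((measurable_coord 1).sub
        ((continuous_circleHeight R₁).measurable.comp (measurable_coord 0)))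
  have msingle : Measurable fun x => (EuclideanSpace.single (1 : Fin 2) (2 * Y x) : Plane) := by
    have e : (fun x => (EuclideanSpace.single (1 : Fin 2) (2 * Y x) : Plane)) =
        fun x => (2 * Y x) • (EuclideanSpace.single (1 : Fin 2) (1 : ℝ) : Plane) := by
      ext x i
      fin_cases i <;> simp
    rw [e]
    exact (mY.const_mul 2).smul_const _
  obtain ⟨C, hC, hCb⟩ := exists_norm_flux_le hR₀ hR hχ
  have lF4 : MemLp (fun x => (‖x‖ ^ 4)⁻¹ • F x) 2 (volume.restrict (cuspidalAnnulus R₀ R₁)) := by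
    have m3 : Measurable fun x : Plane => (‖x‖ ^ 4)⁻¹ := (measurable_norm.pow_const 4).inv
    refine MemLp.of_le_mul (c := |k| * C) (memLp_inv_norm hR₀ hR)
      (m3.smul ((msingle.add (measurable_gradient f)).const_smul (-k))).aestronglyMeasurable
      ((ae_restrict_iff' hΩ).2 (Eventually.of_forall fun x hx => ?_))
    have hx0 := (cuspidalAnnulus_bounds hR₀ hR hx).1
    have h1 := hCb x hx
    rw [norm_smul, norm_smul, norm_neg, Real.norm_of_nonneg (by positivity : 0 ≤ (‖x‖ ^ 4)⁻¹),
      norm_inv, norm_norm, Real.norm_eq_abs]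
    calc _ ≤ (‖x‖ ^ 4)⁻¹ * (|k| * (C * ‖x‖ ^ 3)) := by gcongr
      _ = _ := by field_simp
  refine ⟨_, hw.inv_pow_four_mul hR₀ hR hlam
    (g := fun x => lam * c₀ * (1 - X x) + lam * k * f x) (F := F)
    (memLp_source hR₀ hR hχ _ _) lF4 fun v V hv => ?_⟩
  have lv := hv.1.memLp
  have lV := hv.1.memLp_grad
  have lf := hmod.1.memLp
  have lgf := hmod.1.memLp_grad
  have lu := hG.memLp
  have lX : MemLp X 2 (volume.restrict (cuspidalAnnulus R₀ R₁)) := by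
    refine MemLp.of_bound ((hχ.smooth.continuous.measurable.comp
      (measurable_coord 0)).indicator hS).aestronglyMeasurable 1 (Eventually.of_forall fun x => ?_)
    refine (norm_indicator_le_norm_self _ _).trans ?_
    change ‖χ (x 0)‖ ≤ 1
    rw [Real.norm_of_nonneg (hχ.nonneg _)]
    exact hχ.le_one _
  have i1 : Integrable (fun x => u x * v x) (volume.restrict (cuspidalAnnulus R₀ R₁)) :=
    lu.integrable_mul lv
  have i2 : Integrable (fun x => f x * v x) (volume.restrict (cuspidalAnnulus R₀ R₁)) :=
    lf.integrable_mul lv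
  have i3 : Integrable (fun x => X x * v x) (volume.restrict (cuspidalAnnulus R₀ R₁)) :=
    lX.integrable_mul lv
  have i4 : Integrable v (volume.restrict (cuspidalAnnulus R₀ R₁)) := lv.integrable one_le_two
  have i5 := integrable_inner_of_memLp hG'.1.memLp_grad lV
  have i6 := integrable_inner_of_memLp lgf lV
  have e0 : ∫ x in cuspidalAnnulus R₀ R₁, inner ℝ (G' x) (V x) =
      lam * ∫ x in cuspidalAnnulus R₀ R₁, u x * v x := by
    rw [← heq v V hv]
    refine integral_congr_ae ?_
    filter_upwards [hGG] with x hx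
    rw [hx]
  have e1 : ∫ x in cuspidalAnnulus R₀ R₁, inner ℝ (G' x - k • gradient f x) (V x) =
      lam * (∫ x in cuspidalAnnulus R₀ R₁, u x * v x) -
        k * ∫ x in cuspidalAnnulus R₀ R₁, inner ℝ (gradient f x) (V x) := by
    rw [← e0, ← integral_const_mul, ← integral_sub i5 (i6.const_mul k)]
    congr 1
    ext x
    rw [inner_sub_left, inner_smul_left]
    simp
  have iA : Integrable (fun x => u x * v x - c₀ * v x)
      (volume.restrict (cuspidalAnnulus R₀ R₁)) := i1.sub (i4.const_mul c₀)
  have iB : Integrable (fun x => lam * c₀ * v x - lam * c₀ * (X x * v x))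
      (volume.restrict (cuspidalAnnulus R₀ R₁)) :=
    (i4.const_mul (lam * c₀)).sub (i3.const_mul (lam * c₀))
  have e2 : ∫ x in cuspidalAnnulus R₀ R₁, (u x - c₀ - k * f x) * v x =
      (∫ x in cuspidalAnnulus R₀ R₁, u x * v x) - c₀ * (∫ x in cuspidalAnnulus R₀ R₁, v x) -
        k * ∫ x in cuspidalAnnulus R₀ R₁, f x * v x := by
    rw [← integral_const_mul, ← integral_const_mul, ← integral_sub i1 (i4.const_mul c₀),
      ← integral_sub iA (i2.const_mul k)]
    congr 1
    ext x
    ring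
  have e3 : ∫ x in cuspidalAnnulus R₀ R₁, (lam * c₀ * (1 - X x) + lam * k * f x) * v x =
      lam * c₀ * (∫ x in cuspidalAnnulus R₀ R₁, v x) -
        lam * c₀ * (∫ x in cuspidalAnnulus R₀ R₁, X x * v x) +
        lam * k * ∫ x in cuspidalAnnulus R₀ R₁, f x * v x := by
    rw [← integral_const_mul, ← integral_const_mul, ← integral_const_mul,
      ← integral_sub (i4.const_mul (lam * c₀)) (i3.const_mul (lam * c₀)),
      ← integral_add iB (i2.const_mul (lam * k))]
    congr 1
    ext x
    ring
  have iY : Integrable (fun x => inner ℝ (EuclideanSpace.single (1 : Fin 2) (Y x) : Plane) (V x))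
      (volume.restrict (cuspidalAnnulus R₀ R₁)) := by
    refine integrable_inner_of_memLp (MemLp.of_bound (C := R₀) ?_ ?_) lV
    · have e : (fun x => (EuclideanSpace.single (1 : Fin 2) (Y x) : Plane)) =
          fun x => Y x • (EuclideanSpace.single (1 : Fin 2) (1 : ℝ) : Plane) := by
        ext x i
        fin_cases i <;> simp
      rw [e]
      exact (mY.smul_const _).aestronglyMeasurable
    · refine Eventually.of_forall fun x => ?_
      rw [PiLp.norm_single]
      by_cases hx : x ∈ cuspRegion R₀ R₁
      · obtain ⟨-, -, -, b1, b2, -⟩ := cuspRegion_bounds hR₀ hR hx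
        rw [hY, Set.indicator_of_mem hx, norm_mul, Real.norm_of_nonneg (hχ.nonneg _),
          Real.norm_of_nonneg b1.le]
        have h1 : x 0 ^ 2 / R₀ ≤ R₀ := by
          rw [div_le_iff₀ hR₀, ← sq, sq_le_sq, abs_of_pos hR₀]
          exact hx.1.le
        calc _ ≤ 1 * R₀ := by
              gcongr
              · exact hχ.le_one _
              · exact b2.trans h1
          _ = R₀ := one_mul _
      · rw [hY, Set.indicator_of_notMem hx]
        simpa using hR₀.le
  have e4 : ∫ x in cuspidalAnnulus R₀ R₁, inner ℝ (F x) (V x) =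
      -(2 * k) * (∫ x in cuspidalAnnulus R₀ R₁,
        inner ℝ (EuclideanSpace.single (1 : Fin 2) (Y x) : Plane) (V x)) -
        k * ∫ x in cuspidalAnnulus R₀ R₁, inner ℝ (gradient f x) (V x) := by
    rw [← integral_const_mul, ← integral_const_mul, ← integral_sub (iY.const_mul _) (i6.const_mul _)]
    congr 1
    ext x
    simp only [hF, inner_smul_left, inner_add_left, EuclideanSpace.inner_single_left]
    simp
    ring
  have e5 := integral_cutoff_mul hR₀ hR hχ hv
  rw [← hX, ← hY] at e5
  rw [e1, e2, e3, e4, e5]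
  rw [hk]
  ring

end Remainder

/-! ### Weights given by a distance to the cusp -/

section Weight

variable {R₀ R₁ : ℝ} {ρ : Plane → ℝ}

theorem ne_zero_of_mem_cuspidalAnnulus (hR₀ : 0 < R₀) (hR : R₀ < R₁) {x : Plane}
    (hx : x ∈ cuspidalAnnulus R₀ R₁) : x ≠ 0 :=
  norm_pos_iff.1 (cuspidalAnnulus_bounds hR₀ hR hx).1

theorem isCompact_closure_cuspidalAnnulus : IsCompact (closure (cuspidalAnnulus R₀ R₁)) :=
  (Metric.isBounded_ball.subset Set.sdiff_subset).isCompact_closure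

/-- A function that is continuously differentiable off the cusp is bounded together with its
gradient away from the cusp. -/
theorem exists_bound_away_from_cusp {g : Plane → ℝ}
    (hg : ∀ x ∈ closure (cuspidalAnnulus R₀ R₁), x ≠ 0 → ContDiffAt ℝ 1 g x) {r : ℝ} (hr : 0 < r) :
    ∃ C : ℝ, 0 ≤ C ∧ ∀ x ∈ cuspidalAnnulus R₀ R₁, r ≤ ‖x‖ → |g x| ≤ C ∧ ‖gradient g x‖ ≤ C := by
  set K := closure (cuspidalAnnulus R₀ R₁) \ Metric.ball 0 r with hK
  have hKc : IsCompact K := isCompact_closure_cuspidalAnnulus.diff Metric.isOpen_ball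
  have hKg : ∀ x ∈ K, ContDiffAt ℝ 1 g x := fun x hx => hg x hx.1 fun h => hx.2 (by simpa [h] using hr)
  obtain ⟨C₁, h₁⟩ := hKc.exists_bound_of_continuousOn (f := g)
    fun x hx => (hKg x hx).continuousAt.continuousWithinAt
  have hc : ContinuousOn (gradient g) K := by
    intro x hx
    obtain ⟨V, hV, hxV, hgV⟩ := (hKg x hx).contDiffOn' (m := 1) le_rfl (by simp)
    rw [Set.insert_eq_of_mem (Set.mem_univ _), Set.univ_inter] at hgV
    exact ((continuousOn_gradient hV hgV).continuousAt (hV.mem_nhds hxV)).continuousWithinAt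
  obtain ⟨C₂, h₂⟩ := hKc.exists_bound_of_continuousOn hc
  refine ⟨max 0 (max C₁ C₂), le_max_left _ _, fun x hx hxr => ?_⟩
  have hxK : x ∈ K := ⟨subset_closure hx, by simpa using hxr⟩
  exact ⟨(h₁ x hxK).trans ((le_max_left _ _).trans (le_max_right _ _)),
    (h₂ x hxK).trans ((le_max_right _ _).trans (le_max_right _ _))⟩

theorem IsCuspDistance.exists_radius (hρ : IsCuspDistance (cuspidalAnnulus R₀ R₁) ρ) :
    ∃ r : ℝ, 0 < r ∧ ∀ x ∈ cuspidalAnnulus R₀ R₁, ‖x‖ < r → ρ x = ‖x‖ := by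
  obtain ⟨r, hr, h⟩ := Metric.mem_nhdsWithin_iff.1 hρ.eq_norm
  exact ⟨r, hr, fun x hx hxr => h ⟨by simpa using hxr, hx⟩⟩

theorem gradient_congr_of_eqOn {Ω : Set Plane} {f g : Plane → ℝ} {r : ℝ} (hΩ : IsOpen Ω)
    (h : ∀ x ∈ Ω, ‖x‖ < r → f x = g x) {x : Plane} (hx : x ∈ Ω) (hxr : ‖x‖ < r) :
    gradient f x = gradient g x := by
  have : f =ᶠ[𝓝 x] g := by
    filter_upwards [hΩ.mem_nhds hx, Metric.isOpen_ball.mem_nhds (mem_ball_zero_iff.2 hxr)]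
      with y hy hyr
    exact h y hy (mem_ball_zero_iff.1 hyr)
  exact Filter.EventuallyEq.gradient_eq this

theorem IsCuspDistance.contDiffAt_inv_pow (hρ : IsCuspDistance (cuspidalAnnulus R₀ R₁) ρ) (j : ℕ)
    {x : Plane} (hx : x ∈ closure (cuspidalAnnulus R₀ R₁)) (hx0 : x ≠ 0) :
    ContDiffAt ℝ ∞ (fun y => (ρ y ^ j)⁻¹) x :=
  ((hρ.smooth x hx hx0).pow j).inv (pow_pos (hρ.pos x hx hx0) j).ne'

theorem contDiffAt_norm_pow {x : Plane} (hx : x ≠ 0) (j : ℕ) :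
    ContDiffAt ℝ ∞ (fun y : Plane => ‖y‖ ^ j) x :=
  (contDiffAt_norm ℝ hx).pow j

theorem norm_gradient_inv_norm_pow_four {x : Plane} (hx : x ≠ 0) :
    ‖gradient (fun y : Plane => (‖y‖ ^ 4)⁻¹) x‖ = 4 * (‖x‖ ^ 5)⁻¹ := by
  have hx' : 0 < ‖x‖ := norm_pos_iff.2 hx
  have h := hasGradientAt_inv_pow (δ := 0) (x := x) (by positivity) 2
  simp only [add_zero, ← pow_mul] at h
  norm_num at h
  rw [h.gradient, norm_neg, norm_smul, Real.norm_of_nonneg (by positivity)]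
  field_simp

/-- The weight `ρ⁻⁴` is comparable to `‖x‖⁻⁴`, with its gradient. -/
theorem IsCuspDistance.exists_bound_weight (hR₀ : 0 < R₀) (hR : R₀ < R₁)
    (hρ : IsCuspDistance (cuspidalAnnulus R₀ R₁) ρ) :
    ∃ C : ℝ, 0 ≤ C ∧ ∀ x ∈ cuspidalAnnulus R₀ R₁, |(ρ x ^ 4)⁻¹| ≤ C * (‖x‖ ^ 4)⁻¹ ∧
      ‖gradient (fun y => (ρ y ^ 4)⁻¹) x‖ ≤ C * (‖x‖ ^ 5)⁻¹ := by
  obtain ⟨r, hr, hρr⟩ := hρ.exists_radius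
  obtain ⟨C, hC, hb⟩ := exists_bound_away_from_cusp (g := fun y => (ρ y ^ 4)⁻¹)
    (fun x hx hx0 => (hρ.contDiffAt_inv_pow 4 hx hx0).of_le (by simp)) hr
  have hR₁ := hR₀.trans hR
  refine ⟨4 + C * (2 * R₁) ^ 4 + C * (2 * R₁) ^ 5, by positivity, fun x hx => ?_⟩
  obtain ⟨hx0, hxR, -, -⟩ := cuspidalAnnulus_bounds hR₀ hR hx
  rcases lt_or_ge ‖x‖ r with h | h
  · have e : gradient (fun y => (ρ y ^ 4)⁻¹) x = gradient (fun y : Plane => (‖y‖ ^ 4)⁻¹) x :=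
      gradient_congr_of_eqOn isOpen_cuspidalAnnulus (fun y hy hyr => by rw [hρr y hy hyr]) hx h
    rw [e, norm_gradient_inv_norm_pow_four (norm_pos_iff.1 hx0), hρr x hx h,
      abs_of_nonneg (by positivity)]
    constructor
    · refine le_mul_of_one_le_left (by positivity) ?_
      have : 0 ≤ C * (2 * R₁) ^ 4 + C * (2 * R₁) ^ 5 := by positivity
      linarith
    · gcongr
      have : 0 ≤ C * (2 * R₁) ^ 4 + C * (2 * R₁) ^ 5 := by positivity
      linarith
  · obtain ⟨h1, h2⟩ := hb x hx h
    constructor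
    · refine h1.trans ?_
      rw [le_mul_inv_iff₀ (by positivity)]
      have : C * ‖x‖ ^ 4 ≤ C * (2 * R₁) ^ 4 := by gcongr
      have : 0 ≤ C * (2 * R₁) ^ 5 := by positivity
      linarith
    · refine h2.trans ?_
      rw [le_mul_inv_iff₀ (by positivity)]
      have : C * ‖x‖ ^ 5 ≤ C * (2 * R₁) ^ 5 := by gcongr
      have : 0 ≤ C * (2 * R₁) ^ 4 := by positivity
      linarith

/-- The quotient `‖x‖⁴ / ρ⁴` equals `1` in the annulus near the cusp and is `C¹` on the closure
except possibly at the origin. The origin belongs to the inner boundary, so `IsH10With.mul`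
tolerates the irregularity there. -/
theorem IsCuspDistance.memH10_weight (hR₀ : 0 < R₀) (hR : R₀ < R₁)
    (hρ : IsCuspDistance (cuspidalAnnulus R₀ R₁) ρ) {w : Plane → ℝ} {K : Plane → Plane}
    (h : IsH10With (cuspidalAnnulus R₀ R₁) (innerBoundary R₀) (fun x => (‖x‖ ^ 4)⁻¹ * w x) K) :
    MemH10 (cuspidalAnnulus R₀ R₁) (innerBoundary R₀) fun x => (ρ x ^ 4)⁻¹ * w x := by
  set m : Plane → ℝ := fun x => (ρ x ^ 4)⁻¹ * ‖x‖ ^ 4 with hm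
  obtain ⟨r, hr, hρr⟩ := hρ.exists_radius
  have hmc : ∀ x ∈ closure (cuspidalAnnulus R₀ R₁), x ≠ 0 → ContDiffAt ℝ 1 m x := fun x hx hx0 =>
    ((hρ.contDiffAt_inv_pow 4 hx hx0).mul (contDiffAt_norm_pow hx0 4)).of_le (by simp)
  obtain ⟨C, hC, hb⟩ := exists_bound_away_from_cusp hmc hr
  have hm1 : ∀ x ∈ cuspidalAnnulus R₀ R₁, ‖x‖ < r → m x = 1 := fun x hx hxr => by
    have := (cuspidalAnnulus_bounds hR₀ hR hx).1
    simp only [hm, hρr x hx hxr]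
    field_simp
  have hbd : ∀ x ∈ cuspidalAnnulus R₀ R₁, |m x| ≤ max 1 C ∧ ‖gradient m x‖ ≤ max 1 C := by
    intro x hx
    rcases lt_or_ge ‖x‖ r with h | h
    · rw [hm1 x hx h, gradient_congr_of_eqOn (g := fun _ => 1) isOpen_cuspidalAnnulus hm1 hx h,
        gradient_fun_const]
      simp
    · exact ⟨(hb x hx h).1.trans (le_max_right _ _), (hb x hx h).2.trans (le_max_right _ _)⟩
  set U : Set Plane := {x | ∀ᶠ y in 𝓝 x, ContDiffAt ℝ 1 m y} with hU
  have hUo : IsOpen U := isOpen_setOfPred_eventually_nhds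
  have hUm : ∀ x ∈ closure (cuspidalAnnulus R₀ R₁), x ≠ 0 → x ∈ U := fun x hx hx0 =>
    (hmc x hx hx0).eventually (by simp)
  have := IsH10With.mul isOpen_cuspidalAnnulus isClosed_innerBoundary h hUo
    (fun x hx => hUm x (subset_closure hx) (ne_zero_of_mem_cuspidalAnnulus hR₀ hR hx))
    (fun x hx => ?_) (m := m) (fun x hx => hx.self_of_nhds.contDiffWithinAt)
    (fun x hx => (hbd x hx).1) fun x hx => (hbd x hx).2
  · refine ⟨_, this.congr isOpen_cuspidalAnnulus.measurableSet (fun x hx => ?_) EventuallyEq.rfl⟩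
    have := (cuspidalAnnulus_bounds hR₀ hR hx).1
    simp only [hm]
    field_simp
  · by_cases hx0 : x = 0
    · exact Or.inr (hx0 ▸ zero_mem_innerBoundary hR₀)
    · exact Or.inl (hUm x hx hx0)

/-- A function of fourth order at the cusp, with gradient of third order, stays in `H¹` after
division by `ρ⁴`. -/
theorem IsCuspDistance.memH1_weight (hR₀ : 0 < R₀) (hR : R₀ < R₁)
    (hρ : IsCuspDistance (cuspidalAnnulus R₀ R₁) ρ) {w : Plane → ℝ} {W : Plane → Plane}
    (h : IsH1With (cuspidalAnnulus R₀ R₁) w W) {B : ℝ}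
    (hw : ∀ x ∈ cuspidalAnnulus R₀ R₁, |w x| ≤ B * ‖x‖ ^ 4)
    (hW : ∀ x ∈ cuspidalAnnulus R₀ R₁, ‖W x‖ ≤ B * ‖x‖ ^ 3) :
    MemH1 (cuspidalAnnulus R₀ R₁) fun x => (ρ x ^ 4)⁻¹ * w x := by
  have hΩ := (isOpen_cuspidalAnnulus (R₀ := R₀) (R₁ := R₁)).measurableSet
  obtain ⟨C, hC, hb⟩ := hρ.exists_bound_weight hR₀ hR
  have hm : ContDiffOn ℝ ∞ (fun x => (ρ x ^ 4)⁻¹) (cuspidalAnnulus R₀ R₁) := fun x hx =>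
    (hρ.contDiffAt_inv_pow 4 (subset_closure hx)
      (ne_zero_of_mem_cuspidalAnnulus hR₀ hR hx)).contDiffWithinAt
  have mm : AEStronglyMeasurable (fun x => (ρ x ^ 4)⁻¹)
      (volume.restrict (cuspidalAnnulus R₀ R₁)) := hm.continuousOn.aestronglyMeasurable hΩ
  refine ⟨_, h.mul_of_memLp isOpen_cuspidalAnnulus hm ?_ ?_⟩
  · refine MemLp.of_bound (mm.mul h.memLp.1) (C * B)
      ((ae_restrict_iff' hΩ).2 (Eventually.of_forall fun x hx => ?_))
    have hx0 := (cuspidalAnnulus_bounds hR₀ hR hx).1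
    rw [norm_mul, Real.norm_eq_abs, Real.norm_eq_abs]
    calc _ ≤ (C * (‖x‖ ^ 4)⁻¹) * (B * ‖x‖ ^ 4) := by
          gcongr
          · exact (hb x hx).1
          · exact hw x hx
      _ = C * B := by field_simp
  · refine MemLp.of_le_mul (c := 2 * (C * B)) (memLp_inv_norm hR₀ hR)
      ((mm.smul h.memLp_grad.1).add
        (h.memLp.1.smul (measurable_gradient _).aestronglyMeasurable))
      ((ae_restrict_iff' hΩ).2 (Eventually.of_forall fun x hx => ?_))
    have hx0 := (cuspidalAnnulus_bounds hR₀ hR hx).1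
    refine (norm_add_le _ _).trans ?_
    rw [norm_smul, norm_smul, Real.norm_eq_abs, Real.norm_eq_abs, norm_inv, norm_norm]
    calc _ ≤ (C * (‖x‖ ^ 4)⁻¹) * (B * ‖x‖ ^ 3) + (B * ‖x‖ ^ 4) * (C * (‖x‖ ^ 5)⁻¹) := by
          gcongr
          · exact (hb x hx).1
          · exact hW x hx
          · exact (abs_nonneg _).trans (hw x hx)
          · exact hw x hx
          · exact (hb x hx).2
      _ = _ := by field_simp; ring

theorem IsCuspDistance.rpow_neg_four (hR₀ : 0 < R₀) (hR : R₀ < R₁)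
    (hρ : IsCuspDistance (cuspidalAnnulus R₀ R₁) ρ) {x : Plane} (hx : x ∈ cuspidalAnnulus R₀ R₁) :
    ρ x ^ (-4 : ℝ) = (ρ x ^ 4)⁻¹ := by
  rw [Real.rpow_neg (hρ.pos x (subset_closure hx) (ne_zero_of_mem_cuspidalAnnulus hR₀ hR hx)).le,
    Real.rpow_ofNat]

end Weight

/-! ### The explicit corrector -/

section Corrector

variable {R₀ R₁ : ℝ} {χ : ℝ → ℝ} {ρ : Plane → ℝ}

theorem contDiff_corrector (R₀ R₁ lam c₀ : ℝ) : ContDiff ℝ ∞ (corrector R₀ R₁ lam c₀) := by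
  unfold corrector principalHeight
  fun_prop

theorem hasDerivAt_principalHeight (R t : ℝ) : HasDerivAt (principalHeight R) (t / R) t := by
  have := (hasDerivAt_pow 2 t).div_const (2 * R)
  refine this.congr_deriv ?_
  rw [Nat.cast_ofNat, pow_one, mul_div_mul_left _ _ two_ne_zero]

theorem gradient_corrector_apply (R₀ R₁ lam c₀ : ℝ) (x : Plane) :
    gradient (corrector R₀ R₁ lam c₀) x 0 = lam * c₀ *
        ((principalHeight R₀ (x 0) - principalHeight R₁ (x 0)) * (x 0 / R₀) +
          x 0 / R₁ * (x 1 - principalHeight R₀ (x 0))) ∧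
      gradient (corrector R₀ R₁ lam c₀) x 1 =
        lam * c₀ * (principalHeight R₁ (x 0) - x 1) := by
  have h1 := hasGradientAt_coord 1 x
  have ha := hasGradientAt_comp_coord_zero (x := x) (hasDerivAt_principalHeight R₀ (x 0))
  have hb := hasGradientAt_comp_coord_zero (x := x) (hasDerivAt_principalHeight R₁ (x 0))
  have h := ((((h1.mul' h1).sub' ((hb.const_mul' 2).mul' (h1.sub' ha))).sub'
    (ha.mul' ha)).const_mul' (-(lam * c₀ / 2)))
  have e := h.gradient
  simp only [← sq] at e
  change gradient (corrector R₀ R₁ lam c₀) x = _ at e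
  rw [e]
  constructor
  · simp
    ring
  · simp
    ring

theorem corrector_eq (R₀ R₁ lam c₀ : ℝ) (x : Plane) :
    corrector R₀ R₁ lam c₀ x = lam * c₀ / 2 * ((principalHeight R₀ (x 0) - x 1) *
      (x 1 + principalHeight R₀ (x 0) - 2 * principalHeight R₁ (x 0))) := by
  unfold corrector
  ring

/-- An exact form of the error of the parabola, which makes its fourth order evident. -/
theorem circleHeight_sub_principalHeight {R : ℝ} (hR : 0 < R) {t : ℝ} (ht : |t| ≤ R) :
    circleHeight R t - principalHeight R t = circleHeight R t ^ 2 / (2 * R) := by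
  have h := circleHeight_mul ht
  have e : √(R ^ 2 - t ^ 2) = R - circleHeight R t := by rw [circleHeight]; ring
  rw [e] at h
  rw [principalHeight]
  field_simp
  linarith

theorem principalHeight_bounds (hR₀ : 0 < R₀) {R : ℝ} (hR : R₀ ≤ R) (t : ℝ) :
    0 ≤ principalHeight R t ∧ principalHeight R t ≤ t ^ 2 / R₀ := by
  have := hR₀.trans_le hR
  refine ⟨by unfold principalHeight; positivity, ?_⟩
  unfold principalHeight
  gcongr
  linarith

/-- In the cusp both functions are `O(t⁴)` with horizontal derivative `O(|t|³)`, so only the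
vertical derivatives, each `O(t²)`, must be compared. Their difference is `-λ c₀ χ ((1 - P)(x₂ - H₁)
+ (H₁ - H₁ᵖ))`, with `P` the thickness factor, hence `O(t⁴)`. Above the core the two cut-offs
disagree, which is harmless since `‖x‖ ≥ R₀` outside the cusp region. -/
theorem exists_bound_corrector_sub (hR₀ : 0 < R₀) (hR : R₀ < R₁) (hχ : IsCutoff R₀ χ)
    (lam c₀ : ℝ) :
    ∃ C : ℝ, 0 ≤ C ∧ ∀ x ∈ cuspidalAnnulus R₀ R₁,
      |χ (x 0) * corrector R₀ R₁ lam c₀ x - lam * c₀ / 2 * modelCorrector R₀ R₁ χ x| ≤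
        C * ‖x‖ ^ 4 ∧
      ‖gradient (fun y => χ (y 0) * corrector R₀ R₁ lam c₀ y) x -
        (lam * c₀ / 2) • gradient (modelCorrector R₀ R₁ χ) x‖ ≤ C * ‖x‖ ^ 3 := by
  obtain ⟨Cm, hCm, hm⟩ := exists_gradient_modelCorrector hR₀ hR hχ
  obtain ⟨Cp, hCp, hp⟩ := exists_deriv_thicknessFactor hR₀ hR
  obtain ⟨Cχ, hCχ, hχb⟩ := hχ.exists_bounds hR₀
  have hs : ContDiff ℝ 1 fun y : Plane => χ (y 0) * corrector R₀ R₁ lam c₀ y :=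
    ((hχ.smooth.comp (by fun_prop)).mul (contDiff_corrector R₀ R₁ lam c₀)).of_le (by simp)
  obtain ⟨Ca, hCa, ha⟩ := exists_bound_away_from_cusp (R₀ := R₀) (R₁ := R₁)
    (fun x _ _ => hs.contDiffAt (x := x)) hR₀
  set L := |lam * c₀| with hL
  have hL0 : 0 ≤ L := abs_nonneg _
  have hL2 : |lam * c₀ / 2| = L / 2 := by rw [abs_div, abs_two]
  refine ⟨(Ca / R₀ ^ 4 + Ca / R₀ ^ 3) + (L / R₀ ^ 2 + L / 2 * Cm) +
    (Cχ * (L / R₀) + L * (2 / R₀ ^ 2) + L * (Cp + 1 / R₀ ^ 2)), by positivity, fun x hx => ?_⟩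
  by_cases hxS : x ∈ cuspRegion R₀ R₁
  · obtain ⟨hm0, hg0, hg1⟩ := hm x hxS
    obtain ⟨-, hP, -⟩ := hp _ hxS.1
    obtain ⟨-, y0, y1, z0, z1, -⟩ := cuspRegion_bounds hR₀ hR hxS
    obtain ⟨hχ', -⟩ := hχb _ hxS.1.le
    obtain ⟨a0, a1⟩ := principalHeight_bounds hR₀ le_rfl (x 0)
    obtain ⟨b0, b1⟩ := principalHeight_bounds hR₀ hR.le (x 0)
    obtain ⟨gc0, gc1⟩ := gradient_corrector_apply R₀ R₁ lam c₀ x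
    have hb := circleHeight_sub_principalHeight (hR₀.trans hR) (hxS.1.le.trans hR.le)
    have hH1 := (circleHeight_le (hR₀.trans hR) (hxS.1.le.trans hR.le)).trans
      (by gcongr : x 0 ^ 2 / R₁ ≤ x 0 ^ 2 / R₀)
    have hH0 := circleHeight_nonneg (hR₀.trans hR).le (x 0)
    have hχ0 := hχ.nonneg (x 0)
    have hχ1 := hχ.le_one (x 0)
    have n3 := coord_pow_le x 3
    have n4 := coord_pow_le x 4
    set T := |x 0| with hT
    have hT0 : 0 ≤ T := abs_nonneg _
    have hTR : T ≤ R₀ := hxS.1.le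
    have hsq : x 0 ^ 2 = T ^ 2 := (sq_abs _).symm
    have h4 : x 0 ^ 4 = T ^ 4 := by rw [hT, Even.pow_abs (by decide)]
    rw [hsq] at hP y1 z1 a1 b1 hH1
    rw [h4] at hm0
    set s := T ^ 2 / R₀ with hsd
    have hs0 : 0 ≤ s := by positivity
    have hss : s ^ 2 = T ^ 4 / R₀ ^ 2 := by rw [hsd]; field_simp
    have hss3 : s ^ 2 ≤ T ^ 3 / R₀ := by
      rw [hss, div_le_div_iff₀ (by positivity) hR₀]
      calc T ^ 4 * R₀ = (T ^ 3 * R₀) * T := by ring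
        _ ≤ (T ^ 3 * R₀) * R₀ := by gcongr
        _ = _ := by ring
    have hc : |corrector R₀ R₁ lam c₀ x| ≤ L * s ^ 2 := by
      rw [corrector_eq, abs_mul, abs_mul, hL2]
      have e1 : |principalHeight R₀ (x 0) - x 1| ≤ s := abs_le.2 ⟨by linarith, by linarith⟩
      have e2 : |x 1 + principalHeight R₀ (x 0) - 2 * principalHeight R₁ (x 0)| ≤ 2 * s :=
        abs_le.2 ⟨by linarith, by linarith⟩
      calc _ ≤ L / 2 * (s * (2 * s)) := by gcongr
        _ = _ := by ring
    constructor
    · have h1 : |χ (x 0) * corrector R₀ R₁ lam c₀ x| ≤ L / R₀ ^ 2 * T ^ 4 := by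
        rw [abs_mul, abs_of_nonneg hχ0]
        calc _ ≤ 1 * (L * s ^ 2) := by gcongr
          _ = _ := by rw [hss]; ring
      have h2 : |lam * c₀ / 2 * modelCorrector R₀ R₁ χ x| ≤ L / 2 * Cm * T ^ 4 := by
        rw [abs_mul, hL2, abs_of_nonneg (modelCorrector_nonneg hχ x)]
        calc _ ≤ L / 2 * (Cm * T ^ 4) := by gcongr
          _ = _ := by ring
      calc _ ≤ (L / R₀ ^ 2 + L / 2 * Cm) * T ^ 4 := by
            rw [add_mul]
            exact (abs_sub _ _).trans (add_le_add h1 h2)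
        _ ≤ _ := by
            refine mul_le_mul ?_ n4 (by positivity) (by positivity)
            have : 0 ≤ Ca / R₀ ^ 4 + Ca / R₀ ^ 3 := by positivity
            have : 0 ≤ Cχ * (L / R₀) + L * (2 / R₀ ^ 2) + L * (Cp + 1 / R₀ ^ 2) := by positivity
            linarith
    · have hg := (hasGradientAt_comp_coord_zero (x := x)
        (hχ.smooth.differentiable (by simp) _).hasDerivAt).mul'
        ((contDiff_corrector R₀ R₁ lam c₀).differentiable (by simp) x).hasGradientAt
      have e0 : |χ (x 0) * gradient (corrector R₀ R₁ lam c₀) x 0 +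
          corrector R₀ R₁ lam c₀ x * deriv χ (x 0) -
          lam * c₀ / 2 * gradient (modelCorrector R₀ R₁ χ) x 0| ≤
          (L * (2 / R₀ ^ 2) + Cχ * (L / R₀) + L / 2 * Cm) * T ^ 3 := by
        have h1 : |χ (x 0) * gradient (corrector R₀ R₁ lam c₀) x 0| ≤
            L * (2 / R₀ ^ 2) * T ^ 3 := by
          rw [gc0, abs_mul, abs_mul, abs_of_nonneg hχ0]
          have q1 : |(principalHeight R₀ (x 0) - principalHeight R₁ (x 0)) * (x 0 / R₀)| ≤
              s * (T / R₀) := by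
            rw [abs_mul, abs_div, abs_of_pos hR₀]
            gcongr
            exact abs_le.2 ⟨by linarith, by linarith⟩
          have q2 : |x 0 / R₁ * (x 1 - principalHeight R₀ (x 0))| ≤ T / R₀ * s := by
            rw [abs_mul, abs_div, abs_of_pos (hR₀.trans hR)]
            gcongr
            exact abs_le.2 ⟨by linarith, by linarith⟩
          calc _ ≤ 1 * (L * (s * (T / R₀) + T / R₀ * s)) := by
                gcongr
                exact (abs_add_le _ _).trans (add_le_add q1 q2)
            _ = _ := by rw [hsd]; field_simp; ring
        have h2 : |corrector R₀ R₁ lam c₀ x * deriv χ (x 0)| ≤ Cχ * (L / R₀) * T ^ 3 := by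
          rw [abs_mul]
          calc _ ≤ (L * (T ^ 3 / R₀)) * Cχ := by
                gcongr
                exact hc.trans (by gcongr)
            _ = _ := by ring
        have h3 : |lam * c₀ / 2 * gradient (modelCorrector R₀ R₁ χ) x 0| ≤ L / 2 * Cm * T ^ 3 := by
          rw [abs_mul, hL2]
          calc _ ≤ L / 2 * (Cm * T ^ 3) := by gcongr
            _ = _ := by ring
        rw [add_mul, add_mul]
        exact (abs_sub _ _).trans (add_le_add ((abs_add_le _ _).trans (add_le_add h1 h2)) h3)
      have e1 : |χ (x 0) * gradient (corrector R₀ R₁ lam c₀) x 1 -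
          lam * c₀ / 2 * gradient (modelCorrector R₀ R₁ χ) x 1| ≤
          L * (Cp + 1 / R₀ ^ 2) * T ^ 3 := by
        have q : χ (x 0) * gradient (corrector R₀ R₁ lam c₀) x 1 -
            lam * c₀ / 2 * gradient (modelCorrector R₀ R₁ χ) x 1 =
            -(lam * c₀ * χ (x 0) *
              ((1 - thicknessFactor R₀ R₁ (x 0)) * (x 1 - circleHeight R₁ (x 0)) +
                (circleHeight R₁ (x 0) - principalHeight R₁ (x 0)))) := by
          rw [gc1, hg1]; ring
        rw [q, abs_neg, abs_mul, abs_mul, abs_of_nonneg hχ0, hb]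
        have q1 : |(1 - thicknessFactor R₀ R₁ (x 0)) * (x 1 - circleHeight R₁ (x 0))| ≤
            Cp * T ^ 3 := by
          rw [abs_mul, abs_of_pos z0]
          calc _ ≤ Cp * T ^ 2 * s := by gcongr
            _ = Cp * T ^ 3 * (T / R₀) := by rw [hsd]; ring
            _ ≤ Cp * T ^ 3 * 1 := by
              gcongr
              rwa [div_le_one hR₀]
            _ = _ := by ring
        have q2 : |circleHeight R₁ (x 0) ^ 2 / (2 * R₁)| ≤ 1 / R₀ ^ 2 * T ^ 3 := by
          have := hR₀.trans hR
          rw [abs_of_nonneg (by positivity)]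
          calc _ ≤ s ^ 2 / R₀ := by
                gcongr
                linarith
            _ ≤ T ^ 3 / R₀ / R₀ := by gcongr
            _ = _ := by field_simp
        calc _ ≤ L * 1 * (Cp * T ^ 3 + 1 / R₀ ^ 2 * T ^ 3) := by
              gcongr
              exact (abs_add_le _ _).trans (add_le_add q1 q2)
          _ = _ := by ring
      rw [hg.gradient]
      refine (norm_le_abs_add_abs _).trans ?_
      have f0 : (χ (x 0) • gradient (corrector R₀ R₁ lam c₀) x +
          corrector R₀ R₁ lam c₀ x • EuclideanSpace.single 0 (deriv χ (x 0)) -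
          (lam * c₀ / 2) • gradient (modelCorrector R₀ R₁ χ) x : Plane) 0 =
          χ (x 0) * gradient (corrector R₀ R₁ lam c₀) x 0 +
          corrector R₀ R₁ lam c₀ x * deriv χ (x 0) -
          lam * c₀ / 2 * gradient (modelCorrector R₀ R₁ χ) x 0 := by simp
      have f1 : (χ (x 0) • gradient (corrector R₀ R₁ lam c₀) x +
          corrector R₀ R₁ lam c₀ x • EuclideanSpace.single 0 (deriv χ (x 0)) -
          (lam * c₀ / 2) • gradient (modelCorrector R₀ R₁ χ) x : Plane) 1 =
          χ (x 0) * gradient (corrector R₀ R₁ lam c₀) x 1 -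
          lam * c₀ / 2 * gradient (modelCorrector R₀ R₁ χ) x 1 := by simp
      rw [f0, f1]
      calc _ ≤ (L * (2 / R₀ ^ 2) + Cχ * (L / R₀) + L / 2 * Cm) * T ^ 3 +
            L * (Cp + 1 / R₀ ^ 2) * T ^ 3 := add_le_add e0 e1
        _ = (L / 2 * Cm + (Cχ * (L / R₀) + L * (2 / R₀ ^ 2) + L * (Cp + 1 / R₀ ^ 2))) * T ^ 3 := by
            ring
        _ ≤ _ := by
            gcongr
            have : 0 ≤ Ca / R₀ ^ 4 + Ca / R₀ ^ 3 := by positivity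
            have : 0 ≤ L / R₀ ^ 2 := by positivity
            linarith
  · have h1 : modelCorrector R₀ R₁ χ x = 0 := by
      by_contra h
      exact hxS (mem_cuspRegion_of_modelCorrector_ne_zero hR₀ hR hχ hx h)
    have hxR : R₀ ≤ ‖x‖ := by
      by_contra! h
      exact hxS (mem_cuspRegion_of_norm_lt hR₀ hR hx h)
    obtain ⟨ha0, ha1⟩ := ha x hx hxR
    rw [gradient_modelCorrector_eq_zero hχ h1, h1, mul_zero, smul_zero, sub_zero, sub_zero]
    have t1 : 0 ≤ Ca / R₀ ^ 3 := by positivity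
    have t2 : 0 ≤ Ca / R₀ ^ 4 := by positivity
    have t3 : 0 ≤ (L / R₀ ^ 2 + L / 2 * Cm) +
      (Cχ * (L / R₀) + L * (2 / R₀ ^ 2) + L * (Cp + 1 / R₀ ^ 2)) := by positivity
    constructor
    · calc _ ≤ Ca / R₀ ^ 4 * R₀ ^ 4 := by rw [div_mul_cancel₀ _ (by positivity)]; exact ha0
        _ ≤ _ := by gcongr; linarith
    · calc _ ≤ Ca / R₀ ^ 3 * R₀ ^ 3 := by rw [div_mul_cancel₀ _ (by positivity)]; exact ha1
        _ ≤ _ := by gcongr; linarith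

theorem IsCuspDistance.memH1_corrector_sub (hR₀ : 0 < R₀) (hR : R₀ < R₁) (hχ : IsCutoff R₀ χ)
    (hρ : IsCuspDistance (cuspidalAnnulus R₀ R₁) ρ) (lam c₀ : ℝ) :
    MemH1 (cuspidalAnnulus R₀ R₁) fun x => (ρ x ^ 4)⁻¹ *
      (χ (x 0) * corrector R₀ R₁ lam c₀ x - lam * c₀ / 2 * modelCorrector R₀ R₁ χ x) := by
  obtain ⟨C, hC, hb⟩ := exists_bound_corrector_sub hR₀ hR hχ lam c₀
  have hs : ContDiff ℝ ∞ fun y : Plane => χ (y 0) * corrector R₀ R₁ lam c₀ y :=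
    (hχ.smooth.comp (by fun_prop)).mul (contDiff_corrector R₀ R₁ lam c₀)
  have hb' : ∀ {E : Type} [NormedAddCommGroup E] {g : Plane → E}, Continuous g →
      MemLp g 2 (volume.restrict (cuspidalAnnulus R₀ R₁)) := fun {E _ g} hg => by
    obtain ⟨B, hB⟩ := (isCompact_closure_cuspidalAnnulus (R₀ := R₀)
      (R₁ := R₁)).exists_bound_of_continuousOn hg.continuousOn
    exact MemLp.of_bound hg.aestronglyMeasurable B
      ((ae_restrict_iff' isOpen_cuspidalAnnulus.measurableSet).2
        (Eventually.of_forall fun x hx => hB x (subset_closure hx)))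
  have h1 : IsH1With (cuspidalAnnulus R₀ R₁) (fun y => χ (y 0) * corrector R₀ R₁ lam c₀ y)
      (gradient fun y => χ (y 0) * corrector R₀ R₁ lam c₀ y) :=
    ⟨hb' hs.continuous, hb' (continuous_gradient (hs.of_le (by simp))),
      hasWeakGradient_of_contDiffOn isOpen_cuspidalAnnulus hs.contDiffOn⟩
  exact hρ.memH1_weight hR₀ hR (h1.sub isOpen_cuspidalAnnulus.measurableSet
    ((isH10With_modelCorrector hR₀ hR hχ).const_mul isOpen_cuspidalAnnulus
      isClosed_innerBoundary (lam * c₀ / 2)).1) (fun x hx => (hb x hx).1) fun x hx => (hb x hx).2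

end Corrector

/-! ### Singularity of the corrector -/

section Singularity

variable {R₀ R₁ : ℝ} {χ : ℝ → ℝ} {ρ : Plane → ℝ}

/-- A region between two parabolas. -/
def parabolicWedge (p q ε : ℝ) : Set Plane :=
  {x | (0 < x 0 ∧ x 0 < ε) ∧ p * x 0 ^ 2 < x 1 ∧ x 1 < q * x 0 ^ 2}

theorem measurableSet_parabolicWedge (p q ε : ℝ) : MeasurableSet (parabolicWedge p q ε) := by
  have h0 : Continuous fun x : Plane => x 0 := by fun_prop
  have h1 : Continuous fun x : Plane => x 1 := by fun_prop
  exact (((isOpen_lt continuous_const h0).inter (isOpen_lt h0 continuous_const)).inter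
    ((isOpen_lt ((h0.pow 2).const_mul p) h1).inter
      (isOpen_lt h1 ((h0.pow 2).const_mul q)))).measurableSet

/-- The slice at `t` has length `(q - p) t²`, so the squared norm is `(q - p) ∫ t⁻² dt`, divergent
at zero. -/
theorem not_memLp_inv_sq_parabolicWedge {p q ε : ℝ} (hpq : p < q) (hε : 0 < ε) :
    ¬ MemLp (fun x : Plane => (x 0 ^ 2)⁻¹) 2 (volume.restrict (parabolicWedge p q ε)) := by
  intro h
  have hW := measurableSet_parabolicWedge p q ε
  have hi : ∫⁻ x in parabolicWedge p q ε, ENNReal.ofReal ((x 0 ^ 4)⁻¹) ≠ ⊤ := by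
    have h2 := h.integrable_sq
    have e : (fun x : Plane => (x 0 ^ 2)⁻¹ ^ 2) = fun x => (x 0 ^ 4)⁻¹ := by
      ext x
      rw [inv_pow, ← pow_mul]
    rw [e] at h2
    have := h2.2
    rw [hasFiniteIntegral_iff_ofReal (Eventually.of_forall fun x => by positivity)] at this
    exact this.ne
  have mA : Measurable fun x : Plane => ENNReal.ofReal ((x 0 ^ 4)⁻¹) :=
    ((measurable_coord 0).pow_const 4).inv.ennreal_ofReal
  rw [← lintegral_indicator hW, lintegral_slices (mA.indicator hW)] at hi
  have e : ∀ t : ℝ, ∫⁻ y : ℝ, (parabolicWedge p q ε).indicator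
      (fun x : Plane => ENNReal.ofReal ((x 0 ^ 4)⁻¹)) !₂[t, y] =
      (Set.Ioo 0 ε).indicator (fun t => ENNReal.ofReal ((q - p) * t ^ (-2 : ℝ))) t := by
    intro t
    by_cases ht : t ∈ Set.Ioo 0 ε
    · rw [Set.indicator_of_mem ht]
      have e1 : (fun y : ℝ => (parabolicWedge p q ε).indicator
          (fun x : Plane => ENNReal.ofReal ((x 0 ^ 4)⁻¹)) !₂[t, y]) =
          (Set.Ioo (p * t ^ 2) (q * t ^ 2)).indicator fun _ => ENNReal.ofReal ((t ^ 4)⁻¹) := by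
        ext y
        by_cases hy : y ∈ Set.Ioo (p * t ^ 2) (q * t ^ 2)
        · rw [Set.indicator_of_mem hy, Set.indicator_of_mem (show !₂[t, y] ∈ parabolicWedge p q ε from ⟨ht, hy⟩)]
          rfl
        · rw [Set.indicator_of_notMem hy, Set.indicator_of_notMem fun h => hy h.2]
      have ht0 := ht.1
      rw [e1, lintegral_indicator measurableSet_Ioo, setLIntegral_const, Real.volume_Ioo,
        ← ENNReal.ofReal_mul (by positivity), Real.rpow_neg ht0.le, Real.rpow_ofNat]
      congr 1
      field_simp
    · rw [Set.indicator_of_notMem ht]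
      refine (lintegral_congr fun y => Set.indicator_of_notMem (fun h => ht h.1) _).trans ?_
      simp
  rw [lintegral_congr e, lintegral_indicator measurableSet_Ioo] at hi
  have hint : IntegrableOn (fun t : ℝ => (q - p) * t ^ (-2 : ℝ)) (Set.Ioo 0 ε) := by
    refine ⟨?_, ?_⟩
    · exact ((measurable_id.pow_const (-2 : ℝ)).const_mul (q - p)).aestronglyMeasurable
    · rw [hasFiniteIntegral_iff_ofReal]
      · exact hi.lt_top
      · refine (ae_restrict_iff' measurableSet_Ioo).2 (Eventually.of_forall fun t ht => ?_)
        exact mul_nonneg (sub_nonneg.2 hpq.le) (Real.rpow_nonneg ht.1.le _)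
  have hint' : IntegrableOn (fun t : ℝ => t ^ (-2 : ℝ)) (Set.Ioo 0 ε) := by
    have := hint.const_mul (q - p)⁻¹
    refine this.congr (Eventually.of_forall fun t => ?_)
    simp only
    rw [inv_mul_cancel_left₀ (sub_pos.2 hpq).ne']
  rw [intervalIntegral.integrableOn_Ioo_rpow_iff hε] at hint'
  norm_num at hint'

theorem gradient_inv_norm_mul_corrector {x : Plane} (hx : x ≠ 0) (R₀ R₁ lam c₀ : ℝ) :
    gradient (fun y : Plane => (‖y‖ ^ 4)⁻¹ * corrector R₀ R₁ lam c₀ y) x 1 =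
      lam * c₀ * (‖x‖ ^ 4)⁻¹ * (principalHeight R₁ (x 0) - x 1) -
        4 * (‖x‖ ^ 6)⁻¹ * x 1 * corrector R₀ R₁ lam c₀ x := by
  have hx' : 0 < ‖x‖ := norm_pos_iff.2 hx
  have h := hasGradientAt_inv_pow (δ := 0) (x := x) (by positivity) 2
  simp only [add_zero, ← pow_mul] at h
  norm_num at h
  have h2 := h.mul' ((contDiff_corrector R₀ R₁ lam c₀).differentiable (by simp) x).hasGradientAt
  rw [h2.gradient]
  simp only [PiLp.add_apply, PiLp.smul_apply, PiLp.neg_apply, smul_eq_mul,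
    (gradient_corrector_apply R₀ R₁ lam c₀ x).2]
  ring

/-- The vertical derivative of the corrector is `λ c₀ (H₁ᵖ - x₂)`, comparable to `t²` away from the
outer parabola. Between the parabolas the corrector has the sign of `λ c₀`, so the derivative of the
weight contributes with the same sign and cannot cancel it. -/
theorem exists_wedge (hR₀ : 0 < R₀) (hR : R₀ < R₁) {lam c₀ : ℝ} (hlam : lam ≠ 0) (hc₀ : c₀ ≠ 0)
    {r : ℝ} (hr : 0 < r) :
    ∃ p q ε c : ℝ, p < q ∧ 0 < ε ∧ 0 < c ∧ ∀ x ∈ parabolicWedge p q ε,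
      x ∈ cuspidalAnnulus R₀ R₁ ∩ Metric.ball 0 r ∧
      c * (x 0 ^ 2)⁻¹ ≤ |gradient (fun y => (‖y‖ ^ 4)⁻¹ * corrector R₀ R₁ lam c₀ y) x 1| := by
  have hR₁ := hR₀.trans hR
  set K := |lam * c₀| with hK
  have hK0 : 0 < K := abs_pos.2 (mul_ne_zero hlam hc₀)
  set α := 1 / (2 * R₀) with hα
  set β := 1 / (2 * R₁) with hβ
  have hαp : 0 < α := by positivity
  have hβp : 0 < β := by positivity
  have hκ : β < α := by rw [hα, hβ]; gcongr
  have hαR : α * (2 * R₀) = 1 := by rw [hα]; field_simp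
  have hβR : β * (2 * R₁) = 1 := by rw [hβ]; field_simp
  -- `y < α t²` and `t` is small compared to each of these lengths
  obtain ⟨ε, hε, hε1, hε2, hε3⟩ : ∃ ε : ℝ, 0 < ε ∧ ε ≤ R₀ / 2 ∧ ε ≤ r / 2 ∧
      α ^ 2 * ε ^ 2 < R₁ * (α - β) := by
    have h1 : ∀ᶠ ε : ℝ in 𝓝[>] 0, ε ≤ R₀ / 2 := by
      filter_upwards [Ioo_mem_nhdsGT (half_pos hR₀)] with ε h using h.2.le
    have h2 : ∀ᶠ ε : ℝ in 𝓝[>] 0, ε ≤ r / 2 := by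
      filter_upwards [Ioo_mem_nhdsGT (half_pos hr)] with ε h using h.2.le
    have h3 : ∀ᶠ ε : ℝ in 𝓝[>] 0, α ^ 2 * ε ^ 2 < R₁ * (α - β) := by
      have ht : Tendsto (fun ε : ℝ => α ^ 2 * ε ^ 2) (𝓝[>] 0) (𝓝 (α ^ 2 * 0 ^ 2)) :=
        (Continuous.tendsto (by fun_prop) 0).mono_left nhdsWithin_le_nhds
      refine ht.eventually_lt_const ?_
      have : 0 < R₁ * (α - β) := mul_pos hR₁ (sub_pos.2 hκ)
      simpa using this
    obtain ⟨ε, h⟩ := (((h1.and h2).and h3).and self_mem_nhdsWithin).exists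
    exact ⟨ε, h.2, h.1.1.1, h.1.1.2, h.1.2⟩
  -- The wedge stays between one half and three quarters of the gap between the parabolas: the first
  -- gives the lower bound for the derivative and room for the true outer circle, the second keeps
  -- it below the inner one. The constant `1 / 16` combines `n⁻⁴ ≥ t⁻⁴ / 4` with `D / 4`, which is
  -- less than the available `D / 2`.
  refine ⟨β + (α - β) / 2, β + (α - β) * (3 / 4), ε, K * (α - β) / 16, by linarith, hε,
    by have := sub_pos.2 hκ; positivity, fun x ⟨⟨ht0, htε⟩, hy0, hy1⟩ => ?_⟩
  set t := x 0 with ht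
  set y := x 1 with hy
  have ht2 : 0 < t ^ 2 := by positivity
  have hyp : 0 < y := by
    have : 0 < (β + (α - β) / 2) * t ^ 2 := mul_pos (by linarith) ht2
    linarith
  have hya : y < α * t ^ 2 := by
    have : (β + (α - β) * (3 / 4)) * t ^ 2 ≤ α * t ^ 2 := by gcongr; linarith
    linarith
  have hyt : y ≤ t / 4 := by
    have h1 : α * t ^ 2 ≤ t / 4 := by
      rw [hα, div_mul_eq_mul_div, one_mul, div_le_iff₀ (by positivity)]
      nlinarith
    linarith
  have hyR : y ≤ R₀ / 8 := by linarith
  have hn : ‖x‖ ^ 2 = t ^ 2 + y ^ 2 := norm_sq_eq x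
  have hy2 : y ^ 2 ≤ t ^ 2 / 16 := by nlinarith
  have hx0 : x ≠ 0 := by
    intro h
    rw [ht, h] at ht0
    simp at ht0
  have hnp : 0 < ‖x‖ := norm_pos_iff.2 hx0
  have hΩ : x ∈ cuspidalAnnulus R₀ R₁ := by
    rw [mem_cuspidalAnnulus hR₀ hR₁]
    constructor
    · have h1 : y ^ 2 < R₁ * (α - β) * t ^ 2 := by
        calc y ^ 2 ≤ (α * t ^ 2) ^ 2 := by gcongr
          _ = (α ^ 2 * t ^ 2) * t ^ 2 := by ring
          _ ≤ (α ^ 2 * ε ^ 2) * t ^ 2 := by gcongr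
          _ < _ := by gcongr
      have h2 : 2 * R₁ * ((β + (α - β) / 2) * t ^ 2) < 2 * R₁ * y := by gcongr
      have h3 : 2 * R₁ * ((β + (α - β) / 2) * t ^ 2) =
          t ^ 2 + R₁ * (α - β) * t ^ 2 := by linear_combination t ^ 2 * hβR
      linarith
    · have h2 : 2 * R₀ * y < 2 * R₀ * (α * t ^ 2) := by gcongr
      have h3 : 2 * R₀ * (α * t ^ 2) = t ^ 2 := by linear_combination t ^ 2 * hαR
      nlinarith
  have hball : ‖x‖ < r := by
    have h1 : ‖x‖ ≤ |t| + |y| := norm_le_abs_add_abs x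
    rw [abs_of_pos ht0, abs_of_pos hyp] at h1
    linarith
  refine ⟨⟨hΩ, mem_ball_zero_iff.2 hball⟩, ?_⟩
  rw [gradient_inv_norm_mul_corrector hx0, corrector_eq]
  have ea : principalHeight R₀ (x 0) = α * t ^ 2 := by rw [principalHeight, hα]; ring
  have eb : principalHeight R₁ (x 0) = β * t ^ 2 := by rw [principalHeight, hβ]; ring
  rw [ea, eb, ← hy]
  set D := (α - β) * t ^ 2 with hD
  have hDp : 0 < D := mul_pos (sub_pos.2 hκ) ht2
  set n := ‖x‖ with hnd
  have e : lam * c₀ * (n ^ 4)⁻¹ * (β * t ^ 2 - y) - 4 * (n ^ 6)⁻¹ * y *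
      (lam * c₀ / 2 * ((α * t ^ 2 - y) * (y + α * t ^ 2 - 2 * (β * t ^ 2)))) =
      -(lam * c₀ * ((n ^ 4)⁻¹ * ((y - β * t ^ 2) +
        2 * y * ((α * t ^ 2 - y) * (y + α * t ^ 2 - 2 * (β * t ^ 2))) / n ^ 2))) := by
    field_simp
    ring
  rw [e, abs_neg, abs_mul, ← hK]
  have h1 : D / 2 ≤ y - β * t ^ 2 := by
    have : (β + (α - β) / 2) * t ^ 2 = β * t ^ 2 + D / 2 := by rw [hD]; ring
    linarith
  have h2 : 0 ≤ 2 * y * ((α * t ^ 2 - y) * (y + α * t ^ 2 - 2 * (β * t ^ 2))) / n ^ 2 := by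
    have q1 : 0 ≤ α * t ^ 2 - y := by linarith
    have q2 : 0 ≤ y + α * t ^ 2 - 2 * (β * t ^ 2) := by
      have : α * t ^ 2 = β * t ^ 2 + D := by rw [hD]; ring
      linarith
    positivity
  have h3 : (1 / 4) * (t ^ 4)⁻¹ ≤ (n ^ 4)⁻¹ := by
    have q : n ^ 4 ≤ 4 * t ^ 4 := by
      calc n ^ 4 = (n ^ 2) ^ 2 := by ring
        _ ≤ (2 * t ^ 2) ^ 2 := by gcongr; linarith
        _ = _ := by ring
    calc (1 / 4) * (t ^ 4)⁻¹ = (4 * t ^ 4)⁻¹ := by field_simp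
      _ ≤ _ := by gcongr
  calc K * (α - β) / 16 * (t ^ 2)⁻¹ = K * (((1 / 4) * (t ^ 4)⁻¹) * (D / 4)) := by
        rw [hD]; field_simp; norm_num
    _ ≤ K * ((n ^ 4)⁻¹ * ((y - β * t ^ 2) +
        2 * y * ((α * t ^ 2 - y) * (y + α * t ^ 2 - 2 * (β * t ^ 2))) / n ^ 2)) := by
        gcongr
        linarith
    _ ≤ _ := by
        gcongr
        exact le_abs_self _

theorem isFiniteMeasure_restrict_inter (r : ℝ) :
    IsFiniteMeasure (volume.restrict (cuspidalAnnulus R₀ R₁ ∩ Metric.ball 0 r)) := by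
  rw [isFiniteMeasure_restrict]
  exact ((measure_mono Set.inter_subset_right).trans_lt measure_ball_lt_top).ne

/-- On a small ball `ρ` is the norm and the function is smooth in the open annulus, so its weak
gradient is the classical one. Square integrability there would carry over to `t⁻²` on the wedge. -/
theorem IsCuspDistance.not_memH1_corrector (hR₀ : 0 < R₀) (hR : R₀ < R₁)
    (hρ : IsCuspDistance (cuspidalAnnulus R₀ R₁) ρ) {lam c₀ : ℝ} (hlam : lam ≠ 0) (hc₀ : c₀ ≠ 0)
    {r : ℝ} (hr : 0 < r) :
    ¬ MemH1 (cuspidalAnnulus R₀ R₁ ∩ Metric.ball 0 r)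
      fun x => (ρ x ^ 4)⁻¹ * corrector R₀ R₁ lam c₀ x := by
  intro hH
  obtain ⟨s, hs, hρs⟩ := hρ.exists_radius
  set V := cuspidalAnnulus R₀ R₁ ∩ Metric.ball 0 (min r s) with hV
  have hVo : IsOpen V := isOpen_cuspidalAnnulus.inter Metric.isOpen_ball
  have := isFiniteMeasure_restrict_inter (R₀ := R₀) (R₁ := R₁) (min r s)
  set h : Plane → ℝ := fun x => (‖x‖ ^ 4)⁻¹ * corrector R₀ R₁ lam c₀ x with hh
  obtain ⟨G, hG⟩ : MemH1 V h := by
    refine (hH.mono (Set.inter_subset_inter_right _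
      (Metric.ball_subset_ball (min_le_left r s)))).congr hVo.measurableSet fun x hx => ?_
    simp only [hh]
    rw [hρs x hx.1 ((mem_ball_zero_iff.1 hx.2).trans_le (min_le_right _ _))]
  have hc : ContDiffOn ℝ ∞ h V := fun x hx => by
    have hx0 := ne_zero_of_mem_cuspidalAnnulus hR₀ hR hx.1
    exact (((contDiffAt_norm_pow hx0 4).inv (by positivity)).mul
      (contDiff_corrector R₀ R₁ lam c₀).contDiffAt).contDiffWithinAt
  have hae : G =ᵐ[volume.restrict V] gradient h :=
    hG.weakGradient.ae_eq hVo (locallyIntegrableOn_of_memLp_two hG.memLp_grad)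
      ((continuousOn_gradient hVo (hc.of_le (by simp))).locallyIntegrableOn hVo.measurableSet)
      (hasWeakGradient_of_contDiffOn hVo hc)
  have hL : MemLp (gradient h) 2 (volume.restrict V) := (memLp_congr_ae hae).1 hG.memLp_grad
  obtain ⟨p, q, ε, c, hpq, hε, hc0, hw⟩ := exists_wedge hR₀ hR hlam hc₀ (lt_min hr hs)
  refine not_memLp_inv_sq_parabolicWedge hpq hε ?_
  refine MemLp.of_le_mul (c := c⁻¹)
    (hL.mono_measure (Measure.restrict_mono (fun x hx => (hw x hx).1) le_rfl))
    (((measurable_coord 0).pow_const 2).inv.aestronglyMeasurable)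
    ((ae_restrict_iff' (measurableSet_parabolicWedge p q ε)).2
      (Eventually.of_forall fun x hx => ?_))
  rw [Real.norm_of_nonneg (by positivity), le_inv_mul_iff₀ hc0]
  exact (hw x hx).2.trans (abs_coord_le_norm _ 1)

end Singularity

end

/-! ### Conclusion: the two remainders and the three singular functions -/

theorem theorem2 (R₀ R₁ : ℝ) (hR₀ : 0 < R₀) (hR : R₀ < R₁)
    (lam c₀ : ℝ) (hlam : 0 ≤ lam)
    (u : Plane → ℝ) (hu : IsKissingSolution R₀ R₁ lam c₀ u)
    (χ : ℝ → ℝ) (hχ : IsCutoff R₀ χ)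
    (ρ : Plane → ℝ) (hρ : IsCuspDistance (cuspidalAnnulus R₀ R₁) ρ) :
    ∃ N : ℝ, 0 < N ∧
      MemH1 (cuspidalAnnulus R₀ R₁)
        (fun x => ρ x ^ (-N) * (u x - c₀ - χ (x 0) * corrector R₀ R₁ lam c₀ x)) ∧
      MemH10 (cuspidalAnnulus R₀ R₁) (innerBoundary R₀)
        (fun x => ρ x ^ (-N) *
          (u x - c₀ - cuspCutoff R₀ χ x * stretchedCorrector R₀ R₁ lam c₀ x)) ∧
      (lam ≠ 0 → c₀ ≠ 0 → ∀ r : ℝ, 0 < r →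
        ¬ MemH1 (cuspidalAnnulus R₀ R₁ ∩ Metric.ball 0 r) (fun x => ρ x ^ (-N) * (u x - c₀)) ∧
        ¬ MemH1 (cuspidalAnnulus R₀ R₁ ∩ Metric.ball 0 r)
          (fun x => ρ x ^ (-N) * corrector R₀ R₁ lam c₀ x) ∧
        ¬ MemH1 (cuspidalAnnulus R₀ R₁ ∩ Metric.ball 0 r)
          (fun x => ρ x ^ (-N) * stretchedCorrector R₀ R₁ lam c₀ x)) := by
  have hΩ := (isOpen_cuspidalAnnulus (R₀ := R₀) (R₁ := R₁)).measurableSet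
  have hpow : ∀ x ∈ cuspidalAnnulus R₀ R₁, ρ x ^ (-4 : ℝ) = (ρ x ^ 4)⁻¹ := fun x hx =>
    hρ.rpow_neg_four hR₀ hR hx
  obtain ⟨K, hK⟩ := hu.isH10With_remainder hR₀ hR hlam hχ
  have hrem := hρ.memH10_weight hR₀ hR hK
  have hrem1 : MemH1 (cuspidalAnnulus R₀ R₁) fun x => (ρ x ^ 4)⁻¹ *
      (u x - c₀ - lam * c₀ / 2 * modelCorrector R₀ R₁ χ x) := by
    obtain ⟨G, hG⟩ := hrem
    exact ⟨G, hG.1⟩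
  have hut : MemH1 (cuspidalAnnulus R₀ R₁) fun x => ρ x ^ (-4 : ℝ) *
      (u x - c₀ - χ (x 0) * corrector R₀ R₁ lam c₀ x) := by
    refine (hrem1.sub hΩ (hρ.memH1_corrector_sub hR₀ hR hχ lam c₀)).congr hΩ fun x hx => ?_
    simp only [hpow x hx]
    ring
  have huh : MemH10 (cuspidalAnnulus R₀ R₁) (innerBoundary R₀) fun x => ρ x ^ (-4 : ℝ) *
      (u x - c₀ - cuspCutoff R₀ χ x * stretchedCorrector R₀ R₁ lam c₀ x) := by
    obtain ⟨G, hG⟩ := hrem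
    refine ⟨G, hG.congr hΩ (fun x hx => ?_) EventuallyEq.rfl⟩
    simp only [hpow x hx, modelCorrector_eq hR₀ hR hχ lam c₀ hx]
  refine ⟨4, by norm_num, hut, huh, fun hlam0 hc₀ => ?_⟩
  have hm : ∀ r, MeasurableSet (cuspidalAnnulus R₀ R₁ ∩ Metric.ball 0 r) := fun r =>
    hΩ.inter measurableSet_ball
  have hfin := isFiniteMeasure_restrict_inter (R₀ := R₀) (R₁ := R₁)
  have hcor : ∀ r : ℝ, 0 < r → ¬ MemH1 (cuspidalAnnulus R₀ R₁ ∩ Metric.ball 0 r)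
      fun x => ρ x ^ (-4 : ℝ) * corrector R₀ R₁ lam c₀ x := fun r hr h =>
    hρ.not_memH1_corrector hR₀ hR hlam0 hc₀ hr (h.congr (hm r) fun x hx => by
      simp only [hpow x hx.1])
  have hu0 : ∀ r : ℝ, 0 < r → ¬ MemH1 (cuspidalAnnulus R₀ R₁ ∩ Metric.ball 0 r)
      fun x => ρ x ^ (-4 : ℝ) * (u x - c₀) := by
    intro r hr h
    -- On the smaller ball `χ = 1`, so there the weighted corrector is the weighted `u - c₀` minus
    -- the weighted `ũ`.
    refine hcor (min r (R₀ / 2)) (lt_min hr (half_pos hR₀)) ?_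
    have := hfin (min r (R₀ / 2))
    refine ((h.mono (Set.inter_subset_inter_right _ (Metric.ball_subset_ball
      (min_le_left _ _)))).sub (hm _) (hut.mono Set.inter_subset_left)).congr (hm _)
      fun x hx => ?_
    have hx1 : χ (x 0) = 1 := hχ.eq_one _ ((abs_coord_le_norm x 0).trans
      ((mem_ball_zero_iff.1 hx.2).le.trans (min_le_right _ _)))
    simp only [hx1]
    ring
  refine fun r hr => ⟨hu0 r hr, hcor r hr, fun h => ?_⟩
  refine hu0 (min r (R₀ / 2)) (lt_min hr (half_pos hR₀)) ?_
  have := hfin (min r (R₀ / 2))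
  -- The remainder `û` is taken with the opposite sign, so that subtracting it from the weighted
  -- stretched corrector leaves the weighted `u - c₀`.
  have huh1 : MemH1 (cuspidalAnnulus R₀ R₁) fun x => ρ x ^ (-4 : ℝ) *
      (cuspCutoff R₀ χ x * stretchedCorrector R₀ R₁ lam c₀ x - (u x - c₀)) := by
    obtain ⟨G, hG⟩ := huh
    refine ⟨_, (hG.const_mul isOpen_cuspidalAnnulus isClosed_innerBoundary (-1)).1.congr hΩ
      (fun x _ => ?_) EventuallyEq.rfl⟩
    ring
  refine ((h.mono (Set.inter_subset_inter_right _ (Metric.ball_subset_ball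
    (min_le_left _ _)))).sub (hm _) (huh1.mono Set.inter_subset_left)).congr (hm _)
    fun x hx => ?_
  have hxn := (mem_ball_zero_iff.1 hx.2).le.trans (min_le_right _ _)
  have hx1 : cuspCutoff R₀ χ x = 1 := by
    rw [cuspCutoff, if_pos (((le_abs_self _).trans (abs_coord_le_norm x 1)).trans_lt (by linarith)),
      hχ.eq_one _ ((abs_coord_le_norm x 0).trans hxn)]
  simp only [hx1]
  ring
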